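/- **Setting.** Let $m\ge 1$, let $\mathbb P^1,\dots,\mathbb P^m$ be probability distributions on a sample space and $\lambda>0$. Assume there are $G,L,M>0$ and $\kappa$ such that, for every task $i\in[m]$: the loss $\ell^i(\cdot;\xi):\mathbb R^n\to\mathbb R$ is $G$-Lipschitz and $L$-smooth for all $\xi$; for every $\theta$, $\ell^i(\theta;\cdot)$ has variance at most $\kappa^2$ under $\mathbb P^i$. Let $f:[0,\infty)\to(-\infty,\infty]$ be convex with $f(1)=0$, $f(0)=\lim_{t\to0^+}f(t)$, and with conjugate $f^*(s)=\sup_{t\ge0}\{st-f(t)\}$ finite and $M$-smooth. Put $$L^i(\theta,\eta^i)=\lambda\,\mathbb E_{\xi\sim\mathbb P^i}\Big[f^*\Big(\frac{\ell^i(\theta;\xi)-\eta^i}{\lambda}\Big)\Big]+\eta^i,\qquad \hat L^i(\theta,\eta^i)=L^i(\theta,G\sqrt m\,\eta^i),$$ and assume $L^{i,*}=\inf_{\theta,\eta^i}L^i(\theta,\eta^i)>-\infty$. Let $\nabla_\theta\hat L(\theta,\eta)\in\mathbb R^{n\times m}$ have columns $\nabla_\theta\hat L^i(\theta,\eta^i)$,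 let $\nabla_\eta\hat L(\theta,\eta)=\mathrm{diag}(\partial_{\eta^i}\hat L^i(\theta,\eta^i))\in\mathbb R^{m\times m}$, and let $\nabla_{\theta,\eta}\hat L\in\mathbb R^{(n+m)\times m}$ be the two stacked. Let $\mathcal W$ be the probability simplex in $\mathbb R^m$, $\Pi_{\mathcal W}$ the Euclidean projection onto it, and $\|\cdot\|$ the Euclidean norm. **Algorithm (Double-Clip MGDA).** From $\theta_0\in\mathbb R^n$, $\eta_0\in\mathbb R^m$, $w_0\in\mathcal W$ iterate, for $t=0,\dots,T-1$, $$\eta_{t+1}=\eta_t-\gamma\mu_tZ_tw_t,\quad \theta_{t+1}=\theta_t-\gamma\alpha_tX_tw_t,\quad w_{t+1}=\Pi_{\mathcal W}\big(w_t-\beta[\alpha_tX_t^\top X_tw_t+\mu_tZ_t^\top Z_tw_t+\rho w_t]\big),$$ $$\mu_t=\min\{\tfrac12,\delta\epsilon/\|Z_tw_t\|\},\qquad \alpha_t=\min\{\tfrac12,\delta\epsilon/\|X_tw_t\|\},$$ where $Z_t$ and $X_t$ are the mini-batch estimators of $\nabla_\eta\hat L(\theta_t,\eta_t)$ and $\nabla_\theta\hat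 L(\theta_t,\eta_{t+1})$ with batch sizes $N_2$ and $N_1$; all draws in all batches are independent, and each draw supplies, for each task $i$, a sample with law $\mathbb P^i$ (the samples of different tasks within one draw may be dependent). **Constants.** Put $\Delta=\max_i\{\hat L^i(\theta_0,\eta_0^i)-L^{i,*}\}$, $\hat L_0=L+G^2M/\lambda$, $\hat L_1=L/(G\sqrt m)$, $\hat L_2=G^2Mm/\lambda$, $\hat K_0=8G^2+10G^2M^2\kappa^2/\lambda^2$, $\hat K_1=8/m$, $\hat K_2=mG^2M^2\kappa^2/\lambda^2$ and, for $\bar F>0$, $\Lambda_1=\sup\{u\ge0: u^2\le2\hat L_2\bar F(u+1)\}$. **Theorem.** There are absolute constants $c,C>0$ such that in the above setting, for all $\theta_0,\eta_0$, the following holds. (a) Let $\delta,\epsilon\in(0,1)$, $d,\vartheta>0$, $\bar F\ge Cm(\Delta+d)/\delta$, with $\delta\epsilon\, m\sqrt{\Delta}\le c$ and $\delta\epsilon\le c\sqrt{\beta/\gamma}$, and let $0\le\rho\le c\,\delta^2\epsilon^2$, $$0<\beta\le c\min\Big\{\frac1{mG^2+m\Lambda_1^2+1},\frac1{m\delta^3\epsilon^2}\Big\},$$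 $$0<\gamma\le\min\Big\{\frac{c}{\hat L_0+\hat L_1\Lambda_1},\ \frac{c}{\hat L_2+\vartheta\hat L_1^2\hat L_2^2},\ \Big(\frac{c\,\vartheta}{\delta^2\epsilon^2}\Big)^{1/3},\ d\,\beta\Big\},$$ $$N_1\ge C\max\Big\{\frac{\hat K_0}{\delta^3\epsilon^2},\frac{\hat K_1}{\delta},\frac{\Lambda_1^2\hat K_1}{\delta^3\epsilon^2}\Big\},\qquad N_2\ge C\,\frac{\hat K_2}{\delta^3\epsilon^2},\qquad N_1,N_2\ge1,$$ $$C\max\Big\{\frac{\Delta}{\gamma},\frac1\beta\Big\}\delta^{-2}\epsilon^{-2}\le T\le 2C\max\Big\{\frac{\Delta}{\gamma},\frac1\beta\Big\}\delta^{-2}\epsilon^{-2}.$$ Then, for every $w_0\in\mathcal W$, with probability at least $1-\delta$, $$\frac1T\sum_{t=0}^{T-1}\big\|\nabla_{\theta,\eta}\hat L(\theta_t,\eta_{t+1})w_t\big\|\le34\,\epsilon .$$ (b) For every $\delta\in(0,1)$ there are $\bar F,d,\vartheta,\gamma,\beta$, $\epsilon_0>0$ and $K$, independent of $\epsilon$,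 such that for every $\epsilon\in(0,\epsilon_0)$ there are $\rho>0$, $T,N_1,N_2$ that satisfy all the requirements of (a) and $T\,(N_1+N_2)\le K\epsilon^{-4}$; that is, the sample complexity is $\mathcal O(\epsilon^{-4})$. -/

import Mathlib

open Set Filter Topology MeasureTheory ProbabilityTheory
open scoped NNReal ENNReal BigOperators

noncomputable section

namespace DRMOO

/-- Euclidean space `ℝ^k` with the `ℓ²` norm. -/
abbrev Vec (k : ℕ) : Type := EuclideanSpace ℝ (Fin k)

/-! ### The problem -/

/-- Data of a distributionally robust multi-objective problem with `m` tasks and model parameters in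
`ℝ^n`: losses `ℓ^i(θ; ξ)`, nominal distributions `ℙ^i`, the divergence base function
`f : [0, ∞) → (-∞, ∞]` and the regularization weight `λ`. -/
structure Problem (n m : ℕ) (Ξ : Type*) [MeasurableSpace Ξ] where
  loss : Fin m → Vec n → Ξ → ℝ
  P : Fin m → Measure Ξ
  f : ℝ≥0 → EReal
  lam : ℝ

/-- The convex conjugate `f^*(s) = sup_{t ≥ 0} (s t - f(t))`, with values in `[-∞, ∞]`. -/
def conjE (f : ℝ≥0 → EReal) (s : ℝ) : EReal :=
  ⨆ t : ℝ≥0, (((s * (t : ℝ) : ℝ) : EReal) - f t)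

/-- The convex conjugate as a real function (used only where `conjE f` is finite). -/
def conj (f : ℝ≥0 → EReal) (s : ℝ) : ℝ := (conjE f s).toReal

variable {n m : ℕ} {Ξ : Type*} [MeasurableSpace Ξ]

/-- The standing assumptions on the losses, the distributions and the divergence. -/
structure StandingAssumptions (D : Problem n m Ξ) (G L M κ : ℝ) : Prop where
  G_pos : 0 < G
  L_pos : 0 < L
  M_pos : 0 < M
  lam_pos : 0 < D.lam
  prob : ∀ i, IsProbabilityMeasure (D.P i)
  measurable_loss : ∀ i θ, Measurable (D.loss i θ)
  /-- `ℓ^i(·; ξ)` is `G`-Lipschitz. -/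
  lipschitz : ∀ i ξ θ θ', |D.loss i θ ξ - D.loss i θ' ξ| ≤ G * ‖θ - θ'‖
  /-- `ℓ^i(·; ξ)` is `L`-smooth. -/
  differentiable : ∀ i ξ, Differentiable ℝ (fun θ => D.loss i θ ξ)
  smooth : ∀ i ξ θ θ',
    ‖gradient (fun x => D.loss i x ξ) θ - gradient (fun x => D.loss i x ξ) θ'‖ ≤ L * ‖θ - θ'‖
  /-- The variance of `ℓ^i(θ; ·)` under `ℙ^i` is at most `κ²`. -/
  memLp_loss : ∀ i θ, MemLp (D.loss i θ) 2 (D.P i)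
  variance_le : ∀ i θ, variance (D.loss i θ) (D.P i) ≤ κ ^ 2
  /-- `f` is convex with values in `(-∞, ∞]`, `f(1) = 0` and `f(0) = lim_{t → 0+} f(t)`. -/
  f_ne_bot : ∀ t, D.f t ≠ ⊥
  f_convex : ∀ x y a b : ℝ≥0, a + b = 1 →
    D.f (a * x + b * y) ≤ ((a : ℝ) : EReal) * D.f x + ((b : ℝ) : EReal) * D.f y
  f_one : D.f 1 = 0
  f_zero : Tendsto D.f (𝓝[>] 0) (𝓝 (D.f 0))
  /-- `f^*` is finite and `M`-smooth. -/
  conj_ne_top : ∀ s, conjE D.f s ≠ ⊤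
  conj_differentiable : Differentiable ℝ (conj D.f)
  conj_smooth : ∀ s s', |deriv (conj D.f) s - deriv (conj D.f) s'| ≤ M * |s - s'|

/-! ### Dual objectives and their rescaling -/

/-- `L^i(θ, η) = λ 𝔼_{ξ ∼ ℙ^i}[f^*((ℓ^i(θ; ξ) - η) / λ)] + η`. -/
def dual (D : Problem n m Ξ) (i : Fin m) (θ : Vec n) (η : ℝ) : ℝ :=
  D.lam * (∫ ξ, conj D.f ((D.loss i θ ξ - η) / D.lam) ∂(D.P i)) + η

/-- The one-sample version `L^i(θ, η; ξ)`. -/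
def dualSample (D : Problem n m Ξ) (i : Fin m) (θ : Vec n) (η : ℝ) (ξ : Ξ) : ℝ :=
  D.lam * conj D.f ((D.loss i θ ξ - η) / D.lam) + η

/-- `L̂^i(θ, η) = L^i(θ, G √m η)`. -/
def Lhat (D : Problem n m Ξ) (G : ℝ) (i : Fin m) (θ : Vec n) (η : ℝ) : ℝ :=
  dual D i θ (G * √(m : ℝ) * η)

/-- The one-sample version `L̂^i(θ, η; ξ)`. -/
def LhatSample (D : Problem n m Ξ) (G : ℝ) (i : Fin m) (θ : Vec n) (η : ℝ) (ξ : Ξ) : ℝ :=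
  dualSample D i θ (G * √(m : ℝ) * η) ξ

/-- `L^{i,*} = inf_{θ, η} L^i(θ, η)`. -/
def dualInf (D : Problem n m Ξ) (i : Fin m) : ℝ := ⨅ p : Vec n × ℝ, dual D i p.1 p.2

/-- The initial gap `Δ = max_i (L̂^i(θ₀, η₀^i) - L^{i,*})`. -/
def initGap (D : Problem n m Ξ) (G : ℝ) (θ₀ : Vec n) (η₀ : Vec m) : ℝ :=
  ⨆ i : Fin m, (Lhat D G i θ₀ (η₀ i) - dualInf D i)

/-! ### Matrices with `m` columns, the simplex, clipping -/

/-- `A w` for the matrix with columns `A i`. -/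
def mulW {V : Type*} [NormedAddCommGroup V] [InnerProductSpace ℝ V]
    (A : Fin m → V) (w : Vec m) : V := ∑ i, w i • A i

/-- `Aᵀ A w` for the matrix with columns `A i`. -/
def gramW {V : Type*} [NormedAddCommGroup V] [InnerProductSpace ℝ V]
    (A : Fin m → V) (w : Vec m) : Vec m :=
  WithLp.toLp 2 (fun i => inner ℝ (A i) (mulW A w))

/-- The probability simplex `𝒲` in `ℝ^m`. -/
def simplex (m : ℕ) : Set (Vec m) := {w | WithLp.ofLp w ∈ stdSimplex ℝ (Fin m)}

/-- `u` is a Euclidean projection of `x` onto the simplex. -/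
def IsProjSimplex (x u : Vec m) : Prop := u ∈ simplex m ∧ ∀ v ∈ simplex m, ‖x - u‖ ≤ ‖x - v‖

/-- The Euclidean projection `Π_𝒲` onto the simplex. -/
def projSimplex (x : Vec m) : Vec m := Classical.epsilon (IsProjSimplex x)

theorem isProjSimplex_projSimplex (hm : 0 < m) (x : Vec m) :
    IsProjSimplex x (projSimplex x) := by
  apply Classical.epsilon_spec (p := IsProjSimplex x)
  have hc : IsCompact (simplex m) := by
    have h := (isCompact_stdSimplex ℝ (Fin m)).image
      (PiLp.continuous_toLp 2 (fun _ : Fin m => ℝ))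
    convert h using 1
    ext w
    constructor
    · intro hw
      exact ⟨WithLp.ofLp w, hw, rfl⟩
    · rintro ⟨v, hv, rfl⟩
      exact hv
  have hne : (simplex m).Nonempty :=
    ⟨WithLp.toLp 2 (Pi.single ⟨0, hm⟩ 1), single_mem_stdSimplex ℝ (⟨0, hm⟩ : Fin m)⟩
  obtain ⟨u, hu, hmin⟩ := hc.exists_isMinOn hne
    (f := fun v : Vec m => ‖x - v‖) (by fun_prop)
  exact ⟨u, hu, fun v hv => hmin hv⟩

/-- The clipped step factor `min {a, b / r}`, which is `a` for `r = 0`. -/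
def clip (a b r : ℝ) : ℝ := if r = 0 then a else min a (b / r)

/-! ### The gradients -/

/-- The `i`-th column `(∇_θ L̂^i(θ, η^i), 0, …, ∂_{η^i} L̂^i(θ, η^i), …, 0)` of the
`(n + m) × m` matrix `∇_{θ,η} L̂(θ, η)`. -/
def fullGrad (D : Problem n m Ξ) (G : ℝ) (θ : Vec n) (η : Vec m) (i : Fin m) :
    WithLp 2 (Vec n × Vec m) :=
  WithLp.toLp 2 (gradient (fun x => Lhat D G i x (η i)) θ,
    EuclideanSpace.single i (deriv (fun y => Lhat D G i θ y) (η i)))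

/-- The `i`-th column of the mini-batch estimator of the `n × m` matrix `∇_θ L̂(θ, η)`; in the
`j`-th draw of the batch, `ξ j i` is the sample of task `i`. -/
def gradThetaBatch (D : Problem n m Ξ) (G : ℝ) {B : ℕ} (ξ : Fin B → Fin m → Ξ)
    (θ : Vec n) (η : Vec m) (i : Fin m) : Vec n :=
  (B : ℝ)⁻¹ • ∑ j, gradient (fun x => LhatSample D G i x (η i) (ξ j i)) θ

/-- The `i`-th column of the mini-batch estimator of the diagonal matrix `∇_η L̂(θ, η)`. -/
def gradEtaBatch (D : Problem n m Ξ) (G : ℝ) {B : ℕ} (ξ : Fin B → Fin m → Ξ)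
    (θ : Vec n) (η : Vec m) (i : Fin m) : Vec m :=
  EuclideanSpace.single i
    ((B : ℝ)⁻¹ * ∑ j, deriv (fun y => LhatSample D G i θ y (ξ j i)) (η i))

/-! ### The algorithm -/

/-- Hyper-parameters of the analysis: `δ` (failure probability), `ε` (accuracy), the auxiliary
constants `F` (function gap bound), `d` (bound for `γ / β`), `ϑ`, and the parameters of the
algorithm: step sizes `γ`, `β`, regularization `ρ`, number `T` of iterations, batch sizes
`N₁` (for `θ`) and `N₂` (for `η`). -/
structure Params where
  δ : ℝ
  ε : ℝ
  F : ℝ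
  d : ℝ
  ϑ : ℝ
  γ : ℝ
  β : ℝ
  ρ : ℝ
  T : ℕ
  N₁ : ℕ
  N₂ : ℕ

/-- The iterate `(θ_t, η_t, w_t)`. -/
structure State (n m : ℕ) where
  θ : Vec n
  η : Vec m
  w : Vec m

/-- One iteration of Double-Clip MGDA with `c₁ = f₁ = 1/2` and `c₂ = f₂ = δ ε`, using the
mini-batch `ξ` for `Z_t` and the mini-batch `ξ'` for `X_t`. -/
def step (D : Problem n m Ξ) (G : ℝ) (h : Params)
    (ξ : Fin h.N₂ → Fin m → Ξ) (ξ' : Fin h.N₁ → Fin m → Ξ) (s : State n m) : State n m :=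
  let Z := gradEtaBatch D G ξ s.θ s.η
  let μ := clip (1 / 2) (h.δ * h.ε) ‖mulW Z s.w‖
  let η' := s.η - (h.γ * μ) • mulW Z s.w
  let X := gradThetaBatch D G ξ' s.θ η'
  let α := clip (1 / 2) (h.δ * h.ε) ‖mulW X s.w‖
  { θ := s.θ - (h.γ * α) • mulW X s.w
    η := η'
    w := projSimplex (s.w - h.β • (α • gramW X s.w + μ • gramW Z s.w + h.ρ • s.w)) }

/-- The iterates of the algorithm along given sequences of mini-batches. -/
def run (D : Problem n m Ξ) (G : ℝ) (h : Params)
    (ξ : ℕ → Fin h.N₂ → Fin m → Ξ) (ξ' : ℕ → Fin h.N₁ → Fin m → Ξ) (s₀ : State n m) :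
    ℕ → State n m
  | 0 => s₀
  | t + 1 => step D G h (ξ t) (ξ' t) (run D G h ξ ξ' s₀ t)

/-- `(1/T) ∑_{t<T} ‖∇_{θ,η} L̂(θ_t, η_{t+1}) w_t‖` for a sequence of iterates. -/
def avgBalancedGrad (D : Problem n m Ξ) (G : ℝ) (T : ℕ) (s : ℕ → State n m) : ℝ :=
  (1 / (T : ℝ)) * ∑ t ∈ Finset.range T, ‖mulW (fullGrad D G (s t).θ (s (t + 1)).η) (s t).w‖

/-- All draws of all mini-batches are mutually independent, and in each draw the sample of task `i`
has law `ℙ^i` (within one draw the samples of different tasks may be coupled arbitrarily). -/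
structure IsSampling (D : Problem n m Ξ) {Ω : Type*} [MeasurableSpace Ω] (μ : Measure Ω)
    {N₁ N₂ : ℕ} (ξ : ℕ → Fin N₂ → Ω → Fin m → Ξ) (ξ' : ℕ → Fin N₁ → Ω → Fin m → Ξ) :
    Prop where
  measurable_left : ∀ t j, Measurable (ξ t j)
  measurable_right : ∀ t j, Measurable (ξ' t j)
  law_left : ∀ t j i, μ.map (fun ω => ξ t j ω i) = D.P i
  law_right : ∀ t j i, μ.map (fun ω => ξ' t j ω i) = D.P i
  indep : iIndepFun
    (fun k : (ℕ × Fin N₂) ⊕ (ℕ × Fin N₁) =>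
      Sum.elim (fun p => ξ p.1 p.2) (fun p => ξ' p.1 p.2) k) μ

/-! ### The choice of the hyper-parameters -/

/-- `L̂₀ = L + G² M / λ`. -/
def L0hat (G L M lam : ℝ) : ℝ := L + G ^ 2 * M / lam

/-- `L̂₁ = L / (G √m)`. -/
def L1hat (m : ℕ) (G L : ℝ) : ℝ := L / (G * √(m : ℝ))

/-- `L̂₂ = G² M m / λ`. -/
def L2hat (m : ℕ) (G M lam : ℝ) : ℝ := G ^ 2 * M * m / lam

/-- `K̂₀ = 8 G² + 10 G² M² κ² / λ²`. -/
def K0hat (G M lam κ : ℝ) : ℝ := 8 * G ^ 2 + 10 * G ^ 2 * M ^ 2 * κ ^ 2 / lam ^ 2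

/-- `K̂₁ = 8 / m`. -/
def K1hat (m : ℕ) : ℝ := 8 / (m : ℝ)

/-- `K̂₂ = m G² M² κ² / λ²`. -/
def K2hat (m : ℕ) (G M lam κ : ℝ) : ℝ := m * G ^ 2 * M ^ 2 * κ ^ 2 / lam ^ 2

/-- `Λ₁ = sup {u ≥ 0 | u² ≤ 2 L̂₂ F (u + 1)}`. -/
def Lam1 (m : ℕ) (G M lam F : ℝ) : ℝ :=
  sSup {u : ℝ | 0 ≤ u ∧ u ^ 2 ≤ 2 * L2hat m G M lam * F * (u + 1)}

/-- The iteration scale `max {Δ / γ, 1 / β} δ⁻² ε⁻²`. -/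
def iterScale (Δ : ℝ) (h : Params) : ℝ :=
  max (Δ / h.γ) (1 / h.β) / (h.δ ^ 2 * h.ε ^ 2)

/-- The hyper-parameters are chosen as prescribed, where `c` is the constant in each `O(·)` and `C`
the constant in each `Ω(·)` and `Θ(·)`. -/
structure Admissible (c C : ℝ) (m : ℕ) (G L M lam κ Δ : ℝ) (h : Params) : Prop where
  δ_pos : 0 < h.δ
  δ_lt_one : h.δ < 1
  ε_pos : 0 < h.ε
  ε_lt_one : h.ε < 1
  d_pos : 0 < h.d
  ϑ_pos : 0 < h.ϑ
  γ_pos : 0 < h.γ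
  β_pos : 0 < h.β
  ρ_nonneg : 0 ≤ h.ρ
  N₁_pos : 0 < h.N₁
  N₂_pos : 0 < h.N₂
  /-- `F ≥ C m (Δ + d) / δ`. -/
  F_ge : C * (m * (Δ + h.d) / h.δ) ≤ h.F
  /-- `δ ε ≤ c / (m Δ^{1/2})`. -/
  acc_gap : h.δ * h.ε * (m * √Δ) ≤ c
  /-- `δ ε ≤ c (β / γ)^{1/2}`. -/
  acc_step : h.δ * h.ε ≤ c * √(h.β / h.γ)
  ρ_le : h.ρ ≤ c * (h.δ ^ 2 * h.ε ^ 2)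
  β_le : h.β * (m * G ^ 2 + m * Lam1 m G M lam h.F ^ 2 + 1) ≤ c
  β_le_acc : h.β * (m * h.δ ^ 3 * h.ε ^ 2) ≤ c
  γ_le_theta : h.γ * (L0hat G L M lam + L1hat m G L * Lam1 m G M lam h.F) ≤ c
  γ_le_eta : h.γ * (L2hat m G M lam + h.ϑ * L1hat m G L ^ 2 * L2hat m G M lam ^ 2) ≤ c
  γ_le_young : h.γ ^ 3 * (h.δ ^ 2 * h.ε ^ 2) ≤ c * h.ϑ
  γ_le_β : h.γ ≤ h.d * h.β
  N₁_ge : C * max (K0hat G M lam κ / (h.δ ^ 3 * h.ε ^ 2))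
      (max (K1hat m / h.δ) (Lam1 m G M lam h.F ^ 2 * K1hat m / (h.δ ^ 3 * h.ε ^ 2))) ≤ h.N₁
  N₂_ge : C * (K2hat m G M lam κ / (h.δ ^ 3 * h.ε ^ 2)) ≤ h.N₂
  T_ge : C * iterScale Δ h ≤ h.T
  T_le : (h.T : ℝ) ≤ 2 * C * iterScale Δ h

end DRMOO

end

/-! The conjugate of a function on `[0, ∞)` is nondecreasing, so the number `slope` is nonnegative.
It governs both one-sample derivatives: the θ-gradient is `slope • ∇ℓ` and the η-derivative is `G √m
(1 - slope)`. Hence the mean slope is `1 - ∂_η / (G √m)` (`integral_slope`), and the size of the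
θ-gradient, its local Lipschitz constant and its second moment are all controlled by `|∂_η|`
(`norm_gradTheta_le`, `norm_gradTheta_sub_le`, `integral_sampleGradTheta_sq_le`). In η the objective
is `L̂₂`-smooth and bounded below, so `∂_η² ≤ 2 L̂₂ · gap` (`gradEta_sq_le`). As long as every gap
is at most `F`, one therefore has `|∂_η| ≤ Λ₁`, and generalized smoothness becomes ordinary
smoothness.

Deterministic part: for each task `i` the potential is the gap plus `γ/(2β) ‖w - e_i‖²`. The weight
update is a projected gradient step on the clipped squared norms of the weighted gradients.
Comparing it with the vertex `e_i` (`weight_step`) replaces the inner product of column `i` with the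
step direction by the squared norm of that direction, so every task decreases by the same gain
`S_t`, up to estimation errors (`one_step_descent`). Clipping at level `b = δ ε` makes `S_t + b²`
dominate `b` times the norm (`mul_le_clip_half_mul_sq`), so summing `S_t` bounds the average norm
itself rather than its square (`mul_norm_fullGrad_le`).

Probabilistic part: the descent is valid only while the gaps stay below `F`, so the errors are
multiplied by the indicator of this event, which depends on past draws only. Fresh batches are
independent of that past, so the weighted errors have small expectation (`integral_stepErr_le`).
Markov's inequality is applied twice: once to a majorant `U` of all potentials, which shows that no
gap exceeds `F` before time `T` (`le_sum_of_gap_gt`), and once to the accumulated error `Y`, which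
gives the bound on the average. Each costs probability at most `δ/2`.

For the complexity, `F`, and with it `Λ₁` and the step sizes, can be fixed before `ε`; then `T` and
the batch sizes are both of order `ε⁻²`. -/

namespace DRMOO

variable {n m : ℕ} {Ξ : Type*} [MeasurableSpace Ξ]

/-! ### The conjugate -/

/-- The derivative of the conjugate `f^*` at `(ℓ^i(θ; ξ) - η) / λ`. -/
noncomputable def slope (D : Problem n m Ξ) (i : Fin m) (θ : Vec n) (η : ℝ) (ξ : Ξ) : ℝ :=
  deriv (conj D.f) ((D.loss i θ ξ - η) / D.lam)

/-- The gradient in `θ` of the one-sample objective. -/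
noncomputable def sampleGradTheta (D : Problem n m Ξ) (G : ℝ) (i : Fin m) (θ : Vec n) (η : ℝ)
    (ξ : Ξ) : Vec n :=
  slope D i θ (G * √(m : ℝ) * η) ξ • gradient (fun x => D.loss i x ξ) θ

/-- The derivative in `η` of the one-sample objective. -/
noncomputable def sampleGradEta (D : Problem n m Ξ) (G : ℝ) (i : Fin m) (θ : Vec n) (η : ℝ)
    (ξ : Ξ) : ℝ :=
  G * √(m : ℝ) * (1 - slope D i θ (G * √(m : ℝ) * η) ξ)

/-- The gradient in `θ` of the objective. -/
noncomputable def gradTheta (D : Problem n m Ξ) (G : ℝ) (i : Fin m) (θ : Vec n) (η : ℝ) : Vec n :=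
  ∫ ξ, sampleGradTheta D G i θ η ξ ∂(D.P i)

/-- The derivative in `η` of the objective. -/
noncomputable def gradEta (D : Problem n m Ξ) (G : ℝ) (i : Fin m) (θ : Vec n) (η : ℝ) : ℝ :=
  ∫ ξ, sampleGradEta D G i θ η ξ ∂(D.P i)

/-- Only multipliers `t ≥ 0` enter the supremum. This is the source of the sign of `slope`. -/
theorem conjE_mono (f : ℝ≥0 → EReal) : Monotone (conjE f) := by
  intro s s' h
  refine iSup_mono fun t => EReal.sub_le_sub ?_ le_rfl
  exact_mod_cast mul_le_mul_of_nonneg_right h t.2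

/-- The term `t = 1` gives `s ≤ f^*(s)`. Together with finiteness from above this lets monotonicity
pass through `toReal`. -/
theorem conjE_ne_bot {f : ℝ≥0 → EReal} (h1 : f 1 = 0) (s : ℝ) : conjE f s ≠ ⊥ := by
  have h : ((s : ℝ) : EReal) ≤ conjE f s := by
    refine le_trans ?_ (le_iSup _ (1 : ℝ≥0))
    simp [h1]
  intro hb
  rw [hb] at h
  exact EReal.coe_ne_bot s (le_bot_iff.1 h)

section

variable {D : Problem n m Ξ} {G L M κ : ℝ}

theorem StandingAssumptions.conj_mono (h : StandingAssumptions D G L M κ) :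
    Monotone (conj D.f) := fun s s' hs =>
  EReal.toReal_le_toReal (conjE_mono D.f hs) (conjE_ne_bot h.f_one s) (h.conj_ne_top s')

theorem StandingAssumptions.deriv_conj_nonneg (h : StandingAssumptions D G L M κ) (s : ℝ) :
    0 ≤ deriv (conj D.f) s := h.conj_mono.deriv_nonneg

theorem StandingAssumptions.slope_nonneg (h : StandingAssumptions D G L M κ) (i : Fin m)
    (θ : Vec n) (η : ℝ) (ξ : Ξ) : 0 ≤ slope D i θ η ξ := h.deriv_conj_nonneg _

theorem StandingAssumptions.continuous_deriv_conj (h : StandingAssumptions D G L M κ) :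
    Continuous (deriv (conj D.f)) := by
  have : LipschitzWith (Real.toNNReal M) (deriv (conj D.f)) := by
    refine LipschitzWith.of_dist_le_mul fun s s' => ?_
    rw [Real.dist_eq, Real.dist_eq, Real.coe_toNNReal _ h.M_pos.le]
    exact h.conj_smooth s s'
  exact this.continuous

/-- Linear growth of the derivative, hence quadratic growth of `f^*`: square integrability of the
loss then suffices for all expectations below. -/
theorem StandingAssumptions.abs_deriv_conj_le (h : StandingAssumptions D G L M κ) (s : ℝ) :
    |deriv (conj D.f) s| ≤ |deriv (conj D.f) 0| + M * |s| := by
  have h1 := h.conj_smooth s 0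
  have h2 := abs_sub_abs_le_abs_sub (deriv (conj D.f) s) (deriv (conj D.f) 0)
  rw [sub_zero] at h1
  linarith

theorem StandingAssumptions.abs_conj_le (h : StandingAssumptions D G L M κ) (s : ℝ) :
    |conj D.f s| ≤ |conj D.f 0| + (|deriv (conj D.f) 0| + M * |s|) * |s| := by
  have h1 := Convex.norm_image_sub_le_of_norm_deriv_le (f := conj D.f) (s := Metric.closedBall 0 |s|)
    (C := |deriv (conj D.f) 0| + M * |s|) (x := 0) (y := s)
    (fun x _ => h.conj_differentiable x) (fun x hx => ?_) (convex_closedBall _ _)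
    (by simp) (by simp)
  · have h2 := abs_sub_abs_le_abs_sub (conj D.f s) (conj D.f 0)
    simp only [Real.norm_eq_abs, sub_zero] at h1
    linarith
  · have hx' : |x| ≤ |s| := by simpa using hx
    have := mul_le_mul_of_nonneg_left hx' h.M_pos.le
    exact (h.abs_deriv_conj_le x).trans (by linarith)

/-! ### Measurability and integrability -/

theorem StandingAssumptions.continuous_loss (h : StandingAssumptions D G L M κ) (i : Fin m)
    (ξ : Ξ) : Continuous fun θ => D.loss i θ ξ := (h.differentiable i ξ).continuous

/-- Carathéodory argument: continuity in θ and measurability in ξ. Joint measurability is needed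
because the iterates are themselves random. -/
theorem StandingAssumptions.measurable_loss_uncurry (h : StandingAssumptions D G L M κ)
    (i : Fin m) : Measurable fun p : Vec n × Ξ => D.loss i p.1 p.2 :=
  measurable_uncurry_of_continuous_of_measurable (u := fun θ ξ => D.loss i θ ξ)
    (h.continuous_loss i) (h.measurable_loss i)

theorem StandingAssumptions.norm_gradient_loss_le (h : StandingAssumptions D G L M κ)
    (i : Fin m) (ξ : Ξ) (θ : Vec n) : ‖gradient (fun x => D.loss i x ξ) θ‖ ≤ G := by
  have h1 : LipschitzWith (Real.toNNReal G) (fun x => D.loss i x ξ) := by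
    refine LipschitzWith.of_dist_le_mul fun s s' => ?_
    rw [Real.dist_eq, dist_eq_norm, Real.coe_toNNReal _ h.G_pos.le]
    exact h.lipschitz i ξ s s'
  have h2 := norm_fderiv_le_of_lipschitz ℝ h1 (x₀ := θ)
  rwa [Real.coe_toNNReal _ h.G_pos.le, ← toDual_gradient, LinearIsometryEquiv.norm_map] at h2

theorem StandingAssumptions.continuous_gradient_loss (h : StandingAssumptions D G L M κ)
    (i : Fin m) (ξ : Ξ) : Continuous fun θ => gradient (fun x => D.loss i x ξ) θ := by
  have : LipschitzWith (Real.toNNReal L) fun θ => gradient (fun x => D.loss i x ξ) θ := by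
    refine LipschitzWith.of_dist_le_mul fun s s' => ?_
    rw [dist_eq_norm, dist_eq_norm, Real.coe_toNNReal _ h.L_pos.le]
    exact h.smooth i ξ s s'
  exact this.continuous

/-- Each coordinate of the gradient is a limit of difference quotients along a basis vector, and
these are measurable in ξ. -/
theorem StandingAssumptions.measurable_gradient_loss (h : StandingAssumptions D G L M κ)
    (i : Fin m) (θ : Vec n) : Measurable fun ξ => gradient (fun x => D.loss i x ξ) θ := by
  have hcoord : ∀ k : Fin n,
      Measurable fun ξ => gradient (fun x => D.loss i x ξ) θ k := by
    intro k
    set e : Vec n := EuclideanSpace.single k (1 : ℝ)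
    have hlim : ∀ ξ, Tendsto (fun N : ℕ => ((N : ℝ) + 1) *
        (D.loss i (θ + ((N : ℝ) + 1)⁻¹ • e) ξ - D.loss i θ ξ)) atTop
        (𝓝 (gradient (fun x => D.loss i x ξ) θ k)) := by
      intro ξ
      have hd := (h.differentiable i ξ θ).hasGradientAt.hasFDerivAt
      have h1 := hd.lim e (c := fun N : ℕ => ((N : ℝ) + 1)) (l := atTop) ?_
      · have h2 : (InnerProductSpace.toDual ℝ (Vec n)) (gradient (fun x => D.loss i x ξ) θ) e
            = gradient (fun x => D.loss i x ξ) θ k := by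
          rw [InnerProductSpace.toDual_apply_apply, EuclideanSpace.inner_single_right]
          simp
        rw [h2] at h1
        simpa [smul_eq_mul] using h1
      · exact tendsto_norm_atTop_atTop.comp
            (tendsto_atTop_add_const_right _ _ tendsto_natCast_atTop_atTop)
    refine measurable_of_tendsto_metrizable (fun N => ?_) (tendsto_pi_nhds.2 hlim)
    exact ((h.measurable_loss i _).sub (h.measurable_loss i _)).const_mul _
  have h2 : Measurable fun ξ => WithLp.toLp 2
      (fun k => gradient (fun x => D.loss i x ξ) θ k) :=
    (WithLp.measurable_toLp 2 _).comp (measurable_pi_lambda _ hcoord)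
  exact h2

theorem StandingAssumptions.measurable_gradient_loss_uncurry
    (h : StandingAssumptions D G L M κ) (i : Fin m) :
    Measurable fun p : Vec n × Ξ => gradient (fun x => D.loss i x p.2) p.1 :=
  measurable_uncurry_of_continuous_of_measurable
    (u := fun θ ξ => gradient (fun x => D.loss i x ξ) θ)
    (h.continuous_gradient_loss i) (h.measurable_gradient_loss i)

theorem StandingAssumptions.measurable_slope (h : StandingAssumptions D G L M κ) (i : Fin m) :
    Measurable fun p : (Vec n × ℝ) × Ξ => slope D i p.1.1 p.1.2 p.2 := by
  have h1 : Measurable fun p : (Vec n × ℝ) × Ξ => D.loss i p.1.1 p.2 :=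
    (h.measurable_loss_uncurry i).comp
      ((measurable_fst.comp measurable_fst).prodMk measurable_snd)
  have h2 : Measurable fun p : (Vec n × ℝ) × Ξ => (D.loss i p.1.1 p.2 - p.1.2) / D.lam :=
    (h1.sub (measurable_snd.comp measurable_fst)).div_const _
  exact h.continuous_deriv_conj.measurable.comp h2

theorem StandingAssumptions.measurable_slope_scaled (h : StandingAssumptions D G L M κ)
    (i : Fin m) (a : ℝ) :
    Measurable fun p : (Vec n × ℝ) × Ξ => slope D i p.1.1 (a * p.1.2) p.2 := by
  have h1 : Measurable fun p : (Vec n × ℝ) × Ξ => ((p.1.1, a * p.1.2), p.2) := by fun_prop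
  exact (h.measurable_slope i).comp h1

theorem StandingAssumptions.measurable_sampleGradTheta (h : StandingAssumptions D G L M κ)
    (i : Fin m) :
    Measurable fun p : (Vec n × ℝ) × Ξ => sampleGradTheta D G i p.1.1 p.1.2 p.2 := by
  have h2 : Measurable fun p : (Vec n × ℝ) × Ξ => gradient (fun x => D.loss i x p.2) p.1.1 :=
    (h.measurable_gradient_loss_uncurry i).comp
      ((measurable_fst.comp measurable_fst).prodMk measurable_snd)
  exact (h.measurable_slope_scaled i (G * √(m : ℝ))).smul h2

theorem StandingAssumptions.measurable_sampleGradEta (h : StandingAssumptions D G L M κ)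
    (i : Fin m) :
    Measurable fun p : (Vec n × ℝ) × Ξ => sampleGradEta D G i p.1.1 p.1.2 p.2 :=
  (measurable_const.sub (h.measurable_slope_scaled i (G * √(m : ℝ)))).const_mul _

theorem StandingAssumptions.measurable_gradTheta (h : StandingAssumptions D G L M κ)
    (i : Fin m) : Measurable fun p : Vec n × ℝ => gradTheta D G i p.1 p.2 := by
  have := h.prob i
  exact (StronglyMeasurable.integral_prod_right' (ν := D.P i)
    (h.measurable_sampleGradTheta i).stronglyMeasurable).measurable

theorem StandingAssumptions.measurable_gradEta (h : StandingAssumptions D G L M κ)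
    (i : Fin m) : Measurable fun p : Vec n × ℝ => gradEta D G i p.1 p.2 := by
  have := h.prob i
  exact (StronglyMeasurable.integral_prod_right' (ν := D.P i)
    (h.measurable_sampleGradEta i).stronglyMeasurable).measurable

theorem StandingAssumptions.measurable_Lhat (h : StandingAssumptions D G L M κ)
    (i : Fin m) : Measurable fun p : Vec n × ℝ => Lhat D G i p.1 p.2 := by
  have := h.prob i
  have h1 : Measurable fun p : (Vec n × ℝ) × Ξ => D.loss i p.1.1 p.2 :=
    (h.measurable_loss_uncurry i).comp
      ((measurable_fst.comp measurable_fst).prodMk measurable_snd)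
  have h2 : Measurable fun p : (Vec n × ℝ) × Ξ =>
      conj D.f ((D.loss i p.1.1 p.2 - G * √(m : ℝ) * p.1.2) / D.lam) :=
    h.conj_differentiable.continuous.measurable.comp
      ((h1.sub ((measurable_snd.comp measurable_fst).const_mul _)).div_const _)
  have h3 : Measurable fun p : Vec n × ℝ =>
      ∫ ξ, conj D.f ((D.loss i p.1 ξ - G * √(m : ℝ) * p.2) / D.lam) ∂(D.P i) :=
    (StronglyMeasurable.integral_prod_right' (ν := D.P i) h2.stronglyMeasurable).measurable
  exact (h3.const_mul _).add (measurable_snd.const_mul _)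

theorem StandingAssumptions.memLp_arg (h : StandingAssumptions D G L M κ) (i : Fin m)
    (θ : Vec n) (η : ℝ) : MemLp (fun ξ => (D.loss i θ ξ - η) / D.lam) 2 (D.P i) := by
  have := h.prob i
  have h1 := ((h.memLp_loss i θ).sub (memLp_const η)).const_mul (D.lam⁻¹)
  simpa only [div_eq_inv_mul, Pi.sub_apply] using h1

theorem StandingAssumptions.memLp_slope (h : StandingAssumptions D G L M κ) (i : Fin m)
    (θ : Vec n) (η : ℝ) : MemLp (slope D i θ η) 2 (D.P i) := by
  have := h.prob i
  have h0 : MemLp (fun ξ => M * ‖(D.loss i θ ξ - η) / D.lam‖) 2 (D.P i) :=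
    (h.memLp_arg i θ η).norm.const_mul M
  have hc : MemLp (fun _ : Ξ => |deriv (conj D.f) 0|) 2 (D.P i) := memLp_const _
  have h2 : Measurable (slope D i θ η) := h.continuous_deriv_conj.measurable.comp
    (((h.measurable_loss i θ).sub_const _).div_const _)
  refine (hc.add h0).of_le h2.aestronglyMeasurable (Eventually.of_forall fun ξ => ?_)
  exact (h.abs_deriv_conj_le _).trans (le_abs_self _)

theorem StandingAssumptions.integrable_slope (h : StandingAssumptions D G L M κ) (i : Fin m)
    (θ : Vec n) (η : ℝ) : Integrable (slope D i θ η) (D.P i) := by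
  have := h.prob i
  exact (h.memLp_slope i θ η).integrable (by norm_num)

theorem StandingAssumptions.integrable_conj (h : StandingAssumptions D G L M κ) (i : Fin m)
    (θ : Vec n) (η : ℝ) :
    Integrable (fun ξ => conj D.f ((D.loss i θ ξ - η) / D.lam)) (D.P i) := by
  have := h.prob i
  have hs := h.memLp_arg i θ η
  have h1 : Integrable (fun ξ => |conj D.f 0| + (|deriv (conj D.f) 0| *
      |(D.loss i θ ξ - η) / D.lam| + M * ((D.loss i θ ξ - η) / D.lam) ^ 2)) (D.P i) :=
    (integrable_const _).add (((hs.integrable (by norm_num)).abs.const_mul _).add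
      (hs.integrable_sq.const_mul M))
  refine h1.mono' (h.conj_differentiable.continuous.measurable.comp
    (((h.measurable_loss i θ).sub_const _).div_const _)).aestronglyMeasurable
    (Eventually.of_forall fun ξ => ?_)
  rw [Real.norm_eq_abs]
  refine (h.abs_conj_le _).trans (le_of_eq ?_)
  rw [← sq_abs ((D.loss i θ ξ - η) / D.lam)]
  ring

/-- The slope is kept instead of being bounded, since its mean and second moment can be expressed
through the η-derivative. -/
theorem StandingAssumptions.norm_sampleGradTheta_le (h : StandingAssumptions D G L M κ)
    (i : Fin m) (θ : Vec n) (η : ℝ) (ξ : Ξ) :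
    ‖sampleGradTheta D G i θ η ξ‖ ≤ G * slope D i θ (G * √(m : ℝ) * η) ξ := by
  rw [sampleGradTheta, norm_smul, Real.norm_eq_abs, abs_of_nonneg (h.slope_nonneg _ _ _ _), mul_comm]
  exact mul_le_mul_of_nonneg_right (h.norm_gradient_loss_le i ξ θ) (h.slope_nonneg _ _ _ _)

theorem StandingAssumptions.memLp_sampleGradTheta (h : StandingAssumptions D G L M κ)
    (i : Fin m) (θ : Vec n) (η : ℝ) : MemLp (sampleGradTheta D G i θ η) 2 (D.P i) := by
  have h2 : Measurable (sampleGradTheta D G i θ η) :=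
    (h.measurable_sampleGradTheta i).comp (measurable_prodMk_left (x := (θ, η)))
  refine ((h.memLp_slope i θ (G * √(m : ℝ) * η)).const_mul G).of_le h2.aestronglyMeasurable
    (Eventually.of_forall fun ξ => ?_)
  exact (h.norm_sampleGradTheta_le i θ η ξ).trans (le_abs_self _)

theorem StandingAssumptions.integrable_sampleGradTheta (h : StandingAssumptions D G L M κ)
    (i : Fin m) (θ : Vec n) (η : ℝ) : Integrable (sampleGradTheta D G i θ η) (D.P i) := by
  have := h.prob i
  exact (h.memLp_sampleGradTheta i θ η).integrable (by norm_num)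

theorem StandingAssumptions.memLp_sampleGradEta (h : StandingAssumptions D G L M κ)
    (i : Fin m) (θ : Vec n) (η : ℝ) : MemLp (sampleGradEta D G i θ η) 2 (D.P i) := by
  have := h.prob i
  exact ((memLp_const 1).sub (h.memLp_slope i θ (G * √(m : ℝ) * η))).const_mul _

theorem StandingAssumptions.integrable_sampleGradEta (h : StandingAssumptions D G L M κ)
    (i : Fin m) (θ : Vec n) (η : ℝ) : Integrable (sampleGradEta D G i θ η) (D.P i) := by
  have := h.prob i
  exact (h.memLp_sampleGradEta i θ η).integrable (by norm_num)

/-! ### Differentiation under the expectation -/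

theorem StandingAssumptions.hasGradientAt_conj_loss (h : StandingAssumptions D G L M κ)
    (i : Fin m) (θ : Vec n) (η : ℝ) (ξ : Ξ) :
    HasGradientAt (fun x => conj D.f ((D.loss i x ξ - η) / D.lam))
      (D.lam⁻¹ • slope D i θ η ξ • gradient (fun x => D.loss i x ξ) θ) θ := by
  have h1 := (h.differentiable i ξ θ).hasGradientAt.hasFDerivAt
  have h2 := (h1.sub_const η).mul_const (D.lam⁻¹)
  have h3 := (h.conj_differentiable ((D.loss i θ ξ - η) / D.lam)).hasDerivAt.comp_hasFDerivAt θ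
    (f := fun x => (D.loss i x ξ - η) / D.lam) (by simpa only [div_eq_mul_inv] using h2)
  rw [hasGradientAt_iff_hasFDerivAt]
  refine h3.congr_fderiv ?_
  rw [smul_comm D.lam⁻¹, map_smulₛₗ, map_smulₛₗ]
  rfl

theorem StandingAssumptions.hasDerivAt_conj_eta (h : StandingAssumptions D G L M κ)
    (i : Fin m) (θ : Vec n) (a η : ℝ) (ξ : Ξ) :
    HasDerivAt (fun y => conj D.f ((D.loss i θ ξ - a * y) / D.lam))
      (-(a / D.lam) * slope D i θ (a * η) ξ) η := by
  have h1 : HasDerivAt (fun y => (D.loss i θ ξ - a * y) / D.lam) (-(a / D.lam)) η := by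
    have h0 := (((hasDerivAt_id η).const_mul a).const_sub (D.loss i θ ξ)).div_const D.lam
    simpa [neg_div] using h0
  have h2 := (h.conj_differentiable ((D.loss i θ ξ - a * η) / D.lam)).hasDerivAt.comp η h1
  rw [mul_comm]
  exact h2

theorem StandingAssumptions.hasGradientAt_LhatSample (h : StandingAssumptions D G L M κ)
    (i : Fin m) (θ : Vec n) (η : ℝ) (ξ : Ξ) :
    HasGradientAt (fun x => LhatSample D G i x η ξ) (sampleGradTheta D G i θ η ξ) θ := by
  have h1 := (h.hasGradientAt_conj_loss i θ (G * √(m : ℝ) * η) ξ).hasFDerivAt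
  have h2 := (h1.const_mul D.lam).add_const (G * √(m : ℝ) * η)
  rw [hasGradientAt_iff_hasFDerivAt]
  refine h2.congr_fderiv ?_
  rw [map_smulₛₗ, smul_smul]
  simp only [conj_trivial, mul_inv_cancel₀ h.lam_pos.ne', one_smul]
  rfl

theorem StandingAssumptions.hasDerivAt_LhatSample (h : StandingAssumptions D G L M κ)
    (i : Fin m) (θ : Vec n) (η : ℝ) (ξ : Ξ) :
    HasDerivAt (fun y => LhatSample D G i θ y ξ) (sampleGradEta D G i θ η ξ) η := by
  have h1 := (h.hasDerivAt_conj_eta i θ (G * √(m : ℝ)) η ξ).const_mul D.lam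
  have h2 := h1.add ((hasDerivAt_id η).const_mul (G * √(m : ℝ)))
  refine h2.congr_deriv ?_
  have := h.lam_pos.ne'
  rw [sampleGradEta]
  field_simp
  ring

theorem StandingAssumptions.slope_lipschitz (h : StandingAssumptions D G L M κ)
    (i : Fin m) (θ θ' : Vec n) (η η' : ℝ) (ξ : Ξ) :
    |slope D i θ η ξ - slope D i θ' η' ξ| ≤ M / D.lam * (G * ‖θ - θ'‖ + |η - η'|) := by
  refine (h.conj_smooth _ _).trans ?_
  rw [← sub_div, abs_div, abs_of_pos h.lam_pos, div_mul_eq_mul_div, ← mul_div_assoc]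
  refine div_le_div_of_nonneg_right (mul_le_mul_of_nonneg_left ?_ h.M_pos.le) h.lam_pos.le
  have h1 := h.lipschitz i ξ θ θ'
  have h2 := abs_sub (D.loss i θ ξ - D.loss i θ' ξ) (η - η')
  calc |D.loss i θ ξ - η - (D.loss i θ' ξ - η')|
      = |(D.loss i θ ξ - D.loss i θ' ξ) - (η - η')| := by ring_nf
    _ ≤ _ := by linarith

theorem StandingAssumptions.hasGradientAt_Lhat (h : StandingAssumptions D G L M κ)
    (i : Fin m) (θ : Vec n) (η : ℝ) :
    HasGradientAt (fun x => Lhat D G i x η) (gradTheta D G i θ η) θ := by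
  have := h.prob i
  set y := G * √(m : ℝ) * η with hy
  have hlam := h.lam_pos
  have h1 := hasFDerivAt_integral_of_dominated_of_fderiv_le (𝕜 := ℝ) (μ := D.P i)
    (F := fun x ξ => conj D.f ((D.loss i x ξ - y) / D.lam))
    (F' := fun x ξ => InnerProductSpace.toDual ℝ (Vec n)
      (D.lam⁻¹ • slope D i x y ξ • gradient (fun x => D.loss i x ξ) x))
    (x₀ := θ) (s := Metric.ball θ 1)
    -- On the unit ball around θ the slope exceeds its value at θ by at most `M G / λ`, which gives
    -- an integrable majorant.
    (bound := fun ξ => D.lam⁻¹ * ((slope D i θ y ξ + M / D.lam * G) * G))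
    (Metric.ball_mem_nhds θ one_pos)
    (Eventually.of_forall fun x => (h.integrable_conj i x y).aestronglyMeasurable)
    (h.integrable_conj i θ y) ?_ ?_ ?_ ?_
  · have h2 := (h1.const_mul D.lam).add_const y
    rw [hasGradientAt_iff_hasFDerivAt]
    refine h2.congr_fderiv ?_
    ext v
    have hint : Integrable (fun ξ => D.lam⁻¹ • slope D i θ y ξ •
        gradient (fun x => D.loss i x ξ) θ) (D.P i) :=
      (h.integrable_sampleGradTheta i θ η).fun_smul D.lam⁻¹
    have hint' : Integrable (fun ξ => InnerProductSpace.toDual ℝ (Vec n)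
        (D.lam⁻¹ • slope D i θ y ξ • gradient (fun x => D.loss i x ξ) θ)) (D.P i) := by
      refine hint.norm.mono' ?_ (Eventually.of_forall fun ξ =>
        (LinearIsometryEquiv.norm_map _ _).le)
      exact (LinearIsometryEquiv.continuous _).comp_aestronglyMeasurable hint.aestronglyMeasurable
    rw [smul_apply, ContinuousLinearMap.integral_apply hint']
    simp only [InnerProductSpace.toDual_apply_apply]
    simp_rw [real_inner_comm v]
    rw [integral_inner hint, integral_smul, gradTheta, real_inner_smul_right, smul_eq_mul,
      ← mul_assoc, mul_inv_cancel₀ hlam.ne', one_mul]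
    rfl
  · have hint := (h.integrable_sampleGradTheta i θ η).fun_smul D.lam⁻¹
    exact (LinearIsometryEquiv.continuous _).comp_aestronglyMeasurable hint.aestronglyMeasurable
  · refine Eventually.of_forall fun ξ x hx => ?_
    rw [LinearIsometryEquiv.norm_map, norm_smul, norm_smul, Real.norm_eq_abs,
      Real.norm_eq_abs, abs_of_pos (inv_pos.2 hlam), abs_of_nonneg (h.slope_nonneg _ _ _ _)]
    have h3 := (abs_le.1 (h.slope_lipschitz i x θ y y ξ)).2
    rw [sub_self, abs_zero, add_zero] at h3
    have h4 : ‖x - θ‖ ≤ 1 := by rw [← dist_eq_norm]; exact (Metric.mem_ball.1 hx).le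
    have h5 : M / D.lam * (G * ‖x - θ‖) ≤ M / D.lam * G :=
      mul_le_mul_of_nonneg_left (mul_le_of_le_one_right h.G_pos.le h4)
        (div_nonneg h.M_pos.le hlam.le)
    refine mul_le_mul_of_nonneg_left ?_ (inv_pos.2 hlam).le
    exact mul_le_mul (by linarith) (h.norm_gradient_loss_le i ξ x) (norm_nonneg _)
      (add_nonneg (h.slope_nonneg _ _ _ _)
        (mul_nonneg (div_nonneg h.M_pos.le hlam.le) h.G_pos.le))
  · exact (((h.integrable_slope i θ y).add (integrable_const _)).mul_const G).const_mul _
  · exact Eventually.of_forall fun ξ x _ => (h.hasGradientAt_conj_loss i x y ξ).hasFDerivAt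

theorem StandingAssumptions.hasDerivAt_Lhat (h : StandingAssumptions D G L M κ)
    (i : Fin m) (θ : Vec n) (η : ℝ) :
    HasDerivAt (fun y => Lhat D G i θ y) (gradEta D G i θ η) η := by
  have := h.prob i
  have hlam := h.lam_pos
  set a := G * √(m : ℝ) with ha
  have ha0 : 0 ≤ a := mul_nonneg h.G_pos.le (Real.sqrt_nonneg _)
  have h1 := hasDerivAt_integral_of_dominated_loc_of_deriv_le (𝕜 := ℝ) (μ := D.P i)
    (F := fun y ξ => conj D.f ((D.loss i θ ξ - a * y) / D.lam))
    (F' := fun y ξ => -(a / D.lam) * slope D i θ (a * y) ξ)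
    (x₀ := η) (s := Metric.ball η 1)
    (bound := fun ξ => a / D.lam * (slope D i θ (a * η) ξ + M / D.lam * a))
    (Metric.ball_mem_nhds η one_pos)
    (Eventually.of_forall fun y => (h.integrable_conj i θ (a * y)).aestronglyMeasurable)
    (h.integrable_conj i θ (a * η))
    ((h.integrable_slope i θ (a * η)).const_mul _).aestronglyMeasurable ?_ ?_ ?_
  · have h2 := (h1.2.const_mul D.lam).add ((hasDerivAt_id η).const_mul a)
    refine h2.congr_deriv ?_
    rw [gradEta, integral_const_mul]
    simp only [sampleGradEta]
    rw [integral_const_mul, integral_sub (integrable_const _) (h.integrable_slope _ _ _)]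
    simp only [integral_const, probReal_univ, smul_eq_mul, mul_one, ← ha]
    field_simp
    ring
  · refine Eventually.of_forall fun ξ x hx => ?_
    rw [norm_mul, norm_neg, Real.norm_eq_abs, Real.norm_eq_abs, abs_of_nonneg (div_nonneg ha0 hlam.le),
      abs_of_nonneg (h.slope_nonneg _ _ _ _)]
    refine mul_le_mul_of_nonneg_left ?_ (div_nonneg ha0 hlam.le)
    have h3 := (abs_le.1 (h.slope_lipschitz i θ θ (a * x) (a * η) ξ)).2
    rw [sub_self, norm_zero, mul_zero, zero_add, ← mul_sub, abs_mul, abs_of_nonneg ha0] at h3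
    have h4 : |x - η| ≤ 1 := by rw [← Real.dist_eq]; exact (Metric.mem_ball.1 hx).le
    have h5 : M / D.lam * (a * |x - η|) ≤ M / D.lam * a :=
      mul_le_mul_of_nonneg_left (mul_le_of_le_one_right ha0 h4)
        (div_nonneg h.M_pos.le hlam.le)
    linarith
  · exact ((h.integrable_slope i θ _).add (integrable_const _)).const_mul _
  · exact Eventually.of_forall fun ξ x _ => h.hasDerivAt_conj_eta i θ a x ξ

end

section GradientBounds

variable {D : Problem n m Ξ} {G L M κ : ℝ}

/-! ### Bounds on the gradients -/

/-- The link between the two blocks of the gradient: any bound that is linear in the slope becomes,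
after integration, a bound in terms of `|∂_η|`. -/
theorem StandingAssumptions.integral_slope (h : StandingAssumptions D G L M κ) (hm : 0 < m)
    (i : Fin m) (θ : Vec n) (η : ℝ) :
    ∫ ξ, slope D i θ (G * √(m : ℝ) * η) ξ ∂(D.P i)
      = 1 - gradEta D G i θ η / (G * √(m : ℝ)) := by
  have := h.prob i
  have ha : G * √(m : ℝ) ≠ 0 :=
    (mul_pos h.G_pos (Real.sqrt_pos.2 (by exact_mod_cast hm))).ne'
  rw [gradEta]
  simp only [sampleGradEta]
  rw [integral_const_mul, integral_sub (integrable_const _) (h.integrable_slope _ _ _)]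
  simp only [integral_const, probReal_univ, smul_eq_mul, mul_one]
  rw [mul_div_cancel_left₀ _ ha]
  ring

theorem StandingAssumptions.norm_gradTheta_le (h : StandingAssumptions D G L M κ) (hm : 0 < m)
    (i : Fin m) (θ : Vec n) (η : ℝ) :
    ‖gradTheta D G i θ η‖ ≤ G + |gradEta D G i θ η| / √(m : ℝ) := by
  have hs : 0 < √(m : ℝ) := Real.sqrt_pos.2 (by exact_mod_cast hm)
  have hG := h.G_pos
  have h1 : ‖gradTheta D G i θ η‖ ≤ ∫ ξ, G * slope D i θ (G * √(m : ℝ) * η) ξ ∂(D.P i) :=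
    norm_integral_le_of_norm_le ((h.integrable_slope i θ _).const_mul G)
      (Eventually.of_forall fun ξ => h.norm_sampleGradTheta_le i θ η ξ)
  rw [integral_const_mul, h.integral_slope hm] at h1
  have h2 : G * (1 - gradEta D G i θ η / (G * √(m : ℝ)))
      = G + -gradEta D G i θ η / √(m : ℝ) := by
    field_simp
    ring
  rw [h2] at h1
  have h3 := div_le_div_of_nonneg_right (neg_le_abs (gradEta D G i θ η)) hs.le
  linarith

theorem StandingAssumptions.L2hat_pos (h : StandingAssumptions D G L M κ) (hm : 0 < m) :
    0 < L2hat m G M D.lam := by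
  have := h.G_pos
  have := h.M_pos
  have := h.lam_pos
  have : (0 : ℝ) < m := by exact_mod_cast hm
  unfold L2hat
  positivity

theorem StandingAssumptions.L0hat_pos (h : StandingAssumptions D G L M κ) :
    0 < L0hat G L M D.lam := by
  have := h.G_pos
  have := h.L_pos
  have := h.M_pos
  have := h.lam_pos
  unfold L0hat
  positivity

theorem StandingAssumptions.L1hat_pos (h : StandingAssumptions D G L M κ) (hm : 0 < m) :
    0 < L1hat m G L := by
  have := h.G_pos
  have := h.L_pos
  have : (0 : ℝ) < m := by exact_mod_cast hm
  unfold L1hat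
  positivity

theorem StandingAssumptions.abs_gradEta_sub_le (h : StandingAssumptions D G L M κ)
    (i : Fin m) (θ : Vec n) (η η' : ℝ) :
    |gradEta D G i θ η - gradEta D G i θ η'| ≤ L2hat m G M D.lam * |η - η'| := by
  have := h.prob i
  have ha : 0 ≤ G * √(m : ℝ) := mul_nonneg h.G_pos.le (Real.sqrt_nonneg _)
  rw [gradEta, gradEta, ← integral_sub (h.integrable_sampleGradEta _ _ _)
    (h.integrable_sampleGradEta _ _ _)]
  have h1 := norm_integral_le_of_norm_le_const (μ := D.P i)
    (f := fun ξ => sampleGradEta D G i θ η ξ - sampleGradEta D G i θ η' ξ)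
    (C := L2hat m G M D.lam * |η - η'|) (Eventually.of_forall fun ξ => ?_)
  · simpa using h1
  · have h2 := h.slope_lipschitz i θ θ (G * √(m : ℝ) * η') (G * √(m : ℝ) * η) ξ
    rw [sub_self, norm_zero, mul_zero, zero_add, ← mul_sub, abs_mul, abs_of_nonneg ha] at h2
    have h3 : sampleGradEta D G i θ η ξ - sampleGradEta D G i θ η' ξ = G * √(m : ℝ) *
        (slope D i θ (G * √(m : ℝ) * η') ξ - slope D i θ (G * √(m : ℝ) * η) ξ) := by
      rw [sampleGradEta, sampleGradEta]
      ring
    rw [h3, Real.norm_eq_abs, abs_mul, abs_of_nonneg ha, abs_sub_comm η η']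
    refine (mul_le_mul_of_nonneg_left h2 ha).trans (le_of_eq ?_)
    rw [L2hat]
    have hs := Real.mul_self_sqrt (Nat.cast_nonneg (α := ℝ) m)
    calc _ = G ^ 2 * M * (√(m : ℝ) * √(m : ℝ)) / D.lam * |η' - η| := by ring
      _ = _ := by rw [hs]

/-- The bound is asymmetric on purpose: the η-derivative is taken only at the base point θ, so the
same constant serves along a whole segment issuing from θ. -/
theorem StandingAssumptions.norm_gradTheta_sub_le (h : StandingAssumptions D G L M κ)
    (hm : 0 < m) (i : Fin m) (θ θ' : Vec n) (η : ℝ) :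
    ‖gradTheta D G i θ' η - gradTheta D G i θ η‖
      ≤ (L0hat G L M D.lam + L1hat m G L * |gradEta D G i θ η|) * ‖θ' - θ‖ := by
  have := h.prob i
  have hs : 0 < √(m : ℝ) := Real.sqrt_pos.2 (by exact_mod_cast hm)
  have hG := h.G_pos
  have hL := h.L_pos
  have hlam := h.lam_pos
  have hM := h.M_pos
  rw [gradTheta, gradTheta, ← integral_sub (h.integrable_sampleGradTheta _ _ _)
    (h.integrable_sampleGradTheta _ _ _)]
  set y := G * √(m : ℝ) * η with hy
  have h1 := norm_integral_le_of_norm_le (μ := D.P i)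
    (f := fun ξ => sampleGradTheta D G i θ' η ξ - sampleGradTheta D G i θ η ξ)
    (g := fun ξ => M / D.lam * G ^ 2 * ‖θ' - θ‖ + L * ‖θ' - θ‖ * slope D i θ y ξ)
    ((integrable_const _).add ((h.integrable_slope i θ y).const_mul _))
    (Eventually.of_forall fun ξ => ?_)
  · refine h1.trans ?_
    rw [integral_add (integrable_const _) ((h.integrable_slope i θ y).const_mul _),
      integral_const_mul (L * ‖θ' - θ‖), hy, h.integral_slope hm]
    simp only [integral_const, probReal_univ, one_smul]
    have h2 : -(gradEta D G i θ η / (G * √(m : ℝ))) ≤ |gradEta D G i θ η| / (G * √(m : ℝ)) := by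
      rw [← neg_div]
      exact div_le_div_of_nonneg_right (neg_le_abs _) (by positivity)
    have h3 : L * ‖θ' - θ‖ * (1 - gradEta D G i θ η / (G * √(m : ℝ)))
        ≤ L * ‖θ' - θ‖ * (1 + |gradEta D G i θ η| / (G * √(m : ℝ))) :=
      mul_le_mul_of_nonneg_left (by linarith) (by positivity)
    refine (add_le_add_right h3 _).trans (le_of_eq ?_)
    rw [L0hat, L1hat]
    ring
  · have h2 := h.slope_lipschitz i θ' θ y y ξ
    rw [sub_self, abs_zero, add_zero] at h2
    -- In this product splitting the change of `∇ℓ` is multiplied by the slope at θ, and the change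
    -- of slope by a gradient of norm at most `G`.
    have h3 : sampleGradTheta D G i θ' η ξ - sampleGradTheta D G i θ η ξ
        = (slope D i θ' y ξ - slope D i θ y ξ) • gradient (fun x => D.loss i x ξ) θ'
          + slope D i θ y ξ • (gradient (fun x => D.loss i x ξ) θ'
            - gradient (fun x => D.loss i x ξ) θ) := by
      rw [sampleGradTheta, sampleGradTheta, sub_smul, smul_sub]
      abel
    rw [h3]
    refine (norm_add_le _ _).trans ?_
    rw [norm_smul, norm_smul, Real.norm_eq_abs, Real.norm_eq_abs,
      abs_of_nonneg (h.slope_nonneg i θ y ξ)]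
    have h4 : |slope D i θ' y ξ - slope D i θ y ξ| * ‖gradient (fun x => D.loss i x ξ) θ'‖
        ≤ M / D.lam * (G * ‖θ' - θ‖) * G :=
      mul_le_mul h2 (h.norm_gradient_loss_le i ξ θ') (norm_nonneg _) (by positivity)
    have h5 := mul_le_mul_of_nonneg_left (h.smooth i ξ θ' θ) (h.slope_nonneg i θ y ξ)
    calc _ ≤ M / D.lam * (G * ‖θ' - θ‖) * G + slope D i θ y ξ * (L * ‖θ' - θ‖) :=
          add_le_add h4 h5
      _ = _ := by ring

/-- The quadratic upper bound along a segment. -/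
theorem quadratic_upper_bound_real {g g' : ℝ → ℝ} {K : ℝ} (hg : ∀ t, HasDerivAt g (g' t) t)
    (hK : ∀ t ∈ Icc (0 : ℝ) 1, g' t - g' 0 ≤ K * t) : g 1 ≤ g 0 + g' 0 + K / 2 := by
  have hd : ∀ t, HasDerivAt (fun t => g t - t * g' 0 - K / 2 * t ^ 2) (g' t - g' 0 - K * t) t := by
    intro t
    have h1 := ((hg t).sub ((hasDerivAt_id t).mul_const (g' 0))).sub
      ((hasDerivAt_pow 2 t).const_mul (K / 2))
    refine h1.congr_deriv ?_
    simp
    ring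
  have hanti := antitoneOn_of_deriv_nonpos (convex_Icc (0 : ℝ) 1)
    (f := fun t => g t - t * g' 0 - K / 2 * t ^ 2)
    (fun t _ => (hd t).continuousAt.continuousWithinAt)
    (fun t _ => (hd t).differentiableAt.differentiableWithinAt)
    (fun t ht => by
      rw [interior_Icc] at ht
      rw [(hd t).deriv]
      linarith [hK t ⟨ht.1.le, ht.2.le⟩])
  have := hanti (left_mem_Icc.2 zero_le_one) (right_mem_Icc.2 zero_le_one) zero_le_one
  simp only at this
  linarith

theorem StandingAssumptions.Lhat_eta_le (h : StandingAssumptions D G L M κ)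
    (i : Fin m) (θ : Vec n) (η v : ℝ) :
    Lhat D G i θ (η + v) ≤ Lhat D G i θ η + gradEta D G i θ η * v
      + L2hat m G M D.lam / 2 * v ^ 2 := by
  have h1 : ∀ t : ℝ, HasDerivAt (fun t => Lhat D G i θ (η + t * v))
      (gradEta D G i θ (η + t * v) * v) t := by
    intro t
    have h2 : HasDerivAt (fun t => η + t * v) v t := by
      simpa using ((hasDerivAt_id t).mul_const v).const_add η
    exact HasDerivAt.comp (h₂ := fun y => Lhat D G i θ y) t
      (h.hasDerivAt_Lhat i θ (η + t * v)) h2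
  have h2 := quadratic_upper_bound_real (K := L2hat m G M D.lam * v ^ 2) h1 (fun t ht => by
    have h3 := h.abs_gradEta_sub_le i θ (η + t * v) (η + 0 * v)
    rw [show η + t * v - (η + 0 * v) = t * v by ring, abs_mul, abs_of_nonneg ht.1] at h3
    rw [← sub_mul]
    refine (le_abs_self _).trans ?_
    rw [abs_mul]
    refine (mul_le_mul_of_nonneg_right h3 (abs_nonneg v)).trans (le_of_eq ?_)
    rw [← sq_abs v]
    ring)
  simp only [one_mul, zero_mul, add_zero] at h2
  linarith

theorem StandingAssumptions.Lhat_theta_le (h : StandingAssumptions D G L M κ) (hm : 0 < m)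
    (i : Fin m) (θ v : Vec n) (η : ℝ) :
    Lhat D G i (θ + v) η ≤ Lhat D G i θ η + inner ℝ (gradTheta D G i θ η) v
      + (L0hat G L M D.lam + L1hat m G L * |gradEta D G i θ η|) / 2 * ‖v‖ ^ 2 := by
  have h1 : ∀ t : ℝ, HasDerivAt (fun t : ℝ => Lhat D G i (θ + t • v) η)
      (inner ℝ (gradTheta D G i (θ + t • v) η) v) t := by
    intro t
    have h2 : HasDerivAt (fun t : ℝ => θ + t • v) v t := by
      simpa using ((hasDerivAt_id t).smul_const v).const_add θ
    have h3 := (h.hasGradientAt_Lhat i (θ + t • v) η).hasFDerivAt.comp_hasDerivAt t h2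
    exact h3
  have h2 := quadratic_upper_bound_real
    (K := (L0hat G L M D.lam + L1hat m G L * |gradEta D G i θ η|) * ‖v‖ ^ 2) h1 (fun t ht => by
    have h3 := h.norm_gradTheta_sub_le hm i θ (θ + t • v) η
    rw [add_sub_cancel_left, norm_smul, Real.norm_eq_abs, abs_of_nonneg ht.1] at h3
    rw [zero_smul, add_zero, ← inner_sub_left]
    refine (real_inner_le_norm _ _).trans ?_
    refine (mul_le_mul_of_nonneg_right h3 (norm_nonneg v)).trans (le_of_eq ?_)
    ring)
  simp only [one_smul, zero_smul, add_zero] at h2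
  linarith

theorem dualInf_le_Lhat {i : Fin m}
    (hb : BddBelow (Set.range fun p : Vec n × ℝ => dual D i p.1 p.2)) (θ : Vec n) (η : ℝ) :
    dualInf D i ≤ Lhat D G i θ η :=
  ciInf_le hb (θ, G * √(m : ℝ) * η)

/-- Minimizing the quadratic upper bound in η, by the step `-∂_η / L̂₂`, cannot lead below the
infimum. -/
theorem StandingAssumptions.gradEta_sq_le (h : StandingAssumptions D G L M κ) (hm : 0 < m)
    {i : Fin m} (hb : BddBelow (Set.range fun p : Vec n × ℝ => dual D i p.1 p.2))
    (θ : Vec n) (η : ℝ) :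
    gradEta D G i θ η ^ 2 ≤ 2 * L2hat m G M D.lam * (Lhat D G i θ η - dualInf D i) := by
  have hL := h.L2hat_pos hm
  set K := L2hat m G M D.lam
  have h1 := h.Lhat_eta_le i θ η (-(gradEta D G i θ η / K))
  have h2 := dualInf_le_Lhat (G := G) hb θ (η + -(gradEta D G i θ η / K))
  have h3 : gradEta D G i θ η * -(gradEta D G i θ η / K) + K / 2 * (-(gradEta D G i θ η / K)) ^ 2
      = -(gradEta D G i θ η ^ 2 / (2 * K)) := by
    field_simp
    ring
  have h4 : gradEta D G i θ η ^ 2 / (2 * K) ≤ Lhat D G i θ η - dualInf D i := by linarith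
  rw [div_le_iff₀ (by positivity)] at h4
  linarith

/-- Without boundedness the real `sSup` in `Lam1` would take its default value `0` and bound
nothing. -/
theorem bddAbove_Lam1 (A : ℝ) : BddAbove {u : ℝ | 0 ≤ u ∧ u ^ 2 ≤ A * (u + 1)} := by
  refine ⟨|A| + 1, fun u hu => ?_⟩
  by_contra hlt
  push Not at hlt
  have h1 : A * (u + 1) ≤ |A| * (u + 1) :=
    mul_le_mul_of_nonneg_right (le_abs_self A) (by linarith [hu.1])
  nlinarith [hu.2, abs_nonneg A]

theorem Lam1_nonneg (m : ℕ) (G M lam F : ℝ) : 0 ≤ Lam1 m G M lam F :=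
  Real.sSup_nonneg fun _ hu => hu.1

theorem StandingAssumptions.abs_gradEta_le_Lam1 (h : StandingAssumptions D G L M κ) (hm : 0 < m)
    {i : Fin m} (hb : BddBelow (Set.range fun p : Vec n × ℝ => dual D i p.1 p.2))
    {θ : Vec n} {η F : ℝ} (hF : Lhat D G i θ η - dualInf D i ≤ F) :
    |gradEta D G i θ η| ≤ Lam1 m G M D.lam F := by
  have hL := h.L2hat_pos hm
  refine le_csSup (bddAbove_Lam1 (2 * L2hat m G M D.lam * F)) ⟨abs_nonneg _, ?_⟩
  rw [sq_abs]
  have h1 := h.gradEta_sq_le hm hb θ η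
  have h0 := dualInf_le_Lhat (G := G) hb θ η
  have hF0 : 0 ≤ F := by linarith
  have h2 : 2 * L2hat m G M D.lam * (Lhat D G i θ η - dualInf D i)
      ≤ 2 * L2hat m G M D.lam * F := mul_le_mul_of_nonneg_left hF (by positivity)
  -- This term weakens `u² ≤ 2 L̂₂ F` to the inequality with the factor `u + 1` that defines `Lam1`.
  have h3 : 0 ≤ 2 * L2hat m G M D.lam * F * |gradEta D G i θ η| := by positivity
  linarith

/-! ### Second moments of the one-sample gradients -/

/-- As a function of the loss value the slope is `M/λ`-Lipschitz. Subtracting its value at the mean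
loss leaves the variance unchanged, and the second moment then compares with the variance of the
loss. -/
theorem StandingAssumptions.variance_slope_le (h : StandingAssumptions D G L M κ)
    (i : Fin m) (θ : Vec n) (η : ℝ) :
    variance (slope D i θ η) (D.P i) ≤ (M / D.lam) ^ 2 * κ ^ 2 := by
  have := h.prob i
  have hlam := h.lam_pos
  have hM := h.M_pos
  set e := ∫ ξ, D.loss i θ ξ ∂(D.P i)
  set c := deriv (conj D.f) ((e - η) / D.lam) with hc
  have hms := (h.memLp_slope i θ η).aestronglyMeasurable
  rw [← variance_sub_const hms c]
  refine (variance_le_expectation_sq (hms.sub aestronglyMeasurable_const)).trans ?_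
  have h1 : variance (D.loss i θ) (D.P i) = ∫ ξ, (D.loss i θ ξ - e) ^ 2 ∂(D.P i) :=
    variance_eq_integral (h.measurable_loss i θ).aemeasurable
  have h2 : Integrable (fun ξ => (D.loss i θ ξ - e) ^ 2) (D.P i) :=
    ((h.memLp_loss i θ).sub (memLp_const e)).integrable_sq
  calc ∫ ξ, ((fun ξ => slope D i θ η ξ - c) ^ 2) ξ ∂(D.P i)
      ≤ ∫ ξ, (M / D.lam) ^ 2 * (D.loss i θ ξ - e) ^ 2 ∂(D.P i) := by
        refine integral_mono_of_nonneg (Eventually.of_forall fun ξ => sq_nonneg _)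
          (h2.const_mul _) (Eventually.of_forall fun ξ => ?_)
        have h3 := h.conj_smooth ((D.loss i θ ξ - η) / D.lam) ((e - η) / D.lam)
        rw [← sub_div, sub_sub_sub_cancel_right, abs_div, abs_of_pos hlam, ← mul_div_assoc] at h3
        change (slope D i θ η ξ - c) ^ 2 ≤ (M / D.lam) ^ 2 * (D.loss i θ ξ - e) ^ 2
        rw [← sq_abs (slope D i θ η ξ - c), ← sq_abs (D.loss i θ ξ - e), ← mul_pow,
          div_mul_eq_mul_div]
        exact pow_le_pow_left₀ (abs_nonneg _) h3 2
    _ = (M / D.lam) ^ 2 * variance (D.loss i θ) (D.P i) := by rw [integral_const_mul, h1]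
    _ ≤ _ := mul_le_mul_of_nonneg_left (h.variance_le i θ) (by positivity)

theorem StandingAssumptions.variance_sampleGradEta_le (h : StandingAssumptions D G L M κ)
    (i : Fin m) (θ : Vec n) (η : ℝ) :
    variance (sampleGradEta D G i θ η) (D.P i) ≤ K2hat m G M D.lam κ := by
  have := h.prob i
  have h1 : sampleGradEta D G i θ η
      = fun ξ => G * √(m : ℝ) * (1 - slope D i θ (G * √(m : ℝ) * η) ξ) := rfl
  have hms := (h.memLp_slope i θ (G * √(m : ℝ) * η)).aestronglyMeasurable
  rw [h1, variance_const_mul, variance_const_sub hms]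
  refine (mul_le_mul_of_nonneg_left (h.variance_slope_le i θ _) (sq_nonneg _)).trans
    (le_of_eq ?_)
  rw [mul_pow, Real.sq_sqrt (Nat.cast_nonneg m), K2hat]
  ring

/-- The second moment of the slope is its variance plus its squared mean, and the mean is given by
`integral_slope`. The constants in `K0hat` and `K1hat` leave room. -/
theorem StandingAssumptions.integral_sampleGradTheta_sq_le (h : StandingAssumptions D G L M κ)
    (hm : 0 < m) (i : Fin m) (θ : Vec n) (η : ℝ) :
    ∫ ξ, ‖sampleGradTheta D G i θ η ξ‖ ^ 2 ∂(D.P i)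
      ≤ K0hat G M D.lam κ + K1hat m * gradEta D G i θ η ^ 2 := by
  have := h.prob i
  have hG := h.G_pos
  have hM := h.M_pos
  have hlam := h.lam_pos
  have hm' : (0 : ℝ) < m := by exact_mod_cast hm
  set y := G * √(m : ℝ) * η with hy
  have hs := h.memLp_slope i θ y
  have h1 : ∫ ξ, slope D i θ y ξ ^ 2 ∂(D.P i)
      = variance (slope D i θ y) (D.P i) + (∫ ξ, slope D i θ y ξ ∂(D.P i)) ^ 2 := by
    rw [variance_eq_sub hs]
    simp
  have h2 : ∫ ξ, ‖sampleGradTheta D G i θ η ξ‖ ^ 2 ∂(D.P i)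
      ≤ ∫ ξ, G ^ 2 * slope D i θ y ξ ^ 2 ∂(D.P i) := by
    refine integral_mono_of_nonneg (Eventually.of_forall fun ξ => sq_nonneg _)
      (hs.integrable_sq.const_mul _) (Eventually.of_forall fun ξ => ?_)
    simp only
    rw [← mul_pow]
    exact pow_le_pow_left₀ (norm_nonneg _) (h.norm_sampleGradTheta_le i θ η ξ) 2
  rw [integral_const_mul, h1, hy, h.integral_slope hm] at h2
  refine h2.trans ?_
  have h3 := h.variance_slope_le i θ y
  have h4 : (1 - gradEta D G i θ η / (G * √(m : ℝ))) ^ 2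
      ≤ 2 + 2 * (gradEta D G i θ η ^ 2 / (G ^ 2 * m)) := by
    have : gradEta D G i θ η ^ 2 / (G ^ 2 * m) = (gradEta D G i θ η / (G * √(m : ℝ))) ^ 2 := by
      rw [div_pow, mul_pow, Real.sq_sqrt hm'.le]
    rw [this]
    nlinarith [sq_nonneg (1 + gradEta D G i θ η / (G * √(m : ℝ)))]
  have h5 : G ^ 2 * (2 * (gradEta D G i θ η ^ 2 / (G ^ 2 * m)))
      = 2 / m * gradEta D G i θ η ^ 2 := by
    field_simp
  have h6 : 2 / m * gradEta D G i θ η ^ 2 ≤ 8 / m * gradEta D G i θ η ^ 2 := by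
    gcongr
    norm_num
  have h7 : G ^ 2 * ((M / D.lam) ^ 2 * κ ^ 2) ≤ 10 * G ^ 2 * M ^ 2 * κ ^ 2 / D.lam ^ 2 := by
    have : 10 * G ^ 2 * M ^ 2 * κ ^ 2 / D.lam ^ 2 = 10 * (G ^ 2 * ((M / D.lam) ^ 2 * κ ^ 2)) := by
      rw [div_pow]
      ring
    rw [this]
    have : 0 ≤ G ^ 2 * ((M / D.lam) ^ 2 * κ ^ 2) := by positivity
    linarith
  rw [K0hat, K1hat]
  have h8 := mul_le_mul_of_nonneg_left (add_le_add h3 h4) (sq_nonneg G)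
  rw [mul_add (G ^ 2) ((M / D.lam) ^ 2 * κ ^ 2), mul_add (G ^ 2) 2, h5] at h8
  nlinarith [sq_nonneg G]

/-! ### The mini-batch estimators -/

theorem StandingAssumptions.gradient_Lhat (h : StandingAssumptions D G L M κ)
    (i : Fin m) (θ : Vec n) (η : ℝ) :
    gradient (fun x => Lhat D G i x η) θ = gradTheta D G i θ η :=
  (h.hasGradientAt_Lhat i θ η).gradient

theorem StandingAssumptions.deriv_Lhat (h : StandingAssumptions D G L M κ)
    (i : Fin m) (θ : Vec n) (η : ℝ) :
    deriv (fun y => Lhat D G i θ y) η = gradEta D G i θ η :=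
  (h.hasDerivAt_Lhat i θ η).deriv

theorem StandingAssumptions.gradThetaBatch_eq (h : StandingAssumptions D G L M κ) {B : ℕ}
    (ξ : Fin B → Fin m → Ξ) (θ : Vec n) (η : Vec m) (i : Fin m) :
    gradThetaBatch D G ξ θ η i
      = (B : ℝ)⁻¹ • ∑ j, sampleGradTheta D G i θ (η i) (ξ j i) := by
  simp only [gradThetaBatch, (h.hasGradientAt_LhatSample _ _ _ _).gradient]

/-- The diagonal entries of the mini-batch estimator in `η`. -/
noncomputable def gradEtaMean (D : Problem n m Ξ) (G : ℝ) {B : ℕ} (ξ : Fin B → Fin m → Ξ)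
    (θ : Vec n) (η : Vec m) (i : Fin m) : ℝ :=
  (B : ℝ)⁻¹ * ∑ j, sampleGradEta D G i θ (η i) (ξ j i)

theorem StandingAssumptions.gradEtaBatch_eq (h : StandingAssumptions D G L M κ) {B : ℕ}
    (ξ : Fin B → Fin m → Ξ) (θ : Vec n) (η : Vec m) (i : Fin m) :
    gradEtaBatch D G ξ θ η i = EuclideanSpace.single i (gradEtaMean D G ξ θ η i) := by
  simp only [gradEtaBatch, gradEtaMean, (h.hasDerivAt_LhatSample _ _ _ _).deriv]

end GradientBounds

/-! ### The simplex and the projection -/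

theorem convex_simplex (m : ℕ) : Convex ℝ (simplex m) := by
  intro x hx y hy a b ha hb hab
  exact convex_stdSimplex ℝ (Fin m) hx hy ha hb hab

theorem single_mem_simplex (i : Fin m) : EuclideanSpace.single i (1 : ℝ) ∈ simplex m := by
  simpa [simplex] using single_mem_stdSimplex ℝ i

theorem norm_sq_le_one_of_mem_simplex {w : Vec m} (hw : w ∈ simplex m) : ‖w‖ ^ 2 ≤ 1 := by
  rw [EuclideanSpace.norm_sq_eq, ← hw.2]
  refine Finset.sum_le_sum fun i _ => ?_
  have h0 := hw.1 i
  have h1 : w i ≤ 1 := by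
    rw [← hw.2]
    exact Finset.single_le_sum (f := w) (fun j _ => hw.1 j) (Finset.mem_univ i)
  rw [Real.norm_eq_abs, sq_abs]
  nlinarith

/-- Nonnegative coordinates make the inner product nonnegative. This bounds the weight term of the
initial potential by `γ/β`. -/
theorem norm_sub_sq_le_two_of_mem_simplex {v w : Vec m} (hv : v ∈ simplex m)
    (hw : w ∈ simplex m) : ‖v - w‖ ^ 2 ≤ 2 := by
  have h1 := norm_sq_le_one_of_mem_simplex hv
  have h2 := norm_sq_le_one_of_mem_simplex hw
  have h3 : 0 ≤ inner ℝ v w := by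
    rw [PiLp.inner_apply]
    exact Finset.sum_nonneg fun i _ => by
      simpa using mul_nonneg (hw.1 i) (hv.1 i)
  rw [norm_sub_sq_real]
  linarith

theorem inner_sub_projSimplex_le (hm : 0 < m) (x : Vec m) {v : Vec m} (hv : v ∈ simplex m) :
    inner ℝ (x - projSimplex x) (v - projSimplex x) ≤ 0 := by
  have h := isProjSimplex_projSimplex hm x
  have hne : Nonempty (simplex m) := ⟨⟨_, h.1⟩⟩
  refine (norm_eq_iInf_iff_real_inner_le_zero (convex_simplex m) h.1).1 ?_ v hv
  refine le_antisymm (le_ciInf fun u => h.2 u u.2) ?_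
  exact ciInf_le ⟨0, by rintro _ ⟨u, rfl⟩; exact norm_nonneg _⟩ (⟨_, h.1⟩ : simplex m)

theorem norm_projSimplex_sub_sq_le (hm : 0 < m) (x : Vec m) {v : Vec m} (hv : v ∈ simplex m) :
    ‖projSimplex x - v‖ ^ 2 ≤ ‖x - v‖ ^ 2 := by
  have h1 := inner_sub_projSimplex_le hm x hv
  have h2 : x - v = (x - projSimplex x) + (projSimplex x - v) := by abel
  rw [h2, norm_add_sq_real, ← neg_sub v, inner_neg_right]
  nlinarith [sq_nonneg ‖x - projSimplex x‖]

/-- Needed for measurability of the weights. The variational inequalities at `x` and at `y`, each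
tested with the other projection, add up to nonexpansiveness. -/
theorem continuous_projSimplex (hm : 0 < m) : Continuous (projSimplex : Vec m → Vec m) := by
  have : LipschitzWith 1 (projSimplex : Vec m → Vec m) := by
    refine LipschitzWith.of_dist_le_mul fun x y => ?_
    rw [dist_eq_norm, dist_eq_norm, NNReal.coe_one, one_mul]
    have h1 := inner_sub_projSimplex_le hm x (isProjSimplex_projSimplex hm y).1
    have h2 := inner_sub_projSimplex_le hm y (isProjSimplex_projSimplex hm x).1
    set p := projSimplex x
    set q := projSimplex y
    have h3 : ‖p - q‖ ^ 2 ≤ inner ℝ (x - y) (p - q) := by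
      rw [← real_inner_self_eq_norm_sq]
      have e1 : inner ℝ (x - p) (q - p) = -inner ℝ (x - p) (p - q) := by
        rw [← neg_sub p q, inner_neg_right]
      have e2 : inner ℝ (x - y) (p - q)
          = inner ℝ (x - p) (p - q) + inner ℝ (p - q) (p - q) - inner ℝ (y - q) (p - q) := by
        rw [← inner_add_left, ← inner_sub_left]
        congr 1
        abel
      linarith
    have h4 := real_inner_le_norm (x - y) (p - q)
    by_contra hlt
    push Not at hlt
    nlinarith [norm_nonneg (x - y)]
  exact this.continuous

/-! ### Clipping -/

theorem clip_nonneg {a b r : ℝ} (ha : 0 ≤ a) (hb : 0 ≤ b) (hr : 0 ≤ r) : 0 ≤ clip a b r := by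
  unfold clip
  split_ifs
  · exact ha
  · exact le_min ha (div_nonneg hb hr)

theorem clip_le (a b r : ℝ) : clip a b r ≤ a := by
  unfold clip
  split_ifs
  · exact le_rfl
  · exact min_le_left _ _

theorem clip_mul_le {a b r : ℝ} (hb : 0 ≤ b) (hr : 0 ≤ r) : clip a b r * r ≤ b := by
  unfold clip
  split_ifs with h
  · simpa [h] using hb
  · have hr' : 0 < r := lt_of_le_of_ne hr (Ne.symm h)
    calc min a (b / r) * r ≤ b / r * r := mul_le_mul_of_nonneg_right (min_le_right _ _) hr
      _ = b := div_mul_cancel₀ _ h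

/-- Without clipping this is `2 b r ≤ r² + b²`; with active clipping the first term on the right is
already `b r`. A bound on the clipped gain thus controls the norm linearly. -/
theorem mul_le_clip_half_mul_sq {b r : ℝ} :
    b * r ≤ clip (1 / 2) b r * r ^ 2 + b ^ 2 / 2 := by
  unfold clip
  split_ifs with h
  · rw [h]
    nlinarith [sq_nonneg b]
  · rcases min_choice (1 / 2) (b / r) with h1 | h1 <;> rw [h1]
    · nlinarith [sq_nonneg (r - b)]
    · have : b / r * r ^ 2 = b * r := by
        field_simp
      rw [this]
      nlinarith [sq_nonneg b]

/-! ### Matrices given by their columns -/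

section Columns

variable {V : Type*} [NormedAddCommGroup V] [InnerProductSpace ℝ V]

theorem inner_gramW (A : Fin m → V) (w v : Vec m) :
    inner ℝ (gramW A w) v = inner ℝ (mulW A w) (mulW A v) := by
  rw [PiLp.inner_apply, mulW, mulW, inner_sum]
  refine Finset.sum_congr rfl fun i _ => ?_
  rw [real_inner_smul_right, real_inner_comm (A i)]
  simp [gramW, mulW]

theorem mulW_single (A : Fin m → V) (i : Fin m) :
    mulW A (EuclideanSpace.single i (1 : ℝ)) = A i := by
  rw [mulW, Finset.sum_eq_single i]
  · simp
  · intro j _ hj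
    simp [hj]
  · simp

theorem norm_gramW_sq_le (A : Fin m → V) (w : Vec m) :
    ‖gramW A w‖ ^ 2 ≤ (∑ i, ‖A i‖ ^ 2) * ‖mulW A w‖ ^ 2 := by
  rw [EuclideanSpace.norm_sq_eq, Finset.sum_mul]
  refine Finset.sum_le_sum fun i _ => ?_
  rw [← mul_pow]
  exact pow_le_pow_left₀ (norm_nonneg _) (abs_real_inner_le_norm _ _) 2

theorem norm_mulW_le {w : Vec m} (hw : w ∈ simplex m) (A : Fin m → V) :
    ‖mulW A w‖ ≤ ∑ i, w i * ‖A i‖ := by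
  refine (norm_sum_le _ _).trans (le_of_eq (Finset.sum_congr rfl fun i _ => ?_))
  rw [norm_smul, Real.norm_eq_abs, abs_of_nonneg (hw.1 i)]

theorem mulW_sub (A B : Fin m → V) (w : Vec m) :
    mulW (fun i => A i - B i) w = mulW A w - mulW B w := by
  simp only [mulW, smul_sub, Finset.sum_sub_distrib]

end Columns

theorem abs_apply_le_norm (x : Vec m) (i : Fin m) : |x i| ≤ ‖x‖ := by
  simpa using PiLp.norm_apply_le x i

/-! ### The weight step -/

/-- Projection does not increase the distance to the vertex `e_i`. Expanding the square, the pairing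
of `g` with `w` yields the gain and the pairing with `e_i` isolates column `i`, while the squared
distances telescope over the iterations. -/
theorem weight_step {V W : Type*} [NormedAddCommGroup V] [InnerProductSpace ℝ V]
    [NormedAddCommGroup W] [InnerProductSpace ℝ W] (hm : 0 < m) {w : Vec m} (hw : w ∈ simplex m)
    (X : Fin m → V) (Z : Fin m → W) {α μ β ρ : ℝ} (hβ : 0 < β) (hρ : 0 ≤ ρ) (i : Fin m) {g : Vec m}
    (hg : g = α • gramW X w + μ • gramW Z w + ρ • w) :
    -(α * inner ℝ (X i) (mulW X w) + μ * inner ℝ (Z i) (mulW Z w))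
      ≤ -(α * ‖mulW X w‖ ^ 2 + μ * ‖mulW Z w‖ ^ 2) + ρ
        + (‖w - EuclideanSpace.single i (1 : ℝ)‖ ^ 2
          - ‖projSimplex (w - β • g) - EuclideanSpace.single i (1 : ℝ)‖ ^ 2) / (2 * β)
        + β / 2 * ‖g‖ ^ 2 := by
  set e : Vec m := EuclideanSpace.single i (1 : ℝ) with he
  have h1 := norm_projSimplex_sub_sq_le hm (w - β • g) (single_mem_simplex i)
  rw [← he] at h1
  have h2 : w - β • g - e = (w - e) - β • g := by abel
  rw [h2, norm_sub_sq_real (w - e), real_inner_smul_right, norm_smul, mul_pow, Real.norm_eq_abs,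
    sq_abs, inner_sub_left] at h1
  have h3 : inner ℝ w g = α * ‖mulW X w‖ ^ 2 + μ * ‖mulW Z w‖ ^ 2 + ρ * ‖w‖ ^ 2 := by
    rw [real_inner_comm, hg, inner_add_left, inner_add_left, real_inner_smul_left,
      real_inner_smul_left, real_inner_smul_left, inner_gramW, inner_gramW,
      real_inner_self_eq_norm_sq, real_inner_self_eq_norm_sq, real_inner_self_eq_norm_sq]
  have h4 : inner ℝ e g = α * inner ℝ (X i) (mulW X w) + μ * inner ℝ (Z i) (mulW Z w)
      + ρ * w i := by
    rw [real_inner_comm, hg, inner_add_left, inner_add_left, real_inner_smul_left,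
      real_inner_smul_left, real_inner_smul_left, inner_gramW, inner_gramW, he,
      mulW_single, mulW_single, real_inner_comm (X i), real_inner_comm (Z i),
      EuclideanSpace.inner_single_right]
    simp
  have hwi : w i ≤ 1 := by
    rw [← hw.2]
    exact Finset.single_le_sum (f := w) (fun j _ => hw.1 j) (Finset.mem_univ i)
  have h5 : ρ * w i ≤ ρ := mul_le_of_le_one_right hρ hwi
  have h6 : 0 ≤ ρ * ‖w‖ ^ 2 := by positivity
  rw [h3, h4] at h1
  have h7 : (2 * β) * (-(‖w - e‖ ^ 2 - ‖projSimplex (w - β • g) - e‖ ^ 2) / (2 * β))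
      = -(‖w - e‖ ^ 2 - ‖projSimplex (w - β • g) - e‖ ^ 2) := by
    field_simp
  rw [neg_div] at h7
  refine le_of_mul_le_mul_left ?_ (show (0 : ℝ) < 2 * β by positivity)
  have h8 : β * (ρ * w i) ≤ β * ρ := mul_le_mul_of_nonneg_left h5 hβ.le
  have h9 : 0 ≤ β * (ρ * ‖w‖ ^ 2) := by positivity
  linarith

/-- The second-order terms of one step are absorbed by half of the first-order decrease. -/
theorem second_order_le {γ b c ϑ L0 L1 L2 Λ α μ r s : ℝ} (hγ : 0 < γ) (hϑ : 0 < ϑ)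
    (hc : c ≤ 1) (hL2 : 0 ≤ L2)
    (hα0 : 0 ≤ α) (hα : α ≤ 1 / 2) (hμ0 : 0 ≤ μ) (hμ : μ ≤ 1 / 2) (hs : 0 ≤ s)
    (hαs : α * s ≤ b) (h1 : γ * (L0 + L1 * Λ) ≤ c) (h2 : γ * (L2 + ϑ * L1 ^ 2 * L2 ^ 2) ≤ c)
    (h3 : γ ^ 3 * b ^ 2 ≤ c * ϑ) :
    L2 / 2 * (γ * (μ * r)) ^ 2 + (L0 + L1 * (Λ + L2 * (γ * (μ * r)))) / 2 * (γ * (α * s)) ^ 2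
      ≤ γ / 2 * (α * s ^ 2 + μ * r ^ 2) := by
  set p := μ * r with hp
  set q := α * s with hq
  have hq0 : 0 ≤ q := mul_nonneg hα0 hs
  have hqb : q ^ 2 ≤ b ^ 2 := pow_le_pow_left₀ hq0 hαs 2
  have hpμ : p ^ 2 ≤ 1 / 2 * (μ * r ^ 2) := by
    have : p ^ 2 = μ * (μ * r ^ 2) := by rw [hp]; ring
    rw [this]
    exact mul_le_mul_of_nonneg_right hμ (by positivity)
  have hqα : q ^ 2 ≤ 1 / 2 * (α * s ^ 2) := by
    have : q ^ 2 = α * (α * s ^ 2) := by rw [hq]; ring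
    rw [this]
    exact mul_le_mul_of_nonneg_right hα (by positivity)
  -- The cubic cross term arises because moving η changes the smoothness constant in θ. Young's
  -- inequality with weight `ϑ` splits it into a `p²` term and a `q⁴` term; `h3` reduces the latter
  -- to order `q²`.
  have hyoung : L1 * L2 * (γ * p) * (γ * q) ^ 2
      ≤ γ * (γ * (ϑ * L1 ^ 2 * L2 ^ 2)) * p ^ 2 / 2 + γ * c * q ^ 2 / 2 := by
    have e1 : (γ * q) ^ 2 * (γ * q) ^ 2 ≤ γ * c * q ^ 2 * ϑ := by
      have e2 : γ ^ 3 * q ^ 2 ≤ c * ϑ :=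
        (mul_le_mul_of_nonneg_left hqb (by positivity)).trans h3
      have e3 := mul_le_mul_of_nonneg_left e2 (show 0 ≤ γ * q ^ 2 by positivity)
      nlinarith
    have e4 : 0 ≤ (ϑ * (L1 * L2 * (γ * p)) - (γ * q) ^ 2) ^ 2 := sq_nonneg _
    refine le_of_mul_le_mul_left ?_ hϑ
    nlinarith
  have e5 : γ * (γ * (L2 + ϑ * L1 ^ 2 * L2 ^ 2)) * p ^ 2 ≤ γ * c * p ^ 2 := by gcongr
  have e6 : γ * (γ * (L0 + L1 * Λ)) * q ^ 2 ≤ γ * c * q ^ 2 := by gcongr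
  have e7 : γ * c * p ^ 2 ≤ γ * 1 * (1 / 2 * (μ * r ^ 2)) := by gcongr
  have e8 : γ * c * q ^ 2 ≤ γ * 1 * (1 / 2 * (α * s ^ 2)) := by gcongr
  have e9 : 0 ≤ γ * (γ * L2) * p ^ 2 := by positivity
  have e10 : 0 ≤ γ * (μ * r ^ 2) := by positivity
  have e11 : 0 ≤ γ * (α * s ^ 2) := by positivity
  have e12 : 0 ≤ γ * (γ * (ϑ * L1 ^ 2 * L2 ^ 2)) * p ^ 2 := by positivity
  nlinarith

section Iteration

/-! ### One iteration -/

/-- The update of `η` in one iteration. -/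
noncomputable def stepEta (D : Problem n m Ξ) (G : ℝ) (h : Params)
    (ξ : Fin h.N₂ → Fin m → Ξ) (s : State n m) : Vec m :=
  s.η - (h.γ * clip (1 / 2) (h.δ * h.ε) ‖mulW (gradEtaBatch D G ξ s.θ s.η) s.w‖) •
    mulW (gradEtaBatch D G ξ s.θ s.η) s.w

/-- The squared error of the estimator of `∂_η L̂^i`. -/
noncomputable def errEta (D : Problem n m Ξ) (G : ℝ) {B : ℕ} (ξ : Fin B → Fin m → Ξ)
    (θ : Vec n) (η : Vec m) (i : Fin m) : ℝ :=
  (gradEtaMean D G ξ θ η i - gradEta D G i θ (η i)) ^ 2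

/-- The squared error of the estimator of `∇_θ L̂^i`. -/
noncomputable def errTheta (D : Problem n m Ξ) (G : ℝ) {B : ℕ} (ξ : Fin B → Fin m → Ξ)
    (θ : Vec n) (η : Vec m) (i : Fin m) : ℝ :=
  ‖gradThetaBatch D G ξ θ η i - gradTheta D G i θ (η i)‖ ^ 2

/-- The total squared error of the two estimators for task `i` in one iteration. -/
noncomputable def stepErr (D : Problem n m Ξ) (G : ℝ) (h : Params)
    (ξ : Fin h.N₂ → Fin m → Ξ) (ξ' : Fin h.N₁ → Fin m → Ξ) (s : State n m) (i : Fin m) : ℝ :=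
  errTheta D G ξ' s.θ (stepEta D G h ξ s) i + errEta D G ξ s.θ s.η i

/-- The clipped squared norms of the two balanced gradient estimators in one iteration. -/
noncomputable def stepGain (D : Problem n m Ξ) (G : ℝ) (h : Params)
    (ξ : Fin h.N₂ → Fin m → Ξ) (ξ' : Fin h.N₁ → Fin m → Ξ) (s : State n m) : ℝ :=
  clip (1 / 2) (h.δ * h.ε) ‖mulW (gradThetaBatch D G ξ' s.θ (stepEta D G h ξ s)) s.w‖ *
      ‖mulW (gradThetaBatch D G ξ' s.θ (stepEta D G h ξ s)) s.w‖ ^ 2 +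
    clip (1 / 2) (h.δ * h.ε) ‖mulW (gradEtaBatch D G ξ s.θ s.η) s.w‖ *
      ‖mulW (gradEtaBatch D G ξ s.θ s.η) s.w‖ ^ 2

theorem stepErr_nonneg (D : Problem n m Ξ) (G : ℝ) (h : Params)
    (ξ : Fin h.N₂ → Fin m → Ξ) (ξ' : Fin h.N₁ → Fin m → Ξ) (s : State n m) (i : Fin m) :
    0 ≤ stepErr D G h ξ ξ' s i := add_nonneg (sq_nonneg _) (sq_nonneg _)

theorem norm_add_three_sq_le {V : Type*} [NormedAddCommGroup V] (x y z : V) :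
    ‖x + y + z‖ ^ 2 ≤ 3 * (‖x‖ ^ 2 + ‖y‖ ^ 2 + ‖z‖ ^ 2) := by
  have h1 : ‖x + y + z‖ ^ 2 ≤ (‖x‖ + ‖y‖ + ‖z‖) ^ 2 :=
    pow_le_pow_left₀ (norm_nonneg _) norm_add₃_le 2
  nlinarith [sq_nonneg (‖x‖ - ‖y‖), sq_nonneg (‖y‖ - ‖z‖), sq_nonneg (‖x‖ - ‖z‖)]

variable {D : Problem n m Ξ} {G L M κ Δ : ℝ} {h : Params}

theorem Admissible.acc_pos
    (hA : Admissible (1 / 10000) 100000 m G L M D.lam κ Δ h) : 0 < h.δ * h.ε := mul_pos hA.δ_pos hA.ε_pos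

theorem Admissible.acc_lt_one
    (hA : Admissible (1 / 10000) 100000 m G L M D.lam κ Δ h) : h.δ * h.ε < 1 :=
  mul_lt_one_of_nonneg_of_lt_one_left hA.δ_pos.le hA.δ_lt_one hA.ε_lt_one.le

theorem Admissible.γ_L2hat_le
    (hA : Admissible (1 / 10000) 100000 m G L M D.lam κ Δ h) : h.γ * L2hat m G M D.lam ≤ 1 / 10000 := by
  refine le_trans (mul_le_mul_of_nonneg_left ?_ hA.γ_pos.le) hA.γ_le_eta
  have := hA.ϑ_pos
  have : 0 ≤ h.ϑ * L1hat m G L ^ 2 * L2hat m G M D.lam ^ 2 := by positivity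
  linarith

theorem abs_stepEta_sub_le
    (hA : Admissible (1 / 10000) 100000 m G L M D.lam κ Δ h)
    (ξ : Fin h.N₂ → Fin m → Ξ) (s : State n m) (i : Fin m) :
    |stepEta D G h ξ s i - s.η i| ≤ h.γ * (clip (1 / 2) (h.δ * h.ε)
      ‖mulW (gradEtaBatch D G ξ s.θ s.η) s.w‖ * ‖mulW (gradEtaBatch D G ξ s.θ s.η) s.w‖) := by
  have h1 := abs_apply_le_norm (stepEta D G h ξ s - s.η) i
  rw [PiLp.sub_apply] at h1
  refine h1.trans (le_of_eq ?_)
  rw [stepEta, sub_sub_cancel_left, norm_neg, norm_smul, Real.norm_eq_abs, abs_of_nonneg, mul_assoc]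
  exact mul_nonneg hA.γ_pos.le (clip_nonneg (by norm_num) hA.acc_pos.le (norm_nonneg _))

theorem abs_gradEta_stepEta_sub_le (hS : StandingAssumptions D G L M κ) (hm : 0 < m)
    (hA : Admissible (1 / 10000) 100000 m G L M D.lam κ Δ h)
    (ξ : Fin h.N₂ → Fin m → Ξ) (s : State n m) (i : Fin m) :
    |gradEta D G i s.θ (stepEta D G h ξ s i) - gradEta D G i s.θ (s.η i)|
      ≤ L2hat m G M D.lam * (h.γ * (clip (1 / 2) (h.δ * h.ε)
      ‖mulW (gradEtaBatch D G ξ s.θ s.η) s.w‖ * ‖mulW (gradEtaBatch D G ξ s.θ s.η) s.w‖)) :=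
  (hS.abs_gradEta_sub_le i s.θ _ _).trans
    (mul_le_mul_of_nonneg_left (abs_stepEta_sub_le hA ξ s i) (hS.L2hat_pos hm).le)

/-- Clipping limits the move of η to `γ b`, so the drift of the derivative is at most `γ L̂₂ b`.
This permits passing between `η_t`, where `Z_t` is sampled, and `η_{t+1}`. -/
theorem abs_gradEta_stepEta_sub_le' (hS : StandingAssumptions D G L M κ) (hm : 0 < m)
    (hA : Admissible (1 / 10000) 100000 m G L M D.lam κ Δ h)
    (ξ : Fin h.N₂ → Fin m → Ξ) (s : State n m) (i : Fin m) :
    |gradEta D G i s.θ (stepEta D G h ξ s i) - gradEta D G i s.θ (s.η i)|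
      ≤ 1 / 10000 * (h.δ * h.ε) := by
  refine (abs_gradEta_stepEta_sub_le hS hm hA ξ s i).trans ?_
  rw [← mul_assoc, mul_comm (L2hat m G M D.lam)]
  have := hA.acc_pos
  exact mul_le_mul (hA.γ_L2hat_le) (clip_mul_le hA.acc_pos.le (norm_nonneg _))
    (mul_nonneg (clip_nonneg (by norm_num) hA.acc_pos.le (norm_nonneg _)) (norm_nonneg _))
    (by norm_num)

theorem abs_gradEta_stepEta_le (hS : StandingAssumptions D G L M κ) (hm : 0 < m)
    (hA : Admissible (1 / 10000) 100000 m G L M D.lam κ Δ h)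
    (hb : ∀ i, BddBelow (Set.range fun p : Vec n × ℝ => dual D i p.1 p.2))
    (ξ : Fin h.N₂ → Fin m → Ξ) {s : State n m} {i : Fin m}
    (hgap : Lhat D G i s.θ (s.η i) - dualInf D i ≤ h.F) :
    |gradEta D G i s.θ (stepEta D G h ξ s i)|
      ≤ Lam1 m G M D.lam h.F + 1 / 10000 * (h.δ * h.ε) := by
  have h1 := hS.abs_gradEta_le_Lam1 hm (hb i) hgap
  have h2 := abs_gradEta_stepEta_sub_le' hS hm hA ξ s i
  have h3 := abs_sub_abs_le_abs_sub (gradEta D G i s.θ (stepEta D G h ξ s i))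
    (gradEta D G i s.θ (s.η i))
  linarith

/-- The direction of the weight step is small. -/
theorem norm_weight_direction_sq_le (hS : StandingAssumptions D G L M κ) (hm : 0 < m)
    (hA : Admissible (1 / 10000) 100000 m G L M D.lam κ Δ h)
    (hb : ∀ i, BddBelow (Set.range fun p : Vec n × ℝ => dual D i p.1 p.2))
    (ξ : Fin h.N₂ → Fin m → Ξ) (ξ' : Fin h.N₁ → Fin m → Ξ) {s : State n m}
    (hw : s.w ∈ simplex m) (hgap : ∀ i, Lhat D G i s.θ (s.η i) - dualInf D i ≤ h.F)
    {X : Fin m → Vec n} {Z : Fin m → Vec m} {α μ : ℝ}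
    (hX : X = gradThetaBatch D G ξ' s.θ (stepEta D G h ξ s))
    (hZ : Z = gradEtaBatch D G ξ s.θ s.η)
    (hα : α = clip (1 / 2) (h.δ * h.ε) ‖mulW X s.w‖)
    (hμ : μ = clip (1 / 2) (h.δ * h.ε) ‖mulW Z s.w‖) :
    h.ρ + h.β / 2 * ‖α • gramW X s.w + μ • gramW Z s.w + h.ρ • s.w‖ ^ 2
      ≤ 16 / 10000 * (h.δ * h.ε) ^ 2
        + 3 * (h.δ * h.ε) ^ 2 * h.β * ∑ j, stepErr D G h ξ ξ' s j := by
  set b := h.δ * h.ε with hbdef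
  have hb0 : 0 < b := hA.acc_pos
  have hb1 : b < 1 := hA.acc_lt_one
  set Λ := Lam1 m G M D.lam h.F with hΛ
  have hΛ0 : 0 ≤ Λ := Lam1_nonneg _ _ _ _ _
  have hm1 : (1 : ℝ) ≤ m := by exact_mod_cast hm
  have hG := hS.G_pos
  have hβ := hA.β_pos
  -- Each column is the true gradient plus its error. The derivative at the updated η is at most `Λ
  -- + 1`, since its drift is below `1`.
  have hXj : ∀ j, ‖X j‖ ^ 2 ≤ 2 * (3 * G ^ 2 + 3 * Λ ^ 2 / m + 3 / m)
      + 2 * errTheta D G ξ' s.θ (stepEta D G h ξ s) j := by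
    intro j
    have h1 : ‖gradTheta D G j s.θ (stepEta D G h ξ s j)‖ ≤ G + (Λ + 1) / √(m : ℝ) := by
      refine (hS.norm_gradTheta_le hm j _ _).trans ?_
      have := abs_gradEta_stepEta_le hS hm hA hb ξ (hgap j)
      gcongr
      linarith
    have h2 : ‖gradTheta D G j s.θ (stepEta D G h ξ s j)‖ ^ 2
        ≤ 3 * G ^ 2 + 3 * Λ ^ 2 / m + 3 / m := by
      refine (pow_le_pow_left₀ (norm_nonneg _) h1 2).trans ?_
      have e1 : 3 * G ^ 2 + 3 * Λ ^ 2 / m + 3 / m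
          = 3 * (G ^ 2 + (Λ / √(m : ℝ)) ^ 2 + (1 / √(m : ℝ)) ^ 2) := by
        rw [div_pow, div_pow, Real.sq_sqrt (by positivity)]
        ring
      rw [e1, add_div]
      generalize Λ / √(m : ℝ) = x
      generalize 1 / √(m : ℝ) = y
      nlinarith [sq_nonneg (G - x), sq_nonneg (G - y), sq_nonneg (x - y)]
    have h3 : ‖X j‖ ≤ ‖gradTheta D G j s.θ (stepEta D G h ξ s j)‖
        + ‖X j - gradTheta D G j s.θ (stepEta D G h ξ s j)‖ := by
      have := norm_add_le (gradTheta D G j s.θ (stepEta D G h ξ s j))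
        (X j - gradTheta D G j s.θ (stepEta D G h ξ s j))
      rwa [add_sub_cancel] at this
    have h4 : errTheta D G ξ' s.θ (stepEta D G h ξ s) j
        = ‖X j - gradTheta D G j s.θ (stepEta D G h ξ s j)‖ ^ 2 := by rw [hX, errTheta]
    rw [h4]
    have h5 := pow_le_pow_left₀ (norm_nonneg _) h3 2
    nlinarith [sq_nonneg (‖gradTheta D G j s.θ (stepEta D G h ξ s j)‖
      - ‖X j - gradTheta D G j s.θ (stepEta D G h ξ s j)‖)]
  have hZj : ∀ j, ‖Z j‖ ^ 2 ≤ 2 * Λ ^ 2 + 2 * errEta D G ξ s.θ s.η j := by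
    intro j
    have h1 := hS.abs_gradEta_le_Lam1 hm (hb j) (hgap j)
    have h2 : gradEta D G j s.θ (s.η j) ^ 2 ≤ Λ ^ 2 := by
      rw [← sq_abs]
      exact pow_le_pow_left₀ (abs_nonneg _) h1 2
    rw [hZ, hS.gradEtaBatch_eq, PiLp.norm_single, Real.norm_eq_abs, sq_abs, errEta]
    -- With estimate `z` and true value `g`, the inequality `z² ≤ 2 g² + 2 (z - g)²` is `(z - 2 g)²
    -- ≥ 0`.
    nlinarith [sq_nonneg (gradEtaMean D G ξ s.θ s.η j - 2 * gradEta D G j s.θ (s.η j))]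
  have hXs : ∑ j, ‖X j‖ ^ 2 ≤ 2 * (3 * m * G ^ 2 + 3 * Λ ^ 2 + 3)
      + 2 * ∑ j, errTheta D G ξ' s.θ (stepEta D G h ξ s) j := by
    refine (Finset.sum_le_sum fun j _ => hXj j).trans (le_of_eq ?_)
    rw [Finset.sum_add_distrib, Finset.sum_const, Finset.card_univ, Fintype.card_fin,
      nsmul_eq_mul, ← Finset.mul_sum]
    field_simp
  have hZs : ∑ j, ‖Z j‖ ^ 2 ≤ 2 * m * Λ ^ 2 + 2 * ∑ j, errEta D G ξ s.θ s.η j := by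
    refine (Finset.sum_le_sum fun j _ => hZj j).trans (le_of_eq ?_)
    rw [Finset.sum_add_distrib, Finset.sum_const, Finset.card_univ, Fintype.card_fin,
      nsmul_eq_mul, ← Finset.mul_sum]
    ring
  have hα0 : 0 ≤ α := by rw [hα]; exact clip_nonneg (by norm_num) hb0.le (norm_nonneg _)
  have hμ0 : 0 ≤ μ := by rw [hμ]; exact clip_nonneg (by norm_num) hb0.le (norm_nonneg _)
  have hαb : α * ‖mulW X s.w‖ ≤ b := by rw [hα]; exact clip_mul_le hb0.le (norm_nonneg _)
  have hμb : μ * ‖mulW Z s.w‖ ≤ b := by rw [hμ]; exact clip_mul_le hb0.le (norm_nonneg _)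
  have hgX : ‖α • gramW X s.w‖ ^ 2 ≤ b ^ 2 * ∑ j, ‖X j‖ ^ 2 := by
    rw [norm_smul, mul_pow, Real.norm_eq_abs, sq_abs]
    have e1 := mul_le_mul_of_nonneg_left (norm_gramW_sq_le X s.w) (sq_nonneg α)
    have e2 := pow_le_pow_left₀ (mul_nonneg hα0 (norm_nonneg _)) hαb 2
    have e3 : 0 ≤ ∑ j, ‖X j‖ ^ 2 := Finset.sum_nonneg fun j _ => sq_nonneg _
    have e4 := mul_le_mul_of_nonneg_right e2 e3
    linarith
  have hgZ : ‖μ • gramW Z s.w‖ ^ 2 ≤ b ^ 2 * ∑ j, ‖Z j‖ ^ 2 := by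
    rw [norm_smul, mul_pow, Real.norm_eq_abs, sq_abs]
    have e1 := mul_le_mul_of_nonneg_left (norm_gramW_sq_le Z s.w) (sq_nonneg μ)
    have e2 := pow_le_pow_left₀ (mul_nonneg hμ0 (norm_nonneg _)) hμb 2
    have e3 : 0 ≤ ∑ j, ‖Z j‖ ^ 2 := Finset.sum_nonneg fun j _ => sq_nonneg _
    have e4 := mul_le_mul_of_nonneg_right e2 e3
    linarith
  have hgw : ‖h.ρ • s.w‖ ^ 2 ≤ h.ρ ^ 2 := by
    rw [norm_smul, mul_pow, Real.norm_eq_abs, sq_abs]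
    exact mul_le_of_le_one_right (sq_nonneg _) (norm_sq_le_one_of_mem_simplex hw)
  have hg := norm_add_three_sq_le (α • gramW X s.w) (μ • gramW Z s.w) (h.ρ • s.w)
  have hρ : h.ρ ≤ 1 / 10000 * b ^ 2 := by
    have := hA.ρ_le
    rwa [← mul_pow] at this
  have hρ0 := hA.ρ_nonneg
  have hβc := hA.β_le
  rw [← hΛ] at hβc
  have hsum : ∑ j, stepErr D G h ξ ξ' s j = ∑ j, errTheta D G ξ' s.θ (stepEta D G h ξ s) j
      + ∑ j, errEta D G ξ s.θ s.η j := by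
    simp only [stepErr, Finset.sum_add_distrib]
  rw [hsum]
  set E1 := ∑ j, errTheta D G ξ' s.θ (stepEta D G h ξ s) j
  set E2 := ∑ j, errEta D G ξ s.θ s.η j
  have hmΛ : Λ ^ 2 ≤ m * Λ ^ 2 := le_mul_of_one_le_left (sq_nonneg _) hm1
  have hbd : ‖α • gramW X s.w + μ • gramW Z s.w + h.ρ • s.w‖ ^ 2
      ≤ 3 * (b ^ 2 * (8 * (m * G ^ 2 + m * Λ ^ 2 + 1) + 2 * (E1 + E2)) + h.ρ ^ 2) := by
    refine hg.trans ?_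
    have e1 : ∑ j, ‖X j‖ ^ 2 + ∑ j, ‖Z j‖ ^ 2
        ≤ 8 * (m * G ^ 2 + m * Λ ^ 2 + 1) + 2 * (E1 + E2) := by
      have : 0 ≤ m * G ^ 2 := by positivity
      linarith
    have e2 := mul_le_mul_of_nonneg_left e1 (sq_nonneg b)
    linarith
  have hβ1 : h.β ≤ 1 / 10000 := by
    have e1 : h.β * 1 ≤ h.β * (m * G ^ 2 + m * Λ ^ 2 + 1) := by
      refine mul_le_mul_of_nonneg_left ?_ hβ.le
      have : 0 ≤ m * G ^ 2 := by positivity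
      have : 0 ≤ m * Λ ^ 2 := by positivity
      linarith
    linarith
  have f1 := mul_le_mul_of_nonneg_left hbd (show 0 ≤ h.β / 2 by positivity)
  -- The coefficient is `12 = (1/2) · 3 · 8`: the step `β/2`, the three summands of the direction,
  -- and the bound on the columns. The choice of `β` turns this term into `12/10000 · b²`.
  have f2 := mul_le_mul_of_nonneg_left hβc (show 0 ≤ 12 * b ^ 2 by positivity)
  have hb2 : b ^ 2 ≤ 1 := pow_le_one₀ hb0.le hb1.le
  have hρ1 : h.ρ ≤ 1 := by linarith
  have f3 : h.β * h.ρ ^ 2 ≤ 1 / 10000 * b ^ 2 := by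
    have e1 : h.ρ ^ 2 ≤ h.ρ := by nlinarith
    have e2 : h.β * h.ρ ^ 2 ≤ 1 * h.ρ ^ 2 := by
      refine mul_le_mul_of_nonneg_right (by linarith) (sq_nonneg _)
    linarith
  linarith

/-- Here `z` stands for the estimated derivative and `p` for `Z w`. Task `i` sees only coordinate
`i` of the move, while the quadratic term is enlarged to the full norm so that it is the same for
all tasks. -/
theorem StandingAssumptions.Lhat_noisy_eta_step_le (hS : StandingAssumptions D G L M κ)
    (hm : 0 < m) (i : Fin m) (θ : Vec n) (η z : ℝ) (p : Vec m) {γ μ b : ℝ} (hγ : 0 ≤ γ)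
    (hμ : 0 ≤ μ) (hb : μ * ‖p‖ ≤ b) :
    Lhat D G i θ (η - γ * μ * p i) ≤ Lhat D G i θ η - γ * (μ * (z * p i))
      + γ * (b ^ 2 / 200 + 50 * (z - gradEta D G i θ η) ^ 2)
      + L2hat m G M D.lam / 2 * (γ * (μ * ‖p‖)) ^ 2 := by
  have hd := hS.Lhat_eta_le i θ η (-(γ * μ * p i))
  rw [← sub_eq_add_neg] at hd
  have hL2 := hS.L2hat_pos hm
  generalize gradEta D G i θ η = dη at hd ⊢
  have hp : μ * |p i| ≤ μ * ‖p‖ := mul_le_mul_of_nonneg_left (abs_apply_le_norm _ _) hμ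
  have h0 : 0 ≤ μ * |p i| := mul_nonneg hμ (abs_nonneg _)
  have hsq : (-(γ * μ * p i)) ^ 2 ≤ (γ * (μ * ‖p‖)) ^ 2 := by
    have : (-(γ * μ * p i)) ^ 2 = (γ * (μ * |p i|)) ^ 2 := by
      rw [neg_sq, mul_assoc, mul_pow, mul_pow, mul_pow γ, mul_pow μ, sq_abs]
    rw [this]
    exact pow_le_pow_left₀ (mul_nonneg hγ h0) (mul_le_mul_of_nonneg_left hp hγ) 2
  have h1 := mul_le_mul_of_nonneg_left hsq (show 0 ≤ L2hat m G M D.lam / 2 by positivity)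
  have h2 : μ * ((z - dη) * p i) ≤ b ^ 2 / 200 + 50 * (z - dη) ^ 2 := by
    have e1 : μ * ((z - dη) * p i) ≤ |z - dη| * (μ * |p i|) := by
      have := le_abs_self ((z - dη) * p i)
      rw [abs_mul] at this
      have := mul_le_mul_of_nonneg_left this hμ
      linarith
    have e2 : |z - dη| * (μ * |p i|) ≤ |z - dη| * b :=
      mul_le_mul_of_nonneg_left (hp.trans hb) (abs_nonneg _)
    rw [← sq_abs (z - dη)]
    -- Young's inequality with unequal weights: the multiple of `b²` stays small and the factor `50`
    -- on the error is paid for by the batch sizes.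
    nlinarith [sq_nonneg (b / 10 - 10 * |z - dη|)]
  have h3 := mul_le_mul_of_nonneg_left h2 hγ
  linarith

/-- Replacing the true column by the estimate `x` costs an inner product with the direction `p`; the
clipped length `α ‖p‖ ≤ b` makes this linear in the error, and Young's inequality makes it
quadratic. -/
theorem StandingAssumptions.Lhat_noisy_theta_step_le (hS : StandingAssumptions D G L M κ)
    (hm : 0 < m) (i : Fin m) (θ x p : Vec n) (η : ℝ) {γ α b : ℝ} (hγ : 0 ≤ γ)
    (hα : 0 ≤ α) (hb : α * ‖p‖ ≤ b) :
    Lhat D G i (θ - (γ * α) • p) η ≤ Lhat D G i θ η - γ * (α * inner ℝ x p)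
      + γ * (b ^ 2 / 200 + 50 * ‖x - gradTheta D G i θ η‖ ^ 2)
      + (L0hat G L M D.lam + L1hat m G L * |gradEta D G i θ η|) / 2 * (γ * (α * ‖p‖)) ^ 2 := by
  have hd := hS.Lhat_theta_le hm i θ (-((γ * α) • p)) η
  rw [← sub_eq_add_neg, norm_neg, norm_smul, Real.norm_eq_abs, abs_of_nonneg (mul_nonneg hγ hα),
    mul_assoc γ α ‖p‖, inner_neg_right, real_inner_smul_right] at hd
  generalize gradTheta D G i θ η = g at hd ⊢
  have h2 : α * (inner ℝ x p - inner ℝ g p) ≤ b ^ 2 / 200 + 50 * ‖x - g‖ ^ 2 := by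
    have e1 := mul_le_mul_of_nonneg_left (real_inner_le_norm (x - g) p) hα
    rw [inner_sub_left] at e1
    have e2 := mul_le_mul_of_nonneg_left hb (norm_nonneg (x - g))
    nlinarith [sq_nonneg (b / 10 - 10 * ‖x - g‖)]
  have h3 := mul_le_mul_of_nonneg_left h2 hγ
  linarith

/-- The decrease of the potential of task `i` in one iteration. -/
theorem one_step_descent (hS : StandingAssumptions D G L M κ) (hm : 0 < m)
    (hA : Admissible (1 / 10000) 100000 m G L M D.lam κ Δ h)
    (hb : ∀ i, BddBelow (Set.range fun p : Vec n × ℝ => dual D i p.1 p.2))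
    (ξ : Fin h.N₂ → Fin m → Ξ) (ξ' : Fin h.N₁ → Fin m → Ξ) {s : State n m}
    (hw : s.w ∈ simplex m) (hgap : ∀ i, Lhat D G i s.θ (s.η i) - dualInf D i ≤ h.F) (i : Fin m) :
    Lhat D G i (step D G h ξ ξ' s).θ ((step D G h ξ ξ' s).η i)
        + h.γ / (2 * h.β) * ‖(step D G h ξ ξ' s).w - EuclideanSpace.single i (1 : ℝ)‖ ^ 2
      ≤ Lhat D G i s.θ (s.η i) + h.γ / (2 * h.β) * ‖s.w - EuclideanSpace.single i (1 : ℝ)‖ ^ 2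
        - h.γ / 2 * stepGain D G h ξ ξ' s
        + h.γ * ((h.δ * h.ε) ^ 2 / 80 + 50 * stepErr D G h ξ ξ' s i
          + 3 * (h.δ * h.ε) ^ 2 * h.β * ∑ j, stepErr D G h ξ ξ' s j) := by
  obtain ⟨Z, hZ⟩ : ∃ Z, Z = gradEtaBatch D G ξ s.θ s.η := ⟨_, rfl⟩
  obtain ⟨X, hX⟩ : ∃ X, X = gradThetaBatch D G ξ' s.θ (stepEta D G h ξ s) := ⟨_, rfl⟩
  obtain ⟨μ, hμ⟩ : ∃ μ, μ = clip (1 / 2) (h.δ * h.ε) ‖mulW Z s.w‖ := ⟨_, rfl⟩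
  obtain ⟨α, hα⟩ : ∃ α, α = clip (1 / 2) (h.δ * h.ε) ‖mulW X s.w‖ := ⟨_, rfl⟩
  obtain ⟨g, hg⟩ : ∃ g, g = α • gramW X s.w + μ • gramW Z s.w + h.ρ • s.w := ⟨_, rfl⟩
  have e_η : (step D G h ξ ξ' s).η = stepEta D G h ξ s := rfl
  have e_θ : (step D G h ξ ξ' s).θ = s.θ - (h.γ * α) • mulW X s.w := by
    rw [hα, hX]
    rfl
  have e_w : (step D G h ξ ξ' s).w = projSimplex (s.w - h.β • g) := by
    rw [hg, hα, hμ, hX, hZ]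
    rfl
  have hηi : stepEta D G h ξ s i = s.η i - h.γ * μ * mulW Z s.w i := by
    rw [hμ, hZ]
    rfl
  have hZi : Z i = EuclideanSpace.single i (gradEtaMean D G ξ s.θ s.η i) := by
    rw [hZ, hS.gradEtaBatch_eq]
  have hinnerZ : inner ℝ (Z i) (mulW Z s.w) = gradEtaMean D G ξ s.θ s.η i * mulW Z s.w i := by
    rw [hZi, EuclideanSpace.inner_single_left]
    simp
  have hgain : stepGain D G h ξ ξ' s = α * ‖mulW X s.w‖ ^ 2 + μ * ‖mulW Z s.w‖ ^ 2 := by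
    rw [hα, hμ, hX, hZ]
    rfl
  have herr : stepErr D G h ξ ξ' s i
      = ‖X i - gradTheta D G i s.θ (stepEta D G h ξ s i)‖ ^ 2
        + (gradEtaMean D G ξ s.θ s.η i - gradEta D G i s.θ (s.η i)) ^ 2 := by
    rw [hX]
    rfl
  have hγ := hA.γ_pos
  have hdir := norm_weight_direction_sq_le hS hm hA hb ξ ξ' hw hgap hX hZ hα hμ
  rw [← hg] at hdir
  have hwt := weight_step hm hw X Z (α := α) (μ := μ) hA.β_pos hA.ρ_nonneg i hg
  have hb0 : 0 < h.δ * h.ε := hA.acc_pos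
  have hα0 : 0 ≤ α := hα ▸ clip_nonneg (by norm_num) hb0.le (norm_nonneg _)
  have hμ0 : 0 ≤ μ := hμ ▸ clip_nonneg (by norm_num) hb0.le (norm_nonneg _)
  have hα1 : α ≤ 1 / 2 := hα ▸ clip_le _ _ _
  have hμ1 : μ ≤ 1 / 2 := hμ ▸ clip_le _ _ _
  have hαb : α * ‖mulW X s.w‖ ≤ h.δ * h.ε := hα ▸ clip_mul_le hb0.le (norm_nonneg _)
  have hμb : μ * ‖mulW Z s.w‖ ≤ h.δ * h.ε := hμ ▸ clip_mul_le hb0.le (norm_nonneg _)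
  have hd1 := hS.Lhat_noisy_eta_step_le hm i s.θ (s.η i) (gradEtaMean D G ξ s.θ s.η i)
    (mulW Z s.w) hγ.le hμ0 hμb
  rw [← hηi, ← hinnerZ] at hd1
  have hd2 := hS.Lhat_noisy_theta_step_le hm i s.θ (X i) (mulW X s.w) (stepEta D G h ξ s i)
    hγ.le hα0 hαb
  -- The drift is kept proportional to `μ ‖Z w‖`, not replaced by its bound in `b`, so that
  -- `second_order_le` can absorb it into the gain.
  have hgη : |gradEta D G i s.θ (stepEta D G h ξ s i)|
      ≤ Lam1 m G M D.lam h.F + L2hat m G M D.lam * (h.γ * (μ * ‖mulW Z s.w‖)) := by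
    have f1 := hS.abs_gradEta_le_Lam1 hm (hb i) (hgap i)
    have f2 := abs_gradEta_stepEta_sub_le hS hm hA ξ s i
    rw [← hZ, ← hμ] at f2
    have f3 := abs_sub_abs_le_abs_sub (gradEta D G i s.θ (stepEta D G h ξ s i))
      (gradEta D G i s.θ (s.η i))
    linarith
  have hsec := second_order_le (r := ‖mulW Z s.w‖) (s := ‖mulW X s.w‖) hγ hA.ϑ_pos
    (by norm_num : (1 : ℝ) / 10000 ≤ 1) (hS.L2hat_pos hm).le hα0 hα1 hμ0 hμ1 (norm_nonneg _)
    hαb hA.γ_le_theta hA.γ_le_eta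
    (by have := hA.γ_le_young; rwa [← mul_pow] at this)
  have hq := mul_le_mul_of_nonneg_right (mul_le_mul_of_nonneg_left hgη (hS.L1hat_pos hm).le)
    (show 0 ≤ (h.γ * (α * ‖mulW X s.w‖)) ^ 2 / 2 by positivity)
  -- Multiplication by `γ` gives the telescoping distances the coefficient `γ/(2β)` of the
  -- potential.
  have hwt' := mul_le_mul_of_nonneg_left (hwt.trans (by linarith [hdir] : _ ≤
    -(α * ‖mulW X s.w‖ ^ 2 + μ * ‖mulW Z s.w‖ ^ 2)
        + (‖s.w - EuclideanSpace.single i (1 : ℝ)‖ ^ 2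
          - ‖projSimplex (s.w - h.β • g) - EuclideanSpace.single i (1 : ℝ)‖ ^ 2) / (2 * h.β)
        + (16 / 10000 * (h.δ * h.ε) ^ 2
        + 3 * (h.δ * h.ε) ^ 2 * h.β * ∑ j, stepErr D G h ξ ξ' s j))) hγ.le
  rw [e_η, e_θ, e_w, hgain, herr]
  generalize ∑ j, stepErr D G h ξ ξ' s j = E at hwt' ⊢
  generalize ‖projSimplex (s.w - h.β • g) - EuclideanSpace.single i (1 : ℝ)‖ ^ 2 = q1 at hwt' ⊢
  generalize ‖s.w - EuclideanSpace.single i (1 : ℝ)‖ ^ 2 = q2 at hwt' ⊢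
  generalize Lhat D G i (s.θ - (h.γ * α) • mulW X s.w) (stepEta D G h ξ s i) = l2 at hd2 ⊢
  generalize Lhat D G i s.θ (stepEta D G h ξ s i) = l1 at hd1 hd2
  generalize Lhat D G i s.θ (s.η i) = l0 at hd1 ⊢
  generalize ‖X i - gradTheta D G i s.θ (stepEta D G h ξ s i)‖ = x at hd2 ⊢
  generalize gradEtaMean D G ξ s.θ s.η i - gradEta D G i s.θ (s.η i) = y at hd1 ⊢
  generalize |gradEta D G i s.θ (stepEta D G h ξ s i)| = u at hd2 hq
  generalize inner ℝ (X i) (mulW X s.w) = ix at hd2 hwt'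
  generalize inner ℝ (Z i) (mulW Z s.w) = iz at hd1 hwt'
  generalize ‖mulW X s.w‖ = nx at *
  generalize ‖mulW Z s.w‖ = nz at *
  generalize h.δ * h.ε = b at *
  generalize Lam1 m G M D.lam h.F = Λ at *
  generalize L0hat G L M D.lam = L0 at *
  generalize L1hat m G L = L1 at *
  generalize L2hat m G M D.lam = L2 at *
  have hexp : h.γ * ((q2 - q1) / (2 * h.β)) = h.γ / (2 * h.β) * q2 - h.γ / (2 * h.β) * q1 := by
    ring
  -- Slack for the `b²` terms: `2/200 + 16/10000 ≤ 1/80`.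
  have hpos : 0 ≤ h.γ * b ^ 2 := by positivity
  linarith

/-- The balanced gradient is controlled by the gain of the iteration. -/
theorem mul_norm_fullGrad_le (hS : StandingAssumptions D G L M κ) (hm : 0 < m)
    (hA : Admissible (1 / 10000) 100000 m G L M D.lam κ Δ h)
    (ξ : Fin h.N₂ → Fin m → Ξ) (ξ' : Fin h.N₁ → Fin m → Ξ) {s : State n m}
    (hw : s.w ∈ simplex m) :
    (h.δ * h.ε) * ‖mulW (fullGrad D G s.θ (step D G h ξ ξ' s).η) s.w‖
      ≤ stepGain D G h ξ ξ' s + 51 / 50 * (h.δ * h.ε) ^ 2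
        + 50 * ∑ j, s.w j * stepErr D G h ξ ξ' s j := by
  have e_η : (step D G h ξ ξ' s).η = stepEta D G h ξ s := rfl
  rw [e_η]
  set Z := gradEtaBatch D G ξ s.θ s.η with hZ
  set η' := stepEta D G h ξ s with hη'
  set X := gradThetaBatch D G ξ' s.θ η' with hX
  set b := h.δ * h.ε with hbdef
  have hb0 : 0 < b := hA.acc_pos
  have hZ' : Z = fun j => EuclideanSpace.single j (gradEtaMean D G ξ s.θ s.η j) :=
    funext fun j => hS.gradEtaBatch_eq ξ s.θ s.η j
  have hfst : (mulW (fullGrad D G s.θ η') s.w).fst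
      = mulW (fun j => gradTheta D G j s.θ (η' j)) s.w := by
    change (WithLp.ofLp (∑ j, s.w j • fullGrad D G s.θ η' j)).1 = _
    rw [WithLp.ofLp_sum, Prod.fst_sum]
    simp only [fullGrad, hS.gradient_Lhat]
    rfl
  have hsnd : (mulW (fullGrad D G s.θ η') s.w).snd
      = mulW (fun j => EuclideanSpace.single j (gradEta D G j s.θ (η' j))) s.w := by
    change (WithLp.ofLp (∑ j, s.w j • fullGrad D G s.θ η' j)).2 = _
    rw [WithLp.ofLp_sum, Prod.snd_sum]
    simp only [fullGrad, hS.deriv_Lhat]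
    rfl
  have hnorm : ‖mulW (fullGrad D G s.θ η') s.w‖
      ≤ ‖mulW (fun j => gradTheta D G j s.θ (η' j)) s.w‖
        + ‖mulW (fun j => EuclideanSpace.single j (gradEta D G j s.θ (η' j))) s.w‖ := by
    rw [WithLp.prod_norm_eq_of_L2, hfst, hsnd]
    refine Real.sqrt_le_iff.2 ⟨by positivity, ?_⟩
    nlinarith [norm_nonneg (mulW (fun j => gradTheta D G j s.θ (η' j)) s.w),
      norm_nonneg (mulW (fun j => EuclideanSpace.single j (gradEta D G j s.θ (η' j))) s.w)]
  have hθ : ‖mulW (fun j => gradTheta D G j s.θ (η' j)) s.w‖ ≤ ‖mulW X s.w‖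
      + ∑ j, s.w j * ‖X j - gradTheta D G j s.θ (η' j)‖ := by
    have h1 := norm_sub_norm_le (mulW (fun j => gradTheta D G j s.θ (η' j)) s.w) (mulW X s.w)
    rw [norm_sub_rev, ← mulW_sub] at h1
    have h2 := norm_mulW_le hw (fun j => X j - gradTheta D G j s.θ (η' j))
    linarith
  -- The η-estimator is sampled at `η_t` but the gradient is measured at `η_{t+1}`; the term
  -- `b/10000` accounts for this mismatch.
  have hη : ‖mulW (fun j => EuclideanSpace.single j (gradEta D G j s.θ (η' j))) s.w‖
      ≤ ‖mulW Z s.w‖ + ∑ j, s.w j * (|gradEtaMean D G ξ s.θ s.η j - gradEta D G j s.θ (s.η j)|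
        + 1 / 10000 * b) := by
    have h1 := norm_sub_norm_le
      (mulW (fun j => EuclideanSpace.single j (gradEta D G j s.θ (η' j))) s.w) (mulW Z s.w)
    rw [norm_sub_rev, ← mulW_sub] at h1
    have h2 := norm_mulW_le hw
      (fun j => Z j - EuclideanSpace.single j (gradEta D G j s.θ (η' j)))
    have h3 : ∑ j, s.w j * ‖Z j - EuclideanSpace.single j (gradEta D G j s.θ (η' j))‖
        ≤ ∑ j, s.w j * (|gradEtaMean D G ξ s.θ s.η j - gradEta D G j s.θ (s.η j)|
          + 1 / 10000 * b) := by
      refine Finset.sum_le_sum fun j _ => mul_le_mul_of_nonneg_left ?_ (hw.1 j)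
      have h4 : Z j - EuclideanSpace.single j (gradEta D G j s.θ (η' j))
          = EuclideanSpace.single j (gradEtaMean D G ξ s.θ s.η j - gradEta D G j s.θ (η' j)) := by
        rw [hZ']
        ext k
        by_cases hk : k = j <;> simp [hk]
      rw [h4, PiLp.norm_single, Real.norm_eq_abs]
      have h5 := abs_gradEta_stepEta_sub_le' hS hm hA ξ s j
      rw [abs_sub_comm] at h5
      have h6 := abs_sub_le (gradEtaMean D G ξ s.θ s.η j) (gradEta D G j s.θ (s.η j))
        (gradEta D G j s.θ (η' j))
      linarith
    linarith
  have hcX := mul_le_clip_half_mul_sq (b := b) (r := ‖mulW X s.w‖)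
  have hcZ := mul_le_clip_half_mul_sq (b := b) (r := ‖mulW Z s.w‖)
  have hgain : stepGain D G h ξ ξ' s = clip (1 / 2) b ‖mulW X s.w‖ * ‖mulW X s.w‖ ^ 2
      + clip (1 / 2) b ‖mulW Z s.w‖ * ‖mulW Z s.w‖ ^ 2 := rfl
  -- Young's inequality for each of the two errors gives `2 · b²/200`, and the drift adds
  -- `b²/10000`. The errors keep the weights `w_j`, which avoids a factor `m` later.
  have hsum : b * (∑ j, s.w j * ‖X j - gradTheta D G j s.θ (η' j)‖
      + ∑ j, s.w j * (|gradEtaMean D G ξ s.θ s.η j - gradEta D G j s.θ (s.η j)| + 1 / 10000 * b))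
      ≤ 101 / 10000 * b ^ 2 + 50 * ∑ j, s.w j * stepErr D G h ξ ξ' s j := by
    rw [← Finset.sum_add_distrib, Finset.mul_sum, Finset.mul_sum]
    have hone : 101 / 10000 * b ^ 2 = ∑ j, s.w j * (101 / 10000 * b ^ 2) := by
      rw [← Finset.sum_mul, hw.2, one_mul]
    rw [hone, ← Finset.sum_add_distrib]
    refine Finset.sum_le_sum fun j _ => ?_
    have herr : stepErr D G h ξ ξ' s j = ‖X j - gradTheta D G j s.θ (η' j)‖ ^ 2
      + |gradEtaMean D G ξ s.θ s.η j - gradEta D G j s.θ (s.η j)| ^ 2 := by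
      rw [sq_abs]
      rfl
    rw [herr]
    set x := ‖X j - gradTheta D G j s.θ (η' j)‖
    set y := |gradEtaMean D G ξ s.θ s.η j - gradEta D G j s.θ (s.η j)|
    have h7 : b * (x + (y + 1 / 10000 * b)) ≤ 101 / 10000 * b ^ 2 + 50 * (x ^ 2 + y ^ 2) := by
      nlinarith [sq_nonneg (b / 10 - 10 * x), sq_nonneg (b / 10 - 10 * y)]
    have h8 := mul_le_mul_of_nonneg_left h7 (hw.1 j)
    linarith
  rw [hgain]
  have h9 := mul_le_mul_of_nonneg_left (hnorm.trans (add_le_add hθ hη)) hb0.le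
  -- The two clipping inequalities contribute `b²/2` each, and `1 + 101/10000 ≤ 51/50`.
  nlinarith [sq_nonneg b]

end Iteration

/-! ### Sample means of independent draws -/

section SampleMean

variable {Ω : Type*} [MeasurableSpace Ω] {μ : Measure Ω} [IsProbabilityMeasure μ]
  {P : Measure Ξ} {B : ℕ} {Y : Fin B → Ω → Ξ}

/-- The variance of a mean of independent copies. The Lebesgue form makes integrability of the
weighted errors a consequence rather than a prerequisite. -/
theorem lintegral_sampleMean_sq (hB : 0 < B) (hY : ∀ k, Measurable (Y k))
    (hlaw : ∀ k, μ.map (Y k) = P) (hind : iIndepFun Y μ) {g : Ξ → ℝ} (hg : Measurable g)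
    (hgL : MemLp g 2 P) :
    ∫⁻ ω, ENNReal.ofReal (((B : ℝ)⁻¹ * ∑ k, g (Y k ω) - ∫ x, g x ∂P) ^ 2) ∂μ
      = ENNReal.ofReal (variance g P / B) := by
  have hB' : (B : ℝ) ≠ 0 := by exact_mod_cast hB.ne'
  have hmem : ∀ k, MemLp (fun ω => g (Y k ω)) 2 μ := by
    intro k
    have := hgL
    rw [← hlaw k, memLp_map_measure_iff hg.aestronglyMeasurable (hY k).aemeasurable] at this
    exact this
  have hmean : ∀ k, ∫ ω, g (Y k ω) ∂μ = ∫ x, g x ∂P := by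
    intro k
    rw [← hlaw k, integral_map (hY k).aemeasurable hg.aestronglyMeasurable]
  have hvar : ∀ k, variance (fun ω => g (Y k ω)) μ = variance g P := by
    intro k
    rw [← hlaw k, variance_map hg.aemeasurable (hY k).aemeasurable]
    rfl
  set U : Ω → ℝ := fun ω => (B : ℝ)⁻¹ * ∑ k, g (Y k ω) with hU
  have hUmem : MemLp U 2 μ := (memLp_finsetSum _ fun k _ => hmem k).const_mul _
  have hUmean : ∫ ω, U ω ∂μ = ∫ x, g x ∂P := by
    rw [hU, integral_const_mul, integral_finsetSum _ fun k _ => (hmem k).integrable (by norm_num)]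
    simp only [hmean, Finset.sum_const, Finset.card_univ, Fintype.card_fin, nsmul_eq_mul]
    rw [← mul_assoc, inv_mul_cancel₀ hB', one_mul]
  have hUvar : variance U μ = variance g P / B := by
    have h1 : (fun ω => ∑ k, g (Y k ω)) = ∑ k, fun ω => g (Y k ω) := by
      ext ω
      simp
    rw [hU, variance_const_mul, h1, IndepFun.variance_sum (fun k _ => hmem k)
      (fun k _ l _ hkl => (hind.indepFun hkl).comp hg hg)]
    simp only [hvar, Finset.sum_const, Finset.card_univ, Fintype.card_fin, nsmul_eq_mul]
    field_simp
  rw [← hUvar, ofReal_variance hUmem, evariance_eq_lintegral_ofReal, hUmean]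

/-- Apply the scalar case to each coordinate and bound every variance by a second moment. -/
theorem lintegral_sampleMean_norm_sq_le (hB : 0 < B) (hY : ∀ k, Measurable (Y k))
    (hlaw : ∀ k, μ.map (Y k) = P) (hind : iIndepFun Y μ) {g : Ξ → Vec n} (hg : Measurable g)
    (hgL : MemLp g 2 P) :
    ∫⁻ ω, ENNReal.ofReal (‖(B : ℝ)⁻¹ • ∑ k, g (Y k ω) - ∫ x, g x ∂P‖ ^ 2) ∂μ
      ≤ ENNReal.ofReal ((∫ x, ‖g x‖ ^ 2 ∂P) / B) := by
  have hP : IsProbabilityMeasure P := by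
    rw [← hlaw ⟨0, hB⟩]
    exact Measure.isProbabilityMeasure_map (hY _).aemeasurable
  have hgi : Integrable g P := hgL.integrable (by norm_num)
  have hcoord : ∀ l, Measurable fun x => g x l := fun l =>
    (EuclideanSpace.proj (𝕜 := ℝ) l).continuous.measurable.comp hg
  have hcoordL : ∀ l, MemLp (fun x => g x l) 2 P := fun l =>
    hgL.of_le (hcoord l).aestronglyMeasurable (Eventually.of_forall fun x => PiLp.norm_apply_le _ _)
  have hint : ∀ l, (∫ x, g x ∂P) l = ∫ x, g x l ∂P := fun l =>
    ((EuclideanSpace.proj (𝕜 := ℝ) l).integral_comp_comm hgi).symm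
  have hdec : ∀ ω, ENNReal.ofReal (‖(B : ℝ)⁻¹ • ∑ k, g (Y k ω) - ∫ x, g x ∂P‖ ^ 2)
      = ∑ l, ENNReal.ofReal (((B : ℝ)⁻¹ * ∑ k, g (Y k ω) l - ∫ x, g x l ∂P) ^ 2) := by
    intro ω
    rw [← ENNReal.ofReal_sum_of_nonneg fun l _ => sq_nonneg _, EuclideanSpace.norm_sq_eq]
    congr 1
    refine Finset.sum_congr rfl fun l _ => ?_
    rw [Real.norm_eq_abs, sq_abs, PiLp.sub_apply, PiLp.smul_apply, hint, WithLp.ofLp_sum,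
      Finset.sum_apply, smul_eq_mul]
  simp only [hdec]
  rw [lintegral_finsetSum]
  · simp only [lintegral_sampleMean_sq hB hY hlaw hind (hcoord _) (hcoordL _)]
    rw [← ENNReal.ofReal_sum_of_nonneg fun l _ => div_nonneg (variance_nonneg _ _)
      (Nat.cast_nonneg _), ← Finset.sum_div]
    refine ENNReal.ofReal_le_ofReal (div_le_div_of_nonneg_right ?_ (Nat.cast_nonneg _))
    calc ∑ l, variance (fun x => g x l) P ≤ ∑ l, ∫ x, (g x l) ^ 2 ∂P :=
          Finset.sum_le_sum fun l _ =>
            variance_le_expectation_sq (hcoord l).aestronglyMeasurable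
      _ = ∫ x, ∑ l, (g x l) ^ 2 ∂P :=
          (integral_finsetSum _ fun l _ => (hcoordL l).integrable_sq).symm
      _ = ∫ x, ‖g x‖ ^ 2 ∂P := by simp [EuclideanSpace.norm_sq_eq]
  · intro l _
    refine ENNReal.measurable_ofReal.comp (((Measurable.const_mul ?_ _).sub_const _).pow_const 2)
    exact Finset.measurable_sum _ fun k _ => (hcoord l).comp (hY k)

/-- Freezing the first of two independent variables. -/
theorem lintegral_le_of_indepFun {α β : Type*} [MeasurableSpace α] [MeasurableSpace β]
    {U : Ω → α} {W : Ω → β} (hU : Measurable U) (hW : Measurable W) (hUW : IndepFun U W μ)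
    {F : α × β → ℝ≥0∞} (hF : Measurable F) {φ : Ω → ℝ≥0∞}
    (h : ∀ ω, ∫⁻ ω', F (U ω, W ω') ∂μ ≤ φ ω) :
    ∫⁻ ω, F (U ω, W ω) ∂μ ≤ ∫⁻ ω, φ ω ∂μ := by
  have h1 := (indepFun_iff_map_prod_eq_prod_map_map hU.aemeasurable hW.aemeasurable).1 hUW
  have := Measure.isProbabilityMeasure_map (μ := μ) hW.aemeasurable
  have h2 : ∫⁻ ω, F (U ω, W ω) ∂μ = ∫⁻ ω, ∫⁻ ω', F (U ω, W ω') ∂μ ∂μ := by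
    rw [← lintegral_map hF (hU.prodMk hW), h1, lintegral_prod _ hF.aemeasurable,
      lintegral_map hF.lintegral_prod_right' hU]
    refine lintegral_congr fun ω => ?_
    exact lintegral_map (hF.comp measurable_prodMk_left) hW
  rw [h2]
  exact lintegral_mono h

end SampleMean

/-- A finite Lebesgue bound yields both integrability and the real inequality. -/
theorem integrable_and_integral_le_of_lintegral_le {Ω : Type*} [MeasurableSpace Ω]
    {μ : Measure Ω} {f p : Ω → ℝ} {v : ℝ} (hf : Measurable f)
    (hf0 : ∀ ω, 0 ≤ f ω) (hp : Integrable p μ) (hp0 : ∀ ω, 0 ≤ p ω) (hv : 0 ≤ v)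
    (h : ∫⁻ ω, ENNReal.ofReal (f ω) ∂μ ≤ ∫⁻ ω, ENNReal.ofReal (p ω * v) ∂μ) :
    Integrable f μ ∧ ∫ ω, f ω ∂μ ≤ v * ∫ ω, p ω ∂μ := by
  have hpv : Integrable (fun ω => p ω * v) μ := hp.mul_const v
  have h0 : ∀ ω, 0 ≤ p ω * v := fun ω => mul_nonneg (hp0 ω) hv
  rw [← ofReal_integral_eq_lintegral_ofReal hpv (Eventually.of_forall h0)] at h
  have hint : Integrable f μ := by
    refine ⟨hf.aestronglyMeasurable, ?_⟩
    rw [hasFiniteIntegral_iff_ofReal (Eventually.of_forall hf0)]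
    exact h.trans_lt ENNReal.ofReal_lt_top
  refine ⟨hint, ?_⟩
  rw [← ofReal_integral_eq_lintegral_ofReal hint (Eventually.of_forall hf0)] at h
  have := (ENNReal.ofReal_le_ofReal_iff (integral_nonneg h0)).1 h
  rwa [integral_mul_const, mul_comm] at this


/-! ### Measurability of the iteration -/

section Measurability

variable {D : Problem n m Ξ} {G L M κ : ℝ} {Ω : Type*} [MeasurableSpace Ω]

theorem measurable_vec_apply {k : ℕ} {f : Ω → Vec k} (hf : Measurable f) (i : Fin k) :
    Measurable fun ω => f ω i :=
  (EuclideanSpace.proj (𝕜 := ℝ) i).continuous.measurable.comp hf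

theorem measurable_draw {B : ℕ} {y : Ω → Fin B → Fin m → Ξ} (hy : Measurable y) (k : Fin B)
    (i : Fin m) : Measurable fun ω => y ω k i :=
  (measurable_pi_apply i).comp ((measurable_pi_apply k).comp hy)

theorem StandingAssumptions.measurable_gradThetaBatch (hS : StandingAssumptions D G L M κ) {B : ℕ}
    {y : Ω → Fin B → Fin m → Ξ} {θ : Ω → Vec n} {η : Ω → Vec m} (hy : Measurable y)
    (hθ : Measurable θ) (hη : Measurable η) (i : Fin m) :
    Measurable fun ω => gradThetaBatch D G (y ω) (θ ω) (η ω) i := by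
  simp only [hS.gradThetaBatch_eq]
  exact (Finset.measurable_sum _ fun k _ => (hS.measurable_sampleGradTheta i).comp
    ((hθ.prodMk (measurable_vec_apply hη i)).prodMk (measurable_draw hy k i))).const_smul (B : ℝ)⁻¹

theorem StandingAssumptions.measurable_gradEtaMean (hS : StandingAssumptions D G L M κ) {B : ℕ}
    {y : Ω → Fin B → Fin m → Ξ} {θ : Ω → Vec n} {η : Ω → Vec m} (hy : Measurable y)
    (hθ : Measurable θ) (hη : Measurable η) (i : Fin m) :
    Measurable fun ω => gradEtaMean D G (y ω) (θ ω) (η ω) i :=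
  (Finset.measurable_sum _ fun k _ => (hS.measurable_sampleGradEta i).comp
    ((hθ.prodMk (measurable_vec_apply hη i)).prodMk (measurable_draw hy k i))).const_mul _

theorem measurable_vec_single {k : ℕ} {f : Ω → ℝ} (hf : Measurable f) (i : Fin k) :
    Measurable fun ω => (EuclideanSpace.single i (f ω) : Vec k) := by
  have : (fun ω => (EuclideanSpace.single i (f ω) : Vec k))
      = fun ω => f ω • (EuclideanSpace.single i (1 : ℝ) : Vec k) := by
    ext ω j
    by_cases h : j = i <;> simp [h]
  rw [this]
  exact hf.smul_const _

theorem StandingAssumptions.measurable_gradEtaBatch (hS : StandingAssumptions D G L M κ) {B : ℕ}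
    {y : Ω → Fin B → Fin m → Ξ} {θ : Ω → Vec n} {η : Ω → Vec m} (hy : Measurable y)
    (hθ : Measurable θ) (hη : Measurable η) (i : Fin m) :
    Measurable fun ω => gradEtaBatch D G (y ω) (θ ω) (η ω) i := by
  simp only [hS.gradEtaBatch_eq]
  exact measurable_vec_single (hS.measurable_gradEtaMean hy hθ hη i) i

theorem StandingAssumptions.measurable_errTheta (hS : StandingAssumptions D G L M κ) {B : ℕ}
    {y : Ω → Fin B → Fin m → Ξ} {θ : Ω → Vec n} {η : Ω → Vec m} (hy : Measurable y)
    (hθ : Measurable θ) (hη : Measurable η) (i : Fin m) :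
    Measurable fun ω => errTheta D G (y ω) (θ ω) (η ω) i :=
  ((hS.measurable_gradThetaBatch hy hθ hη i).sub ((hS.measurable_gradTheta i).comp
    (hθ.prodMk (measurable_vec_apply hη i)))).norm.pow_const 2

theorem StandingAssumptions.measurable_errEta (hS : StandingAssumptions D G L M κ) {B : ℕ}
    {y : Ω → Fin B → Fin m → Ξ} {θ : Ω → Vec n} {η : Ω → Vec m} (hy : Measurable y)
    (hθ : Measurable θ) (hη : Measurable η) (i : Fin m) :
    Measurable fun ω => errEta D G (y ω) (θ ω) (η ω) i :=
  ((hS.measurable_gradEtaMean hy hθ hη i).sub ((hS.measurable_gradEta i).comp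
    (hθ.prodMk (measurable_vec_apply hη i)))).pow_const 2

theorem measurable_mulW {k : ℕ} {A : Ω → Fin m → Vec k} {w : Ω → Vec m}
    (hA : ∀ i, Measurable fun ω => A ω i) (hw : Measurable w) :
    Measurable fun ω => mulW (A ω) (w ω) :=
  Finset.measurable_sum _ fun i _ => (measurable_vec_apply hw i).smul (hA i)

theorem measurable_gramW {k : ℕ} {A : Ω → Fin m → Vec k} {w : Ω → Vec m}
    (hA : ∀ i, Measurable fun ω => A ω i) (hw : Measurable w) :
    Measurable fun ω => gramW (A ω) (w ω) :=
  (WithLp.measurable_toLp 2 _).comp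
    (measurable_pi_lambda _ fun i => (hA i).inner (measurable_mulW hA hw))

theorem measurable_clip (a b : ℝ) : Measurable (clip a b) :=
  Measurable.ite (measurableSet_singleton 0) measurable_const
    (measurable_const.min (measurable_const.div measurable_id))

/-- The three components of a random iterate are measurable. -/
def MeasurableState (s : Ω → State n m) : Prop :=
  Measurable (fun ω => (s ω).θ) ∧ Measurable (fun ω => (s ω).η) ∧ Measurable fun ω => (s ω).w

variable {h : Params} {s : Ω → State n m} {y : Ω → Fin h.N₂ → Fin m → Ξ}
  {y' : Ω → Fin h.N₁ → Fin m → Ξ}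

theorem StandingAssumptions.measurable_stepEta (hS : StandingAssumptions D G L M κ)
    (hs : MeasurableState s) (hy : Measurable y) :
    Measurable fun ω => stepEta D G h (y ω) (s ω) := by
  have hZ := measurable_mulW (fun i => hS.measurable_gradEtaBatch hy hs.1 hs.2.1 i) hs.2.2
  exact hs.2.1.sub ((((measurable_clip _ _).comp hZ.norm).const_mul h.γ).smul hZ)

theorem StandingAssumptions.measurable_step (hS : StandingAssumptions D G L M κ) (hm : 0 < m)
    (hs : MeasurableState s) (hy : Measurable y) (hy' : Measurable y') :
    MeasurableState fun ω => step D G h (y ω) (y' ω) (s ω) := by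
  have hη := hS.measurable_stepEta hs hy
  have hZc : ∀ i, Measurable fun ω => gradEtaBatch D G (y ω) (s ω).θ (s ω).η i :=
    fun i => hS.measurable_gradEtaBatch hy hs.1 hs.2.1 i
  have hXc : ∀ i, Measurable fun ω =>
      gradThetaBatch D G (y' ω) (s ω).θ (stepEta D G h (y ω) (s ω)) i :=
    fun i => hS.measurable_gradThetaBatch hy' hs.1 hη i
  have hZ := measurable_mulW hZc hs.2.2
  have hX := measurable_mulW hXc hs.2.2
  have hμ := (measurable_clip (1 / 2) (h.δ * h.ε)).comp hZ.norm
  have hα := (measurable_clip (1 / 2) (h.δ * h.ε)).comp hX.norm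
  refine ⟨hs.1.sub ((hα.const_mul h.γ).smul hX), hη, ?_⟩
  exact (continuous_projSimplex hm).measurable.comp (hs.2.2.sub
    ((((hα.smul (measurable_gramW hXc hs.2.2)).add (hμ.smul (measurable_gramW hZc hs.2.2))).add
      (hs.2.2.const_smul h.ρ)).const_smul h.β))

end Measurability

section

variable {D : Problem n m Ξ} {G L M κ : ℝ}

theorem StandingAssumptions.measurable_sampleGradEta_apply (h : StandingAssumptions D G L M κ)
    (i : Fin m) (θ : Vec n) (η : ℝ) : Measurable (sampleGradEta D G i θ η) := by
  have hpair : Measurable fun x : Ξ => ((θ, η), x) := measurable_const.prodMk measurable_id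
  have h1 := (h.measurable_sampleGradEta i).comp hpair
  exact h1

theorem StandingAssumptions.measurable_sampleGradTheta_apply (h : StandingAssumptions D G L M κ)
    (i : Fin m) (θ : Vec n) (η : ℝ) : Measurable (sampleGradTheta D G i θ η) := by
  have hpair : Measurable fun x : Ξ => ((θ, η), x) := measurable_const.prodMk measurable_id
  have h1 := (h.measurable_sampleGradTheta i).comp hpair
  exact h1

end

/-! ### Past and fresh draws -/

/-- The family of all draws, indexed as in `IsSampling`. -/
def draw {Ω : Type*} {N₁ N₂ : ℕ} (ξ : ℕ → Fin N₂ → Ω → Fin m → Ξ)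
    (ξ' : ℕ → Fin N₁ → Ω → Fin m → Ξ) (k : (ℕ × Fin N₂) ⊕ (ℕ × Fin N₁)) : Ω → Fin m → Ξ :=
  Sum.elim (fun p => ξ p.1 p.2) (fun p => ξ' p.1 p.2) k

/-- The σ-algebra generated by the draws with indices in `S`. -/
@[reducible]
def drawSigma {Ω : Type*} {N₁ N₂ : ℕ} (ξ : ℕ → Fin N₂ → Ω → Fin m → Ξ)
    (ξ' : ℕ → Fin N₁ → Ω → Fin m → Ξ) (S : Set ((ℕ × Fin N₂) ⊕ (ℕ × Fin N₁))) :
    MeasurableSpace Ω :=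
  ⨆ k ∈ S, MeasurableSpace.comap (draw ξ ξ' k) inferInstance

section Draws

variable {Ω : Type*} {N₁ N₂ : ℕ} {ξ : ℕ → Fin N₂ → Ω → Fin m → Ξ}
  {ξ' : ℕ → Fin N₁ → Ω → Fin m → Ξ}

theorem measurable_draw_of_mem {S : Set ((ℕ × Fin N₂) ⊕ (ℕ × Fin N₁))}
    {k : (ℕ × Fin N₂) ⊕ (ℕ × Fin N₁)} (hk : k ∈ S) :
    Measurable[drawSigma ξ ξ' S] (draw ξ ξ' k) :=
  Measurable.mono (comap_measurable _)
    (le_iSup₂ (f := fun k (_ : k ∈ S) => MeasurableSpace.comap (draw ξ ξ' k) inferInstance) k hk)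
    le_rfl

theorem drawSigma_mono {S S' : Set ((ℕ × Fin N₂) ⊕ (ℕ × Fin N₁))} (h : S ⊆ S') :
    drawSigma ξ ξ' S ≤ drawSigma ξ ξ' S' :=
  biSup_mono h

variable [MeasurableSpace Ω] {μ : Measure Ω} {D : Problem n m Ξ}

theorem IsSampling.measurable_draw (hI : IsSampling D μ ξ ξ')
    (k : (ℕ × Fin N₂) ⊕ (ℕ × Fin N₁)) : Measurable (draw ξ ξ' k) := by
  cases k with
  | inl p => exact hI.measurable_left p.1 p.2
  | inr p => exact hI.measurable_right p.1 p.2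

theorem IsSampling.drawSigma_le (hI : IsSampling D μ ξ ξ')
    (S : Set ((ℕ × Fin N₂) ⊕ (ℕ × Fin N₁))) : drawSigma ξ ξ' S ≤ ‹MeasurableSpace Ω› :=
  iSup₂_le fun k _ => (hI.measurable_draw k).comap_le

theorem IsSampling.indep_drawSigma (hI : IsSampling D μ ξ ξ')
    {S S' : Set ((ℕ × Fin N₂) ⊕ (ℕ × Fin N₁))} (h : Disjoint S S') :
    Indep (drawSigma ξ ξ' S) (drawSigma ξ ξ' S') μ :=
  indep_iSup_of_disjoint (fun k => (hI.measurable_draw k).comap_le)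
    ((iIndepFun_iff_iIndep _ _ _).1 hI.indep) h

theorem IsSampling.indepFun_left (hI : IsSampling D μ ξ ξ') {t : ℕ}
    {S : Set ((ℕ × Fin N₂) ⊕ (ℕ × Fin N₁))} (hS : ∀ j, Sum.inl (t, j) ∉ S)
    {α : Type*} [MeasurableSpace α] {U : Ω → α} (hU : Measurable[drawSigma ξ ξ' S] U) :
    IndepFun U (fun ω j => ξ t j ω) μ := by
  rw [IndepFun_iff_Indep]
  have hdisj : Disjoint S (Set.range fun j => Sum.inl (t, j)) := by
    rw [Set.disjoint_right]
    rintro _ ⟨j, rfl⟩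
    exact hS j
  refine indep_of_indep_of_le_left (indep_of_indep_of_le_right (hI.indep_drawSigma hdisj) ?_)
    hU.comap_le
  have hb : Measurable[drawSigma ξ ξ' (Set.range fun j => Sum.inl (t, j))]
      fun ω j => ξ t j ω := by
    let := drawSigma ξ ξ' (Set.range fun j => Sum.inl (t, j))
    exact measurable_pi_lambda _ fun j =>
      measurable_draw_of_mem (ξ := ξ) (ξ' := ξ') (k := Sum.inl (t, j)) ⟨j, rfl⟩
  exact hb.comap_le

theorem IsSampling.indepFun_right (hI : IsSampling D μ ξ ξ') {t : ℕ}
    {S : Set ((ℕ × Fin N₂) ⊕ (ℕ × Fin N₁))} (hS : ∀ j, Sum.inr (t, j) ∉ S)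
    {α : Type*} [MeasurableSpace α] {U : Ω → α} (hU : Measurable[drawSigma ξ ξ' S] U) :
    IndepFun U (fun ω j => ξ' t j ω) μ := by
  rw [IndepFun_iff_Indep]
  have hdisj : Disjoint S (Set.range fun j => Sum.inr (t, j)) := by
    rw [Set.disjoint_right]
    rintro _ ⟨j, rfl⟩
    exact hS j
  refine indep_of_indep_of_le_left (indep_of_indep_of_le_right (hI.indep_drawSigma hdisj) ?_)
    hU.comap_le
  have hb : Measurable[drawSigma ξ ξ' (Set.range fun j => Sum.inr (t, j))]
      fun ω j => ξ' t j ω := by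
    let := drawSigma ξ ξ' (Set.range fun j => Sum.inr (t, j))
    exact measurable_pi_lambda _ fun j =>
      measurable_draw_of_mem (ξ := ξ) (ξ' := ξ') (k := Sum.inr (t, j)) ⟨j, rfl⟩
  exact hb.comap_le

/-- For a fixed task the draws of a batch are independent in `j`. The joint law of different tasks
within a draw plays no role, as errors are estimated task by task. -/
theorem IsSampling.iIndepFun_left (hI : IsSampling D μ ξ ξ') (t : ℕ) (i : Fin m) :
    iIndepFun (fun j ω => ξ t j ω i) μ := by
  have h1 := hI.indep.precomp (g := fun j : Fin N₂ => Sum.inl (t, j))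
    (fun a b hab => by simpa using hab)
  exact h1.comp (fun _ x => x i) fun _ => measurable_pi_apply i

theorem IsSampling.iIndepFun_right (hI : IsSampling D μ ξ ξ') (t : ℕ) (i : Fin m) :
    iIndepFun (fun j ω => ξ' t j ω i) μ := by
  have h1 := hI.indep.precomp (g := fun j : Fin N₁ => Sum.inr (t, j))
    (fun a b hab => by simpa using hab)
  exact h1.comp (fun _ x => x i) fun _ => measurable_pi_apply i

variable [IsProbabilityMeasure μ] {G L M κ : ℝ}

/-- The conditional second moment of the error in `η`, given the past. -/
theorem IsSampling.integral_errEta_le (hI : IsSampling D μ ξ ξ')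
    (hA : StandingAssumptions D G L M κ) (hN : 0 < N₂) {t : ℕ}
    {S : Set ((ℕ × Fin N₂) ⊕ (ℕ × Fin N₁))} (hS : ∀ j, Sum.inl (t, j) ∉ S)
    {p : Ω → ℝ} {θ : Ω → Vec n} {η : Ω → Vec m} (hp : Measurable[drawSigma ξ ξ' S] p)
    (hθ : Measurable[drawSigma ξ ξ' S] θ) (hη : Measurable[drawSigma ξ ξ' S] η)
    (hp0 : ∀ ω, 0 ≤ p ω) (hpi : Integrable p μ) (i : Fin m) {v : ℝ}
    (hv : K2hat m G M D.lam κ ≤ v * N₂) :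
    Integrable (fun ω => p ω * errEta D G (fun j => ξ t j ω) (θ ω) (η ω) i) μ ∧
      ∫ ω, p ω * errEta D G (fun j => ξ t j ω) (θ ω) (η ω) i ∂μ ≤ v * ∫ ω, p ω ∂μ := by
  have hN' : (0 : ℝ) < N₂ := by exact_mod_cast hN
  have hle := hI.drawSigma_le S
  have hy : Measurable fun ω (j : Fin N₂) => ξ t j ω :=
    measurable_pi_lambda _ fun j => hI.measurable_left t j
  have hU : Measurable[drawSigma ξ ξ' S] fun ω => (p ω, θ ω, η ω) := hp.prodMk (hθ.prodMk hη)
  have hF : Measurable fun q : (ℝ × Vec n × Vec m) × (Fin N₂ → Fin m → Ξ) =>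
      ENNReal.ofReal (q.1.1 * errEta D G q.2 q.1.2.1 q.1.2.2 i) :=
    ENNReal.measurable_ofReal.comp ((measurable_fst.comp measurable_fst).mul
      (hA.measurable_errEta measurable_snd
        (measurable_fst.comp (measurable_snd.comp measurable_fst))
        (measurable_snd.comp (measurable_snd.comp measurable_fst)) i))
  have hv0 : 0 ≤ v := by
    have h0 : 0 ≤ K2hat m G M D.lam κ := by unfold K2hat; positivity
    exact nonneg_of_mul_nonneg_left (h0.trans hv) hN'
  refine integrable_and_integral_le_of_lintegral_le ((hp.mono hle le_rfl).mul
    (hA.measurable_errEta hy (hθ.mono hle le_rfl) (hη.mono hle le_rfl) i))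
    (fun ω => mul_nonneg (hp0 ω) (sq_nonneg _)) hpi hp0 hv0 ?_
  refine lintegral_le_of_indepFun (hU.mono hle le_rfl) hy (hI.indepFun_left hS hU) hF fun ω => ?_
  simp only [ENNReal.ofReal_mul (hp0 ω)]
  have hme : Measurable fun ω' =>
      ENNReal.ofReal (errEta D G (fun j => ξ t j ω') (θ ω) (η ω) i) :=
    ENNReal.measurable_ofReal.comp (hA.measurable_errEta hy measurable_const measurable_const i)
  rw [lintegral_const_mul _ hme]
  refine mul_le_mul_right ?_ _
  have h1 := lintegral_sampleMean_sq hN (Y := fun j ω => ξ t j ω i)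
    (fun j => (measurable_pi_apply i).comp (hI.measurable_left t j))
    (fun j => hI.law_left t j i) (hI.iIndepFun_left t i)
    (hA.measurable_sampleGradEta_apply i (θ ω) (η ω i))
    (hA.memLp_sampleGradEta i (θ ω) (η ω i))
  simp only [errEta, gradEtaMean, gradEta]
  rw [h1]
  refine ENNReal.ofReal_le_ofReal ?_
  rw [div_le_iff₀ hN']
  exact (hA.variance_sampleGradEta_le i _ _).trans hv

/-- The conditional second moment of the error in `θ`, given the past. -/
theorem IsSampling.integral_errTheta_le (hI : IsSampling D μ ξ ξ')
    (hA : StandingAssumptions D G L M κ) (hm : 0 < m) (hN : 0 < N₁) {t : ℕ}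
    {S : Set ((ℕ × Fin N₂) ⊕ (ℕ × Fin N₁))} (hS : ∀ j, Sum.inr (t, j) ∉ S)
    {p : Ω → ℝ} {θ : Ω → Vec n} {η : Ω → Vec m} (hp : Measurable[drawSigma ξ ξ' S] p)
    (hθ : Measurable[drawSigma ξ ξ' S] θ) (hη : Measurable[drawSigma ξ ξ' S] η)
    (hp0 : ∀ ω, 0 ≤ p ω) (hpi : Integrable p μ) (i : Fin m) {v : ℝ} (hv0 : 0 ≤ v)
    (hv : ∀ ω, p ω ≠ 0 →
      K0hat G M D.lam κ + K1hat m * gradEta D G i (θ ω) (η ω i) ^ 2 ≤ v * N₁) :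
    Integrable (fun ω => p ω * errTheta D G (fun j => ξ' t j ω) (θ ω) (η ω) i) μ ∧
      ∫ ω, p ω * errTheta D G (fun j => ξ' t j ω) (θ ω) (η ω) i ∂μ ≤ v * ∫ ω, p ω ∂μ := by
  have hN' : (0 : ℝ) < N₁ := by exact_mod_cast hN
  have hle := hI.drawSigma_le S
  have hy : Measurable fun ω (j : Fin N₁) => ξ' t j ω :=
    measurable_pi_lambda _ fun j => hI.measurable_right t j
  have hU : Measurable[drawSigma ξ ξ' S] fun ω => (p ω, θ ω, η ω) := hp.prodMk (hθ.prodMk hη)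
  have hF : Measurable fun q : (ℝ × Vec n × Vec m) × (Fin N₁ → Fin m → Ξ) =>
      ENNReal.ofReal (q.1.1 * errTheta D G q.2 q.1.2.1 q.1.2.2 i) :=
    ENNReal.measurable_ofReal.comp ((measurable_fst.comp measurable_fst).mul
      (hA.measurable_errTheta measurable_snd
        (measurable_fst.comp (measurable_snd.comp measurable_fst))
        (measurable_snd.comp (measurable_snd.comp measurable_fst)) i))
  refine integrable_and_integral_le_of_lintegral_le ((hp.mono hle le_rfl).mul
    (hA.measurable_errTheta hy (hθ.mono hle le_rfl) (hη.mono hle le_rfl) i))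
    (fun ω => mul_nonneg (hp0 ω) (sq_nonneg _)) hpi hp0 hv0 ?_
  refine lintegral_le_of_indepFun (hU.mono hle le_rfl) hy (hI.indepFun_right hS hU) hF fun ω => ?_
  simp only [ENNReal.ofReal_mul (hp0 ω)]
  have hme : Measurable fun ω' =>
      ENNReal.ofReal (errTheta D G (fun j => ξ' t j ω') (θ ω) (η ω) i) :=
    ENNReal.measurable_ofReal.comp (hA.measurable_errTheta hy measurable_const measurable_const i)
  rw [lintegral_const_mul _ hme]
  -- The second moment of the θ-gradient is under control only where the gaps are bounded; elsewhere
  -- the weight vanishes and both sides are `0`.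
  by_cases hpω : p ω = 0
  · simp [hpω]
  refine mul_le_mul_right ?_ _
  have h1 := lintegral_sampleMean_norm_sq_le hN (Y := fun j ω => ξ' t j ω i)
    (fun j => (measurable_pi_apply i).comp (hI.measurable_right t j))
    (fun j => hI.law_right t j i) (hI.iIndepFun_right t i)
    (hA.measurable_sampleGradTheta_apply i (θ ω) (η ω i))
    (hA.memLp_sampleGradTheta i (θ ω) (η ω i))
  simp only [errTheta, hA.gradThetaBatch_eq]
  refine h1.trans (ENNReal.ofReal_le_ofReal ?_)
  rw [div_le_iff₀ hN']
  exact (hA.integral_sampleGradTheta_sq_le hm i _ _).trans (hv ω hpω)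

end Draws

/-! ### The random iterates -/

section Iterates

variable {D : Problem n m Ξ} {G L M κ : ℝ} {h : Params}

/-- The σ-algebra on `Ω` is arbitrary and only draws before `t` must be measurable, so the lemma
also applies to the σ-algebra of the past, where it says that the iterates are adapted. -/
theorem StandingAssumptions.measurable_run (hS : StandingAssumptions D G L M κ) (hm : 0 < m)
    {Ω : Type*} [MeasurableSpace Ω] {ξ : ℕ → Fin h.N₂ → Ω → Fin m → Ξ}
    {ξ' : ℕ → Fin h.N₁ → Ω → Fin m → Ξ} (s₀ : State n m) (t : ℕ)
    (hξ : ∀ r < t, ∀ j, Measurable (ξ r j)) (hξ' : ∀ r < t, ∀ j, Measurable (ξ' r j)) :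
    MeasurableState fun ω => run D G h (fun t j => ξ t j ω) (fun t j => ξ' t j ω) s₀ t := by
  induction t with
  | zero => exact ⟨measurable_const (a := s₀.θ), measurable_const (a := s₀.η),
      measurable_const (a := s₀.w)⟩
  | succ t ih =>
    exact hS.measurable_step hm
      (ih (fun r hr => hξ r (hr.trans t.lt_succ_self)) (fun r hr => hξ' r (hr.trans t.lt_succ_self)))
      (measurable_pi_lambda _ fun j => hξ t t.lt_succ_self j)
      (measurable_pi_lambda _ fun j => hξ' t t.lt_succ_self j)

theorem run_w_mem_simplex (hm : 0 < m) (ξ : ℕ → Fin h.N₂ → Fin m → Ξ)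
    (ξ' : ℕ → Fin h.N₁ → Fin m → Ξ) {s₀ : State n m} (hw : s₀.w ∈ simplex m) (t : ℕ) :
    (run D G h ξ ξ' s₀ t).w ∈ simplex m := by
  cases t with
  | zero => exact hw
  | succ t => exact (isProjSimplex_projSimplex hm _).1

/-- The indices of the draws before iteration `t`. -/
def pastIndices (N₁ N₂ t : ℕ) : Set ((ℕ × Fin N₂) ⊕ (ℕ × Fin N₁)) :=
  {k | Sum.elim Prod.fst Prod.fst k < t}

/-- The indices of the draws before the second mini-batch of iteration `t`. -/
def midIndices (N₁ N₂ t : ℕ) : Set ((ℕ × Fin N₂) ⊕ (ℕ × Fin N₁)) :=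
  pastIndices N₁ N₂ t ∪ Set.range fun j => Sum.inl (t, j)

variable {Ω : Type*} {ξ : ℕ → Fin h.N₂ → Ω → Fin m → Ξ} {ξ' : ℕ → Fin h.N₁ → Ω → Fin m → Ξ}

theorem StandingAssumptions.measurable_run_past (hS : StandingAssumptions D G L M κ) (hm : 0 < m)
    (s₀ : State n m) {r t : ℕ} (hr : r ≤ t) :
    @MeasurableState n m Ω (drawSigma ξ ξ' (pastIndices h.N₁ h.N₂ t))
      fun ω => run D G h (fun t j => ξ t j ω) (fun t j => ξ' t j ω) s₀ r := by
  let := drawSigma ξ ξ' (pastIndices h.N₁ h.N₂ t)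
  refine hS.measurable_run hm s₀ r (fun q hq j => ?_) (fun q hq j => ?_)
  · exact measurable_draw_of_mem (ξ := ξ) (ξ' := ξ') (k := Sum.inl (q, j))
      (show q < t from hq.trans_le hr)
  · exact measurable_draw_of_mem (ξ := ξ) (ξ' := ξ') (k := Sum.inr (q, j))
      (show q < t from hq.trans_le hr)

variable [MeasurableSpace Ω] {μ : Measure Ω} [IsProbabilityMeasure μ] {Δ : ℝ}

/-- The error of iteration `t`, weighted by a function of the past that vanishes unless all gaps
are at most `F`. -/
theorem IsSampling.integral_stepErr_le (hI : IsSampling D μ ξ ξ')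
    (hS : StandingAssumptions D G L M κ) (hm : 0 < m)
    (hA : Admissible (1 / 10000) 100000 m G L M D.lam κ Δ h)
    (hb : ∀ i, BddBelow (Set.range fun p : Vec n × ℝ => dual D i p.1 p.2)) (s₀ : State n m) (t : ℕ)
    {s : Ω → State n m}
    (hs : s = fun ω => run D G h (fun t j => ξ t j ω) (fun t j => ξ' t j ω) s₀ t)
    {p : Ω → ℝ} (hp : Measurable[drawSigma ξ ξ' (pastIndices h.N₁ h.N₂ t)] p)
    (hp0 : ∀ ω, 0 ≤ p ω) (hpi : Integrable p μ)
    (hgap : ∀ ω, p ω ≠ 0 → ∀ i, Lhat D G i (s ω).θ ((s ω).η i) - dualInf D i ≤ h.F) (i : Fin m) :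
    Integrable (fun ω => p ω * stepErr D G h (fun j => ξ t j ω) (fun j => ξ' t j ω) (s ω) i) μ ∧
      ∫ ω, p ω * stepErr D G h (fun j => ξ t j ω) (fun j => ξ' t j ω) (s ω) i ∂μ
        ≤ 5 / 100000 * (h.δ ^ 3 * h.ε ^ 2) * ∫ ω, p ω ∂μ := by
  have hδ := hA.δ_pos
  have hε := hA.ε_pos
  have hmeas := hS.measurable_run_past (ξ := ξ) (ξ' := ξ') hm s₀ (le_refl t)
  rw [← hs] at hmeas
  have hD : 0 < h.δ ^ 3 * h.ε ^ 2 := by positivity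
  have hm' : (0 : ℝ) < m := by exact_mod_cast hm
  have hK0 : 0 ≤ K0hat G M D.lam κ := by unfold K0hat; positivity
  have hK1 : 0 ≤ K1hat m := by unfold K1hat; positivity
  have h1 := hI.integral_errEta_le hS hA.N₂_pos (t := t) (S := pastIndices h.N₁ h.N₂ t)
    (fun j hj => lt_irrefl t hj) hp hmeas.1 hmeas.2.1 hp0 hpi i
    (v := 1 / 100000 * (h.δ ^ 3 * h.ε ^ 2)) (by
      have := hA.N₂_ge
      rw [← mul_div_assoc, div_le_iff₀ hD] at this
      linarith)
  have hmono : drawSigma ξ ξ' (pastIndices h.N₁ h.N₂ t)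
      ≤ drawSigma ξ ξ' (midIndices h.N₁ h.N₂ t) := drawSigma_mono Set.subset_union_left
  have hη' : Measurable[drawSigma ξ ξ' (midIndices h.N₁ h.N₂ t)]
      fun ω => stepEta D G h (fun j => ξ t j ω) (s ω) := by
    let := drawSigma ξ ξ' (midIndices h.N₁ h.N₂ t)
    refine hS.measurable_stepEta ⟨hmeas.1.mono hmono le_rfl, hmeas.2.1.mono hmono le_rfl,
      hmeas.2.2.mono hmono le_rfl⟩ (measurable_pi_lambda _ fun j => ?_)
    exact measurable_draw_of_mem (ξ := ξ) (ξ' := ξ') (k := Sum.inl (t, j)) (Or.inr ⟨j, rfl⟩)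
  -- The θ-batch is taken at the already updated η, so the first batch of iteration `t` belongs to
  -- the conditioning.
  have h2 := hI.integral_errTheta_le hS hm hA.N₁_pos (t := t) (S := midIndices h.N₁ h.N₂ t)
    (fun j hj => by
      rcases hj with hj | ⟨k, hk⟩
      · exact lt_irrefl t hj
      · exact Sum.inl_ne_inr hk)
    (hp.mono hmono le_rfl) (hmeas.1.mono hmono le_rfl) hη' hp0 hpi i
    (v := 4 / 100000 * (h.δ ^ 3 * h.ε ^ 2)) (by positivity) (fun ω hω => by
      have e0 := abs_gradEta_stepEta_le hS hm hA hb (fun j => ξ t j ω) (hgap ω hω i)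
      set Λ := Lam1 m G M D.lam h.F
      set b := h.δ * h.ε with hbd
      have hb0 : 0 < b := hA.acc_pos
      have e1 : gradEta D G i (s ω).θ (stepEta D G h (fun j => ξ t j ω) (s ω) i) ^ 2
          ≤ 2 * Λ ^ 2 + b ^ 2 := by
        rw [← sq_abs]
        refine (pow_le_pow_left₀ (abs_nonneg _) e0 2).trans ?_
        nlinarith [sq_nonneg (Λ - 1 / 10000 * b), sq_nonneg b]
      have hN := hA.N₁_ge
      have n1 : 100000 * K0hat G M D.lam κ ≤ h.N₁ * (h.δ ^ 3 * h.ε ^ 2) := by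
        rw [← div_le_iff₀ hD, mul_div_assoc]
        exact (mul_le_mul_of_nonneg_left (le_max_left _ _) (by norm_num)).trans hN
      have n2 : 100000 * K1hat m ≤ h.N₁ * h.δ := by
        rw [← div_le_iff₀ hδ, mul_div_assoc]
        exact (mul_le_mul_of_nonneg_left ((le_max_left _ _).trans (le_max_right _ _))
          (by norm_num)).trans hN
      have n3 : 100000 * (Λ ^ 2 * K1hat m) ≤ h.N₁ * (h.δ ^ 3 * h.ε ^ 2) := by
        rw [← div_le_iff₀ hD, mul_div_assoc]
        exact (mul_le_mul_of_nonneg_left ((le_max_right _ _).trans (le_max_right _ _))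
          (by norm_num)).trans hN
      have n4 : 100000 * K1hat m * b ^ 2 ≤ h.N₁ * (h.δ ^ 3 * h.ε ^ 2) := by
        have := mul_le_mul_of_nonneg_right n2 (sq_nonneg b)
        refine this.trans (le_of_eq ?_)
        rw [hbd]
        ring
      have n5 := mul_le_mul_of_nonneg_left e1 hK1
      -- In units of `δ³ ε² N₁ / 100000`, the terms with `K̂₀`, `2 Λ² K̂₁` and `b² K̂₁` cost `1`,
      -- `2` and `1`, which gives the factor `4`.
      linarith)
  have hsplit : (fun ω => p ω * stepErr D G h (fun j => ξ t j ω) (fun j => ξ' t j ω) (s ω) i)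
      = fun ω => p ω * errTheta D G (fun j => ξ' t j ω) (s ω).θ
          (stepEta D G h (fun j => ξ t j ω) (s ω)) i
        + p ω * errEta D G (fun j => ξ t j ω) (s ω).θ (s ω).η i := by
    ext ω
    rw [stepErr, mul_add]
  rw [hsplit]
  refine ⟨h2.1.add h1.1, ?_⟩
  rw [integral_add h2.1 h1.1]
  linarith [h1.2, h2.2]

end Iterates

/-! ### Descent up to a stopping time -/

/-- Before the first exit the indicator `a` equals `1`, so inserting it changes nothing; the
resulting sum, however, makes sense and has a small mean without any assumption on the trajectory.
-/
theorem stopped_descent {V gap R : ℕ → Fin m → ℝ} {S a : ℕ → ℝ} {γ F : ℝ}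
    (hstep : ∀ t, (∀ i, gap t i ≤ F) → ∀ i, V (t + 1) i ≤ V t i - γ / 2 * S t + γ * R t i)
    (ha : ∀ t, (∀ r ≤ t, ∀ i, gap r i ≤ F) → a t = 1) (T : ℕ)
    (hT : ∀ r < T, ∀ i, gap r i ≤ F) (i : Fin m) :
    V T i + γ / 2 * ∑ t ∈ Finset.range T, S t
      ≤ V 0 i + γ * ∑ t ∈ Finset.range T, a t * R t i := by
  induction T with
  | zero => simp
  | succ T ih =>
    have h1 := ih fun r hr => hT r (hr.trans T.lt_succ_self)
    have h2 := hstep T (hT T T.lt_succ_self) i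
    have h3 := ha T fun r hr => hT r (Nat.lt_succ_of_le hr)
    rw [Finset.sum_range_succ, Finset.sum_range_succ, h3]
    linarith

/-- At the first exit time the descent is still available and forces the potential of the exiting
task above `F`. Summing over all tasks gives one majorant for every task and every exit time, so a
single Markov bound suffices; this is the factor `m` in the choice of `F`. -/
theorem le_sum_of_gap_gt {V gap R : ℕ → Fin m → ℝ} {S a : ℕ → ℝ} {γ F : ℝ} (hγ : 0 ≤ γ)
    (hstep : ∀ t, (∀ i, gap t i ≤ F) → ∀ i, V (t + 1) i ≤ V t i - γ / 2 * S t + γ * R t i)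
    (ha : ∀ t, (∀ r ≤ t, ∀ i, gap r i ≤ F) → a t = 1) (ha0 : ∀ t, 0 ≤ a t)
    (hS : ∀ t, 0 ≤ S t) (hR : ∀ t i, 0 ≤ R t i) (hV : ∀ t i, 0 ≤ V t i)
    (hgV : ∀ t i, gap t i ≤ V t i) (T : ℕ) (hT : ¬ ∀ r < T, ∀ i, gap r i ≤ F) :
    F ≤ ∑ i, (V 0 i + γ * ∑ t ∈ Finset.range T, a t * R t i) := by
  classical
  push Not at hT
  have hex : ∃ r, r < T ∧ ∃ i, F < gap r i := hT
  obtain ⟨hrT, i, hi⟩ := Nat.find_spec hex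
  set r := Nat.find hex
  have hmin : ∀ q < r, ∀ j, gap q j ≤ F := by
    intro q hq j
    by_contra hlt
    push Not at hlt
    exact Nat.find_min hex hq ⟨hq.trans hrT, j, hlt⟩
  have h1 := stopped_descent hstep ha r hmin i
  have hS' : 0 ≤ ∑ t ∈ Finset.range r, S t := Finset.sum_nonneg fun t _ => hS t
  have hmono : ∑ t ∈ Finset.range r, a t * R t i ≤ ∑ t ∈ Finset.range T, a t * R t i :=
    Finset.sum_le_sum_of_subset_of_nonneg (Finset.range_mono hrT.le)
      fun t _ _ => mul_nonneg (ha0 t) (hR t i)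
  have h2 : F ≤ V 0 i + γ * ∑ t ∈ Finset.range T, a t * R t i := by
    have := mul_le_mul_of_nonneg_left hmono hγ
    have := mul_nonneg (show 0 ≤ γ / 2 by positivity) hS'
    linarith [hgV r i]
  refine h2.trans (Finset.single_le_sum
    (f := fun i => V 0 i + γ * ∑ t ∈ Finset.range T, a t * R t i) (fun j _ => ?_)
    (Finset.mem_univ i))
  exact add_nonneg (hV 0 j) (mul_nonneg hγ
    (Finset.sum_nonneg fun t _ => mul_nonneg (ha0 t) (hR t j)))

open Classical in
/-- The indicator of the event that all gaps are at most `F` up to time `t`. -/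
noncomputable def gapIndicator (D : Problem n m Ξ) (G F : ℝ) (s : ℕ → State n m) (t : ℕ) : ℝ :=
  if ∀ r ≤ t, ∀ i, Lhat D G i (s r).θ ((s r).η i) - dualInf D i ≤ F then 1 else 0

section

variable {D : Problem n m Ξ} {G L M κ F : ℝ}

theorem gapIndicator_nonneg (s : ℕ → State n m) (t : ℕ) : 0 ≤ gapIndicator D G F s t := by
  unfold gapIndicator
  split_ifs <;> norm_num

theorem gapIndicator_le_one (s : ℕ → State n m) (t : ℕ) : gapIndicator D G F s t ≤ 1 := by
  unfold gapIndicator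
  split_ifs <;> norm_num

theorem gap_le_of_gapIndicator_ne_zero {s : ℕ → State n m} {t : ℕ}
    (h : gapIndicator D G F s t ≠ 0) (i : Fin m) :
    Lhat D G i (s t).θ ((s t).η i) - dualInf D i ≤ F := by
  unfold gapIndicator at h
  split_ifs at h with h1
  · exact h1 t le_rfl i
  · exact absurd rfl h

theorem StandingAssumptions.measurable_gapIndicator (hS : StandingAssumptions D G L M κ)
    {Ω : Type*} [MeasurableSpace Ω] {s : Ω → ℕ → State n m} {t : ℕ}
    (hs : ∀ r ≤ t, MeasurableState fun ω => s ω r) :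
    Measurable fun ω => gapIndicator D G F (s ω) t := by
  have hL : ∀ r ≤ t, ∀ i, Measurable fun ω => Lhat D G i (s ω r).θ ((s ω r).η i) := by
    intro r hr i
    have h1 := (hs r hr).1.prodMk (measurable_vec_apply (hs r hr).2.1 i)
    have h2 := (hS.measurable_Lhat i).comp h1
    exact h2
  have hset : MeasurableSet {ω | ∀ r ≤ t, ∀ i,
      Lhat D G i (s ω r).θ ((s ω r).η i) - dualInf D i ≤ F} := by
    have h1 : {ω | ∀ r ≤ t, ∀ i, Lhat D G i (s ω r).θ ((s ω r).η i) - dualInf D i ≤ F}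
        = ⋂ r, ⋂ (_ : r ≤ t), ⋂ i,
          {ω | Lhat D G i (s ω r).θ ((s ω r).η i) - dualInf D i ≤ F} := by
      ext ω
      simp only [Set.mem_iInter]
      rfl
    rw [h1]
    refine MeasurableSet.iInter fun r => MeasurableSet.iInter fun hr =>
      MeasurableSet.iInter fun i => ?_
    have h2 := (hL r hr i).sub_const (dualInf D i)
    exact measurableSet_le h2 measurable_const
  unfold gapIndicator
  exact Measurable.ite hset measurable_const measurable_const

end

/-! ### Convergence with high probability -/

theorem measureReal_ge_le_of_integral_le {Ω : Type*} [MeasurableSpace Ω] {μ : Measure Ω}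
    {f : Ω → ℝ} (hf : Integrable f μ) (hf0 : ∀ ω, 0 ≤ f ω) {A B q : ℝ} (hA : 0 < A)
    (hB : ∫ ω, f ω ∂μ ≤ B) (hq : B ≤ q * A) : μ.real {ω | A ≤ f ω} ≤ q := by
  have h1 := mul_meas_ge_le_integral_of_nonneg (Eventually.of_forall hf0) hf A
  refine le_of_mul_le_mul_left ?_ hA
  linarith

/-- The expected per-iteration error terms are small multiples of `(δ ε)²`. -/
theorem Admissible.error_budget {G L M lam κ Δ : ℝ} {h : Params}
    (hA : Admissible (1 / 10000) 100000 m G L M lam κ Δ h) :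
    5 / 100000 * (h.δ ^ 3 * h.ε ^ 2) ≤ 5 / 100000 * (h.δ * h.ε) ^ 2 ∧
      (h.δ * h.ε) ^ 2 * h.β * (m * (5 / 100000 * (h.δ ^ 3 * h.ε ^ 2)))
        ≤ 1 / 100000 * (h.δ * h.ε) ^ 2 := by
  have hδ := hA.δ_pos
  have hε := hA.ε_pos
  have hb2 : 0 < (h.δ * h.ε) ^ 2 := by positivity
  constructor
  · have e1 : h.δ ^ 3 * h.ε ^ 2 = h.δ * (h.δ * h.ε) ^ 2 := by ring
    rw [e1]
    exact mul_le_mul_of_nonneg_left (mul_le_of_le_one_left hb2.le hA.δ_lt_one.le) (by norm_num)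
  · have e1 : (h.δ * h.ε) ^ 2 * h.β * (m * (5 / 100000 * (h.δ ^ 3 * h.ε ^ 2)))
        = 5 / 100000 * ((h.δ * h.ε) ^ 2 * (h.β * (m * h.δ ^ 3 * h.ε ^ 2))) := by ring
    rw [e1]
    have := mul_le_mul_of_nonneg_left hA.β_le_acc hb2.le
    linarith

/-- The condition `γ/β ≤ d` keeps the accumulated error `γ T b²` of order `Δ + d`, independently of
`ε`, so that a fixed `F` can majorize it. -/
theorem Admissible.T_mul_le {G L M lam κ Δ : ℝ} {h : Params} (hΔ : 0 ≤ Δ)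
    (hA : Admissible (1 / 10000) 100000 m G L M lam κ Δ h) :
    h.γ * (h.T * (h.δ * h.ε) ^ 2) ≤ 200000 * (Δ + h.d) := by
  have hδ := hA.δ_pos
  have hε := hA.ε_pos
  have hγ := hA.γ_pos
  have hβ := hA.β_pos
  have h1 := hA.T_le
  have hb2 : 0 < h.δ ^ 2 * h.ε ^ 2 := by positivity
  rw [iterScale, ← mul_div_assoc, le_div_iff₀ hb2] at h1
  have h2 : h.γ * max (Δ / h.γ) (1 / h.β) ≤ Δ + h.d := by
    rw [mul_max_of_nonneg _ _ hγ.le]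
    refine max_le ?_ ?_
    · rw [mul_div_cancel₀ _ hγ.ne']
      linarith [hA.d_pos]
    · rw [mul_one_div, div_le_iff₀ hβ]
      have := hA.γ_le_β
      have := mul_nonneg hΔ hβ.le
      linarith
  have h3 := mul_le_mul_of_nonneg_left h1 hγ.le
  rw [mul_pow]
  linarith

theorem Admissible.le_T_mul {G L M lam κ Δ : ℝ} {h : Params}
    (hA : Admissible (1 / 10000) 100000 m G L M lam κ Δ h) :
    Δ / h.γ + 1 / h.β ≤ 2 / 100000 * (h.T * (h.δ * h.ε) ^ 2) := by
  have hδ := hA.δ_pos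
  have hε := hA.ε_pos
  have h1 := hA.T_ge
  have hb2 : 0 < h.δ ^ 2 * h.ε ^ 2 := by positivity
  rw [iterScale, ← mul_div_assoc, div_le_iff₀ hb2] at h1
  rw [mul_pow]
  linarith [le_max_left (Δ / h.γ) (1 / h.β), le_max_right (Δ / h.γ) (1 / h.β)]

theorem initGap_nonneg {D : Problem n m Ξ} {G : ℝ} (hm : 0 < m)
    (hb : ∀ i, BddBelow (Set.range fun p : Vec n × ℝ => dual D i p.1 p.2))
    (θ₀ : Vec n) (η₀ : Vec m) : 0 ≤ initGap D G θ₀ η₀ :=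
  (sub_nonneg.2 (dualInf_le_Lhat (hb ⟨0, hm⟩) θ₀ (η₀ ⟨0, hm⟩))).trans
    (le_ciSup (f := fun i => Lhat D G i θ₀ (η₀ i) - dualInf D i)
      (Set.finite_range _).bddAbove ⟨0, hm⟩)

theorem convergence_whp {D : Problem n m Ξ} {G L M κ : ℝ} {θ₀ : Vec n} {η₀ : Vec m} (hm : 0 < m)
    (hS : StandingAssumptions D G L M κ)
    (hb : ∀ i, BddBelow (Set.range fun p : Vec n × ℝ => dual D i p.1 p.2))
    {h : Params} {w₀ : Vec m} {Ω : Type*} [MeasurableSpace Ω] {μ : Measure Ω}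
    [IsProbabilityMeasure μ] {ξ : ℕ → Fin h.N₂ → Ω → Fin m → Ξ}
    {ξ' : ℕ → Fin h.N₁ → Ω → Fin m → Ξ}
    (hA : Admissible (1 / 10000) 100000 m G L M D.lam κ (initGap D G θ₀ η₀) h)
    (hw : w₀ ∈ simplex m) (hI : IsSampling D μ ξ ξ') :
    1 - h.δ ≤ μ.real {ω | avgBalancedGrad D G h.T
      (run D G h (fun t j => ξ t j ω) (fun t j => ξ' t j ω) ⟨θ₀, η₀, w₀⟩) ≤ 34 * h.ε} := by
  obtain ⟨Δ, hΔ⟩ : ∃ Δ, Δ = initGap D G θ₀ η₀ := ⟨_, rfl⟩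
  rw [← hΔ] at hA
  obtain ⟨b, hbb⟩ : ∃ b, b = h.δ * h.ε := ⟨_, rfl⟩
  obtain ⟨v, hv⟩ : ∃ v, v = 5 / 100000 * (h.δ ^ 3 * h.ε ^ 2) := ⟨_, rfl⟩
  obtain ⟨s, hs⟩ : ∃ s : Ω → ℕ → State n m, s = fun ω =>
    run D G h (fun t j => ξ t j ω) (fun t j => ξ' t j ω) ⟨θ₀, η₀, w₀⟩ := ⟨_, rfl⟩
  obtain ⟨E, hE⟩ : ∃ E : ℕ → Fin m → Ω → ℝ, E = fun t j ω =>
    stepErr D G h (fun j => ξ t j ω) (fun j => ξ' t j ω) (s ω t) j := ⟨_, rfl⟩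
  obtain ⟨a, ha⟩ : ∃ a : ℕ → Ω → ℝ, a = fun t ω => gapIndicator D G h.F (s ω) t := ⟨_, rfl⟩
  have hδ := hA.δ_pos
  have hε := hA.ε_pos
  have hγ := hA.γ_pos
  have hβ := hA.β_pos
  have hb0 : 0 < b := hbb ▸ hA.acc_pos
  have hm' : (0 : ℝ) < m := by exact_mod_cast hm
  have hv0 : 0 ≤ v := by rw [hv]; positivity
  have hE0 : ∀ t j ω, 0 ≤ E t j ω := by
    intro t j ω
    rw [hE]
    exact stepErr_nonneg _ _ _ _ _ _ _
  have ha0 : ∀ t ω, 0 ≤ a t ω := fun t ω => ha ▸ gapIndicator_nonneg _ _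
  have ha1 : ∀ t ω, a t ω ≤ 1 := fun t ω => ha ▸ gapIndicator_le_one _ _
  have hsw : ∀ t ω, (s ω t).w ∈ simplex m := fun t ω => hs ▸ run_w_mem_simplex hm _ _ hw t
  obtain ⟨i₀⟩ : Nonempty (Fin m) := ⟨⟨0, hm⟩⟩
  have hgap0 : ∀ i, Lhat D G i θ₀ (η₀ i) - dualInf D i ≤ Δ := fun i => by
    rw [hΔ]
    exact le_ciSup (f := fun i => Lhat D G i θ₀ (η₀ i) - dualInf D i)
      (Set.finite_range _).bddAbove i
  have hΔ0 : 0 ≤ Δ := hΔ ▸ initGap_nonneg hm hb θ₀ η₀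
  -- expectations of the weighted errors
  have hpast : ∀ t, ∀ r ≤ t, @MeasurableState n m Ω (drawSigma ξ ξ' (pastIndices h.N₁ h.N₂ t))
      fun ω => s ω r := fun t r hr => hs ▸ hS.measurable_run_past hm _ hr
  have ham : ∀ t, Measurable[drawSigma ξ ξ' (pastIndices h.N₁ h.N₂ t)] (a t) := by
    intro t
    let := drawSigma ξ ξ' (pastIndices h.N₁ h.N₂ t)
    rw [ha]
    exact hS.measurable_gapIndicator (hpast t)
  have hai : ∀ t, Integrable (a t) μ := fun t =>
    Integrable.of_bound ((ham t).mono (hI.drawSigma_le _) le_rfl).aestronglyMeasurable 1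
      (Eventually.of_forall fun ω => by
        rw [Real.norm_eq_abs, abs_of_nonneg (ha0 t ω)]
        exact ha1 t ω)
  have hai1 : ∀ t, ∫ ω, a t ω ∂μ ≤ 1 := fun t => by
    have := integral_mono (hai t) (integrable_const 1) (ha1 t)
    simpa using this
  have hgapa : ∀ t ω, a t ω ≠ 0 →
      ∀ i, Lhat D G i (s ω t).θ ((s ω t).η i) - dualInf D i ≤ h.F := fun t ω hne =>
    gap_le_of_gapIndicator_ne_zero (by rw [ha] at hne; exact hne)
  have hst : ∀ t, (fun ω => s ω t) = fun ω =>
      run D G h (fun t j => ξ t j ω) (fun t j => ξ' t j ω) ⟨θ₀, η₀, w₀⟩ t := fun t => by rw [hs]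
  have hEa : ∀ t j, Integrable (fun ω => a t ω * E t j ω) μ ∧ ∫ ω, a t ω * E t j ω ∂μ ≤ v := by
    intro t j
    have h1 := hI.integral_stepErr_le hS hm hA hb ⟨θ₀, η₀, w₀⟩ t (hst t) (ham t) (ha0 t) (hai t)
      (hgapa t) j
    rw [hE]
    refine ⟨h1.1, h1.2.trans ?_⟩
    rw [← hv]
    exact mul_le_of_le_one_right hv0 (hai1 t)
  -- The weights `w_t` are functions of the past, so `a_t w_j` is an admissible multiplier. Because
  -- the weights sum to `1`, the total error in `hEws` is `v` and not `m v`.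
  have hEw : ∀ t j, Integrable (fun ω => a t ω * (s ω t).w j * E t j ω) μ ∧
      ∫ ω, a t ω * (s ω t).w j * E t j ω ∂μ ≤ v * ∫ ω, a t ω * (s ω t).w j ∂μ ∧
      Integrable (fun ω => a t ω * (s ω t).w j) μ := by
    intro t j
    have hwm : Measurable[drawSigma ξ ξ' (pastIndices h.N₁ h.N₂ t)]
        fun ω => a t ω * (s ω t).w j := by
      let := drawSigma ξ ξ' (pastIndices h.N₁ h.N₂ t)
      exact (ham t).mul (measurable_vec_apply (hpast t t le_rfl).2.2 j)
    have hw1 : ∀ ω, (s ω t).w j ≤ 1 := fun ω => by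
      rw [← (hsw t ω).2]
      exact Finset.single_le_sum (f := (s ω t).w) (fun k _ => (hsw t ω).1 k) (Finset.mem_univ j)
    have hw0 : ∀ ω, 0 ≤ a t ω * (s ω t).w j := fun ω => mul_nonneg (ha0 t ω) ((hsw t ω).1 j)
    have hwi : Integrable (fun ω => a t ω * (s ω t).w j) μ :=
      Integrable.of_bound (hwm.mono (hI.drawSigma_le _) le_rfl).aestronglyMeasurable 1
        (Eventually.of_forall fun ω => by
          rw [Real.norm_eq_abs, abs_of_nonneg (hw0 ω)]
          exact mul_le_one₀ (ha1 t ω) ((hsw t ω).1 j) (hw1 ω))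
    have h1 := hI.integral_stepErr_le hS hm hA hb ⟨θ₀, η₀, w₀⟩ t (hst t) hwm hw0 hwi
      (fun ω hne => hgapa t ω (left_ne_zero_of_mul hne)) j
    rw [hE]
    refine ⟨h1.1, ?_, hwi⟩
    rw [hv]
    exact h1.2
  have hEws : ∀ t, ∫ ω, ∑ j, a t ω * (s ω t).w j * E t j ω ∂μ ≤ v := by
    intro t
    rw [integral_finsetSum _ fun j _ => (hEw t j).1]
    refine (Finset.sum_le_sum fun j _ => (hEw t j).2.1).trans ?_
    rw [← Finset.mul_sum, ← integral_finsetSum _ fun j _ => (hEw t j).2.2]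
    have : ∀ ω, ∑ j, a t ω * (s ω t).w j = a t ω := fun ω => by
      rw [← Finset.mul_sum, (hsw t ω).2, mul_one]
    simp only [this]
    exact mul_le_of_le_one_right hv0 (hai1 t)
  have hEs : ∀ t, Integrable (fun ω => ∑ j, a t ω * E t j ω) μ ∧
      ∫ ω, ∑ j, a t ω * E t j ω ∂μ ≤ m * v := by
    intro t
    refine ⟨integrable_finsetSum _ fun j _ => (hEa t j).1, ?_⟩
    rw [integral_finsetSum _ fun j _ => (hEa t j).1]
    refine (Finset.sum_le_sum fun j _ => (hEa t j).2).trans (le_of_eq ?_)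
    simp
  -- the two exceptional events
  obtain ⟨q, hq⟩ : ∃ q : ℕ → Fin m → Ω → ℝ, q = fun t i ω =>
      b ^ 2 / 80 + 50 * (a t ω * E t i ω) + 3 * b ^ 2 * h.β * ∑ j, a t ω * E t j ω := ⟨_, rfl⟩
  have hbudget := hA.error_budget
  rw [← hv, ← hbb] at hbudget
  -- The budget is `1/80 + 50 · 5/100000 + 3/100000 ≤ 1/60`.
  have hqi : ∀ t i, Integrable (q t i) μ ∧ ∫ ω, q t i ω ∂μ ≤ b ^ 2 / 60 := by
    intro t i
    have i1 : Integrable (fun ω => b ^ 2 / 80 + 50 * (a t ω * E t i ω)) μ :=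
      (integrable_const _).add ((hEa t i).1.const_mul 50)
    have i2 := (hEs t).1.const_mul (3 * b ^ 2 * h.β)
    rw [hq]
    refine ⟨i1.add i2, ?_⟩
    simp only
    rw [integral_add i1 i2, integral_add (integrable_const _) ((hEa t i).1.const_mul 50),
      integral_const_mul, integral_const_mul]
    simp only [integral_const, probReal_univ, one_smul]
    have f1 := mul_le_mul_of_nonneg_left (hEs t).2 (show 0 ≤ 3 * b ^ 2 * h.β by positivity)
    have f2 := (hEa t i).2
    have f3 := hbudget.1
    have f4 := hbudget.2
    have f5 : 0 ≤ b ^ 2 := sq_nonneg b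
    linarith
  have hq0 : ∀ t i ω, 0 ≤ q t i ω := by
    intro t i ω
    rw [hq]
    have f1 := mul_nonneg (ha0 t ω) (hE0 t i ω)
    have f2 : 0 ≤ ∑ j, a t ω * E t j ω :=
      Finset.sum_nonneg fun j _ => mul_nonneg (ha0 t ω) (hE0 t j ω)
    positivity
  obtain ⟨U, hU⟩ : ∃ U : Ω → ℝ, U = fun ω =>
    ∑ i, (Δ + h.γ / h.β + h.γ * ∑ t ∈ Finset.range h.T, q t i ω) := ⟨_, rfl⟩
  obtain ⟨Y, hY⟩ : ∃ Y : Ω → ℝ, Y = fun ω => ∑ t ∈ Finset.range h.T,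
    (100 * (a t ω * E t i₀ ω) + 6 * b ^ 2 * h.β * ∑ j, a t ω * E t j ω
      + 50 * ∑ j, a t ω * (s ω t).w j * E t j ω) := ⟨_, rfl⟩
  have hT0 : (0 : ℝ) < h.T := by
    have h1 := hA.le_T_mul
    rw [← hbb] at h1
    have h2 : 0 < Δ / h.γ + 1 / h.β := by positivity
    have h3 : 0 < (h.T : ℝ) * b ^ 2 := by linarith
    exact pos_of_mul_pos_left h3 (sq_nonneg b)
  have hγd : h.γ / h.β ≤ h.d := by
    rw [div_le_iff₀ hβ]
    exact hA.γ_le_β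
  have hF0 : 0 < h.F := by
    have h1 := hA.F_ge
    have h2 : 0 < m * (Δ + h.d) / h.δ := by
      have := hA.d_pos
      positivity
    linarith
  have hPU : μ.real {ω | h.F ≤ U ω} ≤ h.δ / 2 := by
    have i1 : ∀ i, Integrable (fun ω => h.γ * ∑ t ∈ Finset.range h.T, q t i ω) μ := fun i =>
      (integrable_finsetSum _ fun t _ => (hqi t i).1).const_mul _
    have i2 : ∀ i, Integrable
        (fun ω => Δ + h.γ / h.β + h.γ * ∑ t ∈ Finset.range h.T, q t i ω) μ :=
      fun i => (integrable_const _).add (i1 i)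
    -- The constant covers `1 + 200000/60`, with `200000` from `T_mul_le`. The lower bound on `F`
    -- gives `F δ/2 ≥ 50000 m (Δ + d)`.
    refine measureReal_ge_le_of_integral_le (A := h.F) (B := 4000 * (m * (Δ + h.d)))
      (by rw [hU]; exact integrable_finsetSum _ fun i _ => i2 i) (fun ω => ?_) hF0 ?_ ?_
    · rw [hU]
      refine Finset.sum_nonneg fun i _ => ?_
      have f1 : 0 ≤ ∑ t ∈ Finset.range h.T, q t i ω := Finset.sum_nonneg fun t _ => hq0 t i ω
      positivity
    · rw [hU, integral_finsetSum _ fun i _ => i2 i]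
      have f1 : ∀ i, ∫ ω, (Δ + h.γ / h.β + h.γ * ∑ t ∈ Finset.range h.T, q t i ω) ∂μ
          ≤ 4000 * (Δ + h.d) := by
        intro i
        rw [integral_add (integrable_const _) (i1 i), integral_const_mul,
          integral_finsetSum _ fun t _ => (hqi t i).1]
        simp only [integral_const, probReal_univ, one_smul]
        have f2 : ∑ t ∈ Finset.range h.T, ∫ ω, q t i ω ∂μ ≤ h.T * (b ^ 2 / 60) := by
          refine (Finset.sum_le_sum fun t _ => (hqi t i).2).trans (le_of_eq ?_)
          simp
        have f3 := hA.T_mul_le hΔ0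
        rw [← hbb] at f3
        have f4 := mul_le_mul_of_nonneg_left f2 hγ.le
        have f5 := hA.d_pos
        linarith
      refine (Finset.sum_le_sum fun i _ => f1 i).trans (le_of_eq ?_)
      simp
      ring
    · have h1 := hA.F_ge
      rw [← mul_div_assoc, div_le_iff₀ hδ] at h1
      have : 0 ≤ m * (Δ + h.d) := mul_nonneg hm'.le (add_nonneg hΔ0 hA.d_pos.le)
      linarith
  -- Since `b ε = b²/δ`, this threshold exceeds the mean bound `T b²` by the factor `32/δ`, more
  -- than Markov's inequality requires.
  have hPY : μ.real {ω | 32 * (h.T * b * h.ε) ≤ Y ω} ≤ h.δ / 2 := by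
    have i1 : ∀ t, Integrable (fun ω => 100 * (a t ω * E t i₀ ω)) μ := fun t =>
      (hEa t i₀).1.const_mul _
    have i2 : ∀ t, Integrable (fun ω => 6 * b ^ 2 * h.β * ∑ j, a t ω * E t j ω) μ := fun t =>
      (hEs t).1.const_mul _
    have i3 : ∀ t, Integrable (fun ω => 50 * ∑ j, a t ω * (s ω t).w j * E t j ω) μ := fun t =>
      (integrable_finsetSum _ fun j _ => (hEw t j).1).const_mul _
    have i12 : ∀ t, Integrable (fun ω => 100 * (a t ω * E t i₀ ω)
        + 6 * b ^ 2 * h.β * ∑ j, a t ω * E t j ω) μ := fun t => (i1 t).add (i2 t)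
    have i4 : ∀ t, Integrable (fun ω => 100 * (a t ω * E t i₀ ω)
        + 6 * b ^ 2 * h.β * ∑ j, a t ω * E t j ω
        + 50 * ∑ j, a t ω * (s ω t).w j * E t j ω) μ := fun t => (i12 t).add (i3 t)
    refine measureReal_ge_le_of_integral_le (A := 32 * (h.T * b * h.ε)) (B := h.T * b ^ 2)
      (by rw [hY]; exact integrable_finsetSum _ fun t _ => i4 t) (fun ω => ?_) (by positivity)
      ?_ ?_
    · rw [hY]
      refine Finset.sum_nonneg fun t _ => ?_
      have f1 := mul_nonneg (ha0 t ω) (hE0 t i₀ ω)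
      have f2 : 0 ≤ ∑ j, a t ω * E t j ω :=
        Finset.sum_nonneg fun j _ => mul_nonneg (ha0 t ω) (hE0 t j ω)
      have f3 : 0 ≤ ∑ j, a t ω * (s ω t).w j * E t j ω :=
        Finset.sum_nonneg fun j _ =>
          mul_nonneg (mul_nonneg (ha0 t ω) ((hsw t ω).1 j)) (hE0 t j ω)
      positivity
    · rw [hY, integral_finsetSum _ fun t _ => i4 t]
      have f1 : ∀ t, ∫ ω, (100 * (a t ω * E t i₀ ω) + 6 * b ^ 2 * h.β * ∑ j, a t ω * E t j ω
          + 50 * ∑ j, a t ω * (s ω t).w j * E t j ω) ∂μ ≤ b ^ 2 := by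
        intro t
        rw [integral_add (i12 t) (i3 t), integral_add (i1 t) (i2 t), integral_const_mul,
          integral_const_mul, integral_const_mul]
        have g1 := (hEa t i₀).2
        have g2 := mul_le_mul_of_nonneg_left (hEs t).2 (show 0 ≤ 6 * b ^ 2 * h.β by positivity)
        have g3 := hEws t
        have g4 := hbudget.1
        have g5 := hbudget.2
        have g6 : 0 ≤ b ^ 2 := sq_nonneg b
        linarith
      refine (Finset.sum_le_sum fun t _ => f1 t).trans (le_of_eq ?_)
      simp
    · have e1 : h.δ / 2 * (32 * (h.T * b * h.ε)) = 16 * (h.T * b ^ 2) := by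
        rw [hbb]
        ring
      rw [e1]
      have : 0 ≤ h.T * b ^ 2 := by positivity
      linarith
  -- the complement of the exceptional events
  have hgood : ∀ ω, ¬ h.F ≤ U ω → ¬ 32 * (h.T * b * h.ε) ≤ Y ω →
      avgBalancedGrad D G h.T (s ω) ≤ 34 * h.ε := by
    intro ω hωU hωY
    obtain ⟨gap, hgap⟩ : ∃ gap : ℕ → Fin m → ℝ, gap = fun t i =>
      Lhat D G i (s ω t).θ ((s ω t).η i) - dualInf D i := ⟨_, rfl⟩
    obtain ⟨S, hSg⟩ : ∃ S : ℕ → ℝ, S = fun t =>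
      stepGain D G h (fun j => ξ t j ω) (fun j => ξ' t j ω) (s ω t) := ⟨_, rfl⟩
    obtain ⟨V, hV⟩ : ∃ V : ℕ → Fin m → ℝ, V = fun t i => gap t i
      + h.γ / (2 * h.β) * ‖(s ω t).w - EuclideanSpace.single i (1 : ℝ)‖ ^ 2 := ⟨_, rfl⟩
    obtain ⟨R, hR⟩ : ∃ R : ℕ → Fin m → ℝ, R = fun t i =>
      b ^ 2 / 80 + 50 * E t i ω + 3 * b ^ 2 * h.β * ∑ j, E t j ω := ⟨_, rfl⟩
    have hgap_nonneg : ∀ t i, 0 ≤ gap t i := fun t i => by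
      rw [hgap]
      exact sub_nonneg.2 (dualInf_le_Lhat (hb i) _ _)
    have hgV : ∀ t i, gap t i ≤ V t i := fun t i => by
      rw [hV]
      have : 0 ≤ h.γ / (2 * h.β) * ‖(s ω t).w - EuclideanSpace.single i (1 : ℝ)‖ ^ 2 := by
        positivity
      linarith
    have hS0 : ∀ t, 0 ≤ S t := fun t => by
      rw [hSg]
      exact add_nonneg
        (mul_nonneg (clip_nonneg (by norm_num) hA.acc_pos.le (norm_nonneg _)) (sq_nonneg _))
        (mul_nonneg (clip_nonneg (by norm_num) hA.acc_pos.le (norm_nonneg _)) (sq_nonneg _))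
    have hR0 : ∀ t i, 0 ≤ R t i := fun t i => by
      rw [hR]
      have f1 := hE0 t i ω
      have f2 : 0 ≤ ∑ j, E t j ω := Finset.sum_nonneg fun j _ => hE0 t j ω
      positivity
    have hrun : ∀ t, s ω (t + 1)
        = step D G h (fun j => ξ t j ω) (fun j => ξ' t j ω) (s ω t) := fun t => by
      rw [hs]
      rfl
    have hstep : ∀ t, (∀ i, gap t i ≤ h.F) →
        ∀ i, V (t + 1) i ≤ V t i - h.γ / 2 * S t + h.γ * R t i := by
      intro t ht i
      have f1 := one_step_descent hS hm hA hb (fun j => ξ t j ω) (fun j => ξ' t j ω) (hsw t ω)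
        (by rw [hgap] at ht; exact ht) i
      rw [← hrun, ← hbb] at f1
      rw [hV, hgap, hSg, hR, hE]
      simp only
      linarith
    have haω : ∀ t, (∀ r ≤ t, ∀ i, gap r i ≤ h.F) → a t ω = 1 := by
      intro t ht
      rw [hgap] at ht
      rw [ha]
      exact if_pos ht
    have haR : ∀ t i, a t ω * R t i ≤ q t i ω := by
      intro t i
      rw [hR, hq]
      simp only
      rw [← Finset.mul_sum]
      have f1 : a t ω * (b ^ 2 / 80) ≤ b ^ 2 / 80 :=
        mul_le_of_le_one_left (by positivity) (ha1 t ω)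
      linarith
    have hV0 : ∀ i, V 0 i ≤ Δ + h.γ / h.β := by
      intro i
      have f1 := norm_sub_sq_le_two_of_mem_simplex (hsw 0 ω) (single_mem_simplex i)
      have f2 : gap 0 i ≤ Δ := by
        rw [hgap, hs]
        exact hgap0 i
      have f3 := mul_le_mul_of_nonneg_left f1 (show 0 ≤ h.γ / (2 * h.β) by positivity)
      have f4 : h.γ / (2 * h.β) * 2 = h.γ / h.β := by
        field_simp
      rw [hV]
      simp only
      linarith
    -- An exit before time `T` would force `U ≥ F`, which this outcome excludes.
    have hall : ∀ r < h.T, ∀ i, gap r i ≤ h.F := by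
      by_contra hcon
      have f1 := le_sum_of_gap_gt hγ.le hstep haω (fun t => ha0 t ω) hS0 hR0
        (fun t i => (hgap_nonneg t i).trans (hgV t i)) hgV h.T hcon
      refine hωU (f1.trans ?_)
      rw [hU]
      refine Finset.sum_le_sum fun i _ => add_le_add (hV0 i) ?_
      exact mul_le_mul_of_nonneg_left (Finset.sum_le_sum fun t _ => haR t i) hγ.le
    have hsumS := stopped_descent hstep haω h.T hall i₀
    have hsumq := Finset.sum_le_sum fun t (_ : t ∈ Finset.range h.T) => haR t i₀
    have hVT := (hgap_nonneg h.T i₀).trans (hgV h.T i₀)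
    have hS1 : ∑ t ∈ Finset.range h.T, S t
        ≤ 2 * (Δ / h.γ + 1 / h.β) + 2 * ∑ t ∈ Finset.range h.T, q t i₀ ω := by
      have f1 := mul_le_mul_of_nonneg_left hsumq hγ.le
      have f2 := hV0 i₀
      refine le_of_mul_le_mul_left ?_ hγ
      have f3 : h.γ * (2 * (Δ / h.γ + 1 / h.β) + 2 * ∑ t ∈ Finset.range h.T, q t i₀ ω)
          = 2 * (Δ + h.γ / h.β) + 2 * (h.γ * ∑ t ∈ Finset.range h.T, q t i₀ ω) := by
        field_simp
      linarith
    obtain ⟨Q, hQ⟩ : ∃ Q : ℕ → ℝ, Q = fun t =>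
      ‖mulW (fullGrad D G (s ω t).θ (s ω (t + 1)).η) (s ω t).w‖ := ⟨_, rfl⟩
    have hQt : ∀ t ∈ Finset.range h.T, b * Q t ≤ S t + 51 / 50 * b ^ 2
        + 50 * ∑ j, a t ω * (s ω t).w j * E t j ω := by
      intro t ht
      have f1 := mul_norm_fullGrad_le hS hm hA (fun j => ξ t j ω) (fun j => ξ' t j ω) (hsw t ω)
      rw [← hrun, ← hbb] at f1
      have f2 : a t ω = 1 :=
        haω t fun r hr => hall r (lt_of_le_of_lt hr (Finset.mem_range.1 ht))
      rw [hQ, hSg, f2, hE]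
      simp only [one_mul]
      exact f1
    have hsumQ := Finset.sum_le_sum hQt
    rw [← Finset.mul_sum, Finset.sum_add_distrib, Finset.sum_add_distrib, Finset.sum_const,
      Finset.card_range, nsmul_eq_mul] at hsumQ
    -- `Y` is exactly the random part of the final estimate: twice the descent error of the single
    -- task `i₀` plus the error of replacing true gradients by estimates.
    have hqY : 2 * ∑ t ∈ Finset.range h.T, q t i₀ ω
        + ∑ t ∈ Finset.range h.T, 50 * ∑ j, a t ω * (s ω t).w j * E t j ω
        = h.T * (b ^ 2 / 40) + Y ω := by
      have f0 : (h.T : ℝ) * (b ^ 2 / 40) = ∑ t ∈ Finset.range h.T, b ^ 2 / 40 := by simp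
      rw [hY, hq, f0, Finset.mul_sum, ← Finset.sum_add_distrib, ← Finset.sum_add_distrib]
      refine Finset.sum_congr rfl fun t _ => ?_
      ring
    -- The total is `32 + 4/100000 + 1/40 + 51/50 ≤ 34` in units of `T b ε`, using `b ≤ ε` for the
    -- deterministic terms.
    have hlast : b * ∑ t ∈ Finset.range h.T, Q t ≤ b * (34 * h.ε * h.T) := by
      have f1 := hA.le_T_mul
      rw [← hbb] at f1
      push Not at hωY
      have f2 : (h.T : ℝ) * b ^ 2 ≤ h.T * b * h.ε := by
        have f3 : b ≤ h.ε := by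
          rw [hbb]
          exact mul_le_of_le_one_left hε.le hA.δ_lt_one.le
        have := mul_le_mul_of_nonneg_left f3 (show 0 ≤ (h.T : ℝ) * b by positivity)
        linarith
      have f4 : 0 ≤ (h.T : ℝ) * b ^ 2 := by positivity
      linarith
    have hlast' := le_of_mul_le_mul_left hlast hb0
    rw [avgBalancedGrad, one_div, inv_mul_le_iff₀ hT0]
    rw [hQ] at hlast'
    linarith
  have hcover : (Set.univ : Set Ω) ⊆ {ω | avgBalancedGrad D G h.T (s ω) ≤ 34 * h.ε} ∪
      ({ω | h.F ≤ U ω} ∪ {ω | 32 * (h.T * b * h.ε) ≤ Y ω}) := by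
    intro ω _
    by_cases h1 : h.F ≤ U ω
    · exact Or.inr (Or.inl h1)
    by_cases h2 : 32 * (h.T * b * h.ε) ≤ Y ω
    · exact Or.inr (Or.inr h2)
    · exact Or.inl (hgood ω h1 h2)
  have h1 := (measureReal_mono (μ := μ) hcover (measure_ne_top _ _)).trans
    ((measureReal_union_le _ _).trans (add_le_add_right (measureReal_union_le _ _) _))
  rw [probReal_univ] at h1
  rw [hs] at h1
  linarith

/-! ### Sample complexity -/

/-- Admissible hyper-parameters exist for all small accuracies `ε`, with step sizes independent of
`ε` and a total number of samples of order `ε⁻⁴`. -/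
theorem exists_admissible {c C : ℝ} (hc : 0 < c) (hc1 : c ≤ 1) (hC : 1 ≤ C)
    {G L M lam κ Δ : ℝ} (hm : 0 < m) (hL0 : 0 ≤ L0hat G L M lam) (hL1 : 0 ≤ L1hat m G L)
    (hL2 : 0 ≤ L2hat m G M lam) {δ : ℝ} (hδ : 0 < δ) (hδ1 : δ < 1) :
    ∃ F d ϑ γ β ε₀ K : ℝ, 0 < ε₀ ∧ ∀ ε : ℝ, 0 < ε → ε < ε₀ →
      ∃ (ρ : ℝ) (T N₁ N₂ : ℕ), 0 < ρ ∧
        Admissible c C m G L M lam κ Δ ⟨δ, ε, F, d, ϑ, γ, β, ρ, T, N₁, N₂⟩ ∧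
        (T : ℝ) * (N₁ + N₂) ≤ K / ε ^ 4 := by
  have hm' : (0 : ℝ) < m := by exact_mod_cast hm
  have hC0 : 0 < C := by linarith
  -- The least admissible value for `d = 1`. It does not involve `ε`, so `Λ` and the step sizes
  -- built from it do not either.
  obtain ⟨F, hF⟩ : ∃ F, F = C * (m * (Δ + 1) / δ) := ⟨_, rfl⟩
  have hΛ0 : 0 ≤ Lam1 m G M lam F := Lam1_nonneg _ _ _ _ _
  obtain ⟨Λ, hΛ⟩ : ∃ Λ, Λ = Lam1 m G M lam F := ⟨_, rfl⟩
  obtain ⟨A, hA⟩ : ∃ A : ℝ, A = m * G ^ 2 + m * Λ ^ 2 + 1 := ⟨_, rfl⟩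
  obtain ⟨P, hP⟩ : ∃ P : ℝ, P = L0hat G L M lam + L1hat m G L * Λ := ⟨_, rfl⟩
  obtain ⟨Q, hQ⟩ : ∃ Q : ℝ,
    Q = L2hat m G M lam + 1 * L1hat m G L ^ 2 * L2hat m G M lam ^ 2 := ⟨_, rfl⟩
  rw [← hΛ] at hΛ0
  have hA1 : 1 ≤ A := by
    have : 0 ≤ m * G ^ 2 + m * Λ ^ 2 := by positivity
    linarith
  have hP0 : 0 ≤ P := by rw [hP]; positivity
  have hQ0 : 0 ≤ Q := by rw [hQ]; positivity
  have hB0 : 0 ≤ m * δ ^ 3 := by positivity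
  -- Adding the denominators satisfies both upper bounds on `β`; the factor `ε²` of the second is
  -- bounded by `1`.
  obtain ⟨β, hβ⟩ : ∃ β, β = c / (A + m * δ ^ 3) := ⟨_, rfl⟩
  have hβ0 : 0 < β := by rw [hβ]; positivity
  have hβAB : β * (A + m * δ ^ 3) = c := by
    rw [hβ]
    exact div_mul_cancel₀ _ (by positivity)
  have hβA : β * A ≤ c := by
    have := mul_nonneg hβ0.le hB0
    linarith
  have hβB : β * (m * δ ^ 3) ≤ c := by
    have := mul_nonneg hβ0.le (zero_le_one.trans hA1)
    linarith
  have hβ1 : β ≤ 1 := (le_mul_of_one_le_right hβ0.le hA1).trans (hβA.trans hc1)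
  -- The three summands `γ`, `γ P`, `γ Q` add up to `c β`, so each is at most `c` and at most `β`.
  -- This yields all conditions on `γ`, with `d = ϑ = 1`.
  obtain ⟨γ, hγ⟩ : ∃ γ, γ = c * β / (1 + P + Q) := ⟨_, rfl⟩
  have hγ0 : 0 < γ := by rw [hγ]; positivity
  have hγPQ : γ + γ * P + γ * Q = c * β := by
    rw [hγ]
    field_simp
  have hγP := mul_nonneg hγ0.le hP0
  have hγQ := mul_nonneg hγ0.le hQ0
  have hcβ : c * β ≤ c := mul_le_of_le_one_right hc.le hβ1
  have hcβ' : c * β ≤ β := mul_le_of_le_one_left hβ0.le hc1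
  obtain ⟨S, hS⟩ : ∃ S, S = max (Δ / γ) (1 / β) := ⟨_, rfl⟩
  have hS1 : 1 ≤ S := by
    rw [hS]
    exact ((one_le_div hβ0).2 hβ1).trans (le_max_right _ _)
  obtain ⟨k₀, hk₀⟩ : ∃ k, k = K0hat G M lam κ := ⟨_, rfl⟩
  obtain ⟨k₁, hk₁⟩ : ∃ k, k = K1hat m := ⟨_, rfl⟩
  obtain ⟨k₂, hk₂⟩ : ∃ k, k = K2hat m G M lam κ := ⟨_, rfl⟩
  have hk₀0 : 0 ≤ k₀ := by rw [hk₀, K0hat]; positivity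
  have hk₁0 : 0 ≤ k₁ := by rw [hk₁, K1hat]; positivity
  have hk₂0 : 0 ≤ k₂ := by rw [hk₂, K2hat]; positivity
  have hk₁Λ : 0 ≤ Λ ^ 2 * k₁ := by positivity
  obtain ⟨R, hR⟩ : ∃ R, R = C * ((k₀ + k₁ + Λ ^ 2 * k₁ + k₂) / δ ^ 3) := ⟨_, rfl⟩
  have hR0 : 0 ≤ R := by rw [hR]; positivity
  -- The threshold `ε₀` collects the accuracy conditions; the `+ 1` keeps the denominator positive
  -- when `Δ = 0`. The value of `K` is the product of `2 C S / δ²` from `T` and `2 (R + 2)` from the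
  -- two batches.
  refine ⟨F, 1, 1, γ, β, min 1 (min (c / (m * √Δ + 1)) (c * √(β / γ))),
    4 * C * S * (R + 2) / δ ^ 2, by positivity, fun ε hε hε₀ => ?_⟩
  obtain ⟨hε1, hε₀'⟩ := lt_min_iff.1 hε₀
  obtain ⟨hε2, hε3⟩ := lt_min_iff.1 hε₀'
  have hδε : δ * ε ≤ ε := mul_le_of_le_one_left hε.le hδ1.le
  have hεsq : ε ^ 2 ≤ 1 := pow_le_one₀ hε.le hε1.le
  have hδsq : δ ^ 2 ≤ 1 := pow_le_one₀ hδ.le hδ1.le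
  have hδε2 : δ ^ 2 * ε ^ 2 ≤ 1 := mul_le_one₀ hδsq (sq_nonneg ε) hεsq
  have hδε20 : 0 < δ ^ 2 * ε ^ 2 := by positivity
  -- One batch size serves both estimators. The added `1` makes it positive even if `R = 0`, and
  -- rounding is absorbed by `2 ≤ 2/ε²`.
  obtain ⟨N, hN⟩ : ∃ N : ℕ, N = ⌈R / ε ^ 2⌉₊ + 1 := ⟨_, rfl⟩
  have hNge : R / ε ^ 2 ≤ N := by
    rw [hN]
    push_cast
    linarith [Nat.le_ceil (R / ε ^ 2)]
  have hNle : (N : ℝ) ≤ (R + 2) / ε ^ 2 := by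
    have h1 := (Nat.ceil_lt_add_one (show 0 ≤ R / ε ^ 2 by positivity)).le
    have h2 : 2 ≤ 2 / ε ^ 2 := (le_div_iff₀ (by positivity)).2 (by linarith)
    rw [hN, add_div]
    push_cast
    linarith
  have hRε : R / ε ^ 2 = C * ((k₀ + k₁ + Λ ^ 2 * k₁ + k₂) / (δ ^ 3 * ε ^ 2)) := by
    rw [hR]
    field_simp
  have hδ3 : 0 < δ ^ 3 * ε ^ 2 := by positivity
  have hRN : ∀ x, x ≤ (k₀ + k₁ + Λ ^ 2 * k₁ + k₂) / (δ ^ 3 * ε ^ 2) → C * x ≤ N := by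
    intro x hx
    refine (mul_le_mul_of_nonneg_left hx hC0.le).trans ?_
    rw [← hRε]
    exact hNge
  obtain ⟨I, hI⟩ : ∃ I, I = S / (δ ^ 2 * ε ^ 2) := ⟨_, rfl⟩
  have hI1 : 1 ≤ I := by
    rw [hI, le_div_iff₀ hδε20]
    linarith
  -- With `C I ≥ 1`, rounding up stays within the factor `2` allowed for `T`.
  have hCI : 1 ≤ C * I := one_le_mul_of_one_le_of_one_le hC hI1
  have hT1 : C * I ≤ ⌈C * I⌉₊ := Nat.le_ceil _
  have hT2 : (⌈C * I⌉₊ : ℝ) ≤ 2 * C * I := by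
    have := Nat.ceil_lt_add_one (show 0 ≤ C * I by linarith)
    linarith
  refine ⟨c * (δ ^ 2 * ε ^ 2), ⌈C * I⌉₊, N, N, by positivity, ?_, ?_⟩
  · refine
      { δ_pos := hδ
        δ_lt_one := hδ1
        ε_pos := hε
        ε_lt_one := hε1
        d_pos := one_pos
        ϑ_pos := one_pos
        γ_pos := hγ0
        β_pos := hβ0
        ρ_nonneg := by positivity
        N₁_pos := by rw [hN]; exact Nat.succ_pos _
        N₂_pos := by rw [hN]; exact Nat.succ_pos _
        F_ge := hF.ge
        acc_gap := ?_
        acc_step := hδε.trans hε3.le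
        ρ_le := le_rfl
        β_le := ?_
        β_le_acc := ?_
        γ_le_theta := ?_
        γ_le_eta := ?_
        γ_le_young := ?_
        γ_le_β := ?_
        N₁_ge := ?_
        N₂_ge := ?_
        T_ge := ?_
        T_le := ?_ }
    · simp only
      have h1 : 0 ≤ m * √Δ := by positivity
      have h2 := (lt_div_iff₀ (by positivity)).1 hε2
      have h3 := mul_le_mul_of_nonneg_right hδε h1
      linarith
    · simp only
      rw [← hΛ, ← hA]
      exact hβA
    · simp only
      have h1 := mul_le_of_le_one_right (mul_nonneg hβ0.le hB0) hεsq
      linarith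
    · simp only
      rw [← hΛ, ← hP]
      linarith
    · simp only
      rw [← hQ]
      linarith
    · simp only
      have hγ1 : γ ≤ 1 := by linarith
      have h1 : γ ^ 3 ≤ γ := pow_le_of_le_one hγ0.le hγ1 (by norm_num)
      have h2 := mul_le_of_le_one_right (show 0 ≤ γ ^ 3 by positivity) hδε2
      linarith
    · simp only
      linarith
    · simp only
      rw [← hΛ, ← hk₀, ← hk₁]
      refine hRN _ (max_le ?_ (max_le ?_ ?_))
      · gcongr
        linarith
      · rw [div_le_div_iff₀ hδ hδ3]
        have h1 := mul_le_mul_of_nonneg_left hδε2 (mul_nonneg hk₁0 hδ.le)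
        have h2 : 0 ≤ (k₀ + Λ ^ 2 * k₁ + k₂) * δ := by positivity
        linarith
      · gcongr
        linarith
    · simp only
      rw [← hk₂]
      refine hRN _ ?_
      gcongr
      linarith
    · rw [iterScale]
      simp only
      rw [← hS, ← hI]
      exact hT1
    · rw [iterScale]
      simp only
      rw [← hS, ← hI]
      exact hT2
  · have h1 : (N : ℝ) + N ≤ 2 * ((R + 2) / ε ^ 2) := by linarith
    refine (mul_le_mul hT2 h1 (by positivity) (by linarith)).trans (le_of_eq ?_)
    rw [hI]
    field_simp
    ring

end DRMOO

/-! ### The theorem with explicit absolute constants -/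

open DRMOO in
theorem theorem2 :
    ∃ c C : ℝ, 0 < c ∧ 0 < C ∧
      ∀ (n m : ℕ) (Ξ : Type*) [MeasurableSpace Ξ] (D : Problem n m Ξ) (G L M κ : ℝ)
        (θ₀ : Vec n) (η₀ : Vec m),
        0 < m →
        StandingAssumptions D G L M κ →
        (∀ i, BddBelow (Set.range fun p : Vec n × ℝ => dual D i p.1 p.2)) →
        -- convergence with high probability, for every admissible choice of the parameters
        (∀ (h : Params) (w₀ : Vec m) (Ω : Type*) [MeasurableSpace Ω] (μ : Measure Ω)
            [IsProbabilityMeasure μ]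
            (ξ : ℕ → Fin h.N₂ → Ω → Fin m → Ξ) (ξ' : ℕ → Fin h.N₁ → Ω → Fin m → Ξ),
            Admissible c C m G L M D.lam κ (initGap D G θ₀ η₀) h →
            w₀ ∈ simplex m →
            IsSampling D μ ξ ξ' →
            1 - h.δ ≤ μ.real {ω | avgBalancedGrad D G h.T
              (run D G h (fun t j => ξ t j ω) (fun t j => ξ' t j ω) ⟨θ₀, η₀, w₀⟩) ≤ 34 * h.ε}) ∧
        -- sample complexity of order `ε⁻⁴`, with step sizes that do not depend on `ε`
        (∀ δ : ℝ, 0 < δ → δ < 1 →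
          ∃ F d ϑ γ β ε₀ K : ℝ, 0 < ε₀ ∧ ∀ ε : ℝ, 0 < ε → ε < ε₀ →
            ∃ (ρ : ℝ) (T N₁ N₂ : ℕ), 0 < ρ ∧
              Admissible c C m G L M D.lam κ (initGap D G θ₀ η₀)
                ⟨δ, ε, F, d, ϑ, γ, β, ρ, T, N₁, N₂⟩ ∧
              (T : ℝ) * (N₁ + N₂) ≤ K / ε ^ 4) := by
  -- A small `c` makes the second-order, weight and drift terms a small fraction of `b²`; a large
  -- `C` does the same for the variances and gives `F` its margin in Markov's inequality.
  refine ⟨1 / 10000, 100000, by norm_num, by norm_num, ?_⟩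
  intro n m Ξ _ D G L M κ θ₀ η₀ hm hS hb
  refine ⟨?_, ?_⟩
  · intro h w₀ Ω _ μ _ ξ ξ' hA hw hI
    exact convergence_whp hm hS hb hA hw hI
  · intro δ hδ hδ1
    exact exists_admissible (by norm_num) (by norm_num) (by norm_num) hm hS.L0hat_pos.le
      (hS.L1hat_pos hm).le (hS.L2hat_pos hm).le hδ hδ1
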